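/- Let $n\ge 1$ be an integer, $s\in(0,1)$, $p>1$ and $\Lambda\ge 1$. There exist an exponent $\alpha\in(0,1)$ and a constant $C\ge 1$, depending only on $n$, $s$, $p$ and $\Lambda$, such that the following holds. Let $\Omega\subset\mathbb{R}^n$ be a bounded open set. Let $K:\mathbb{R}^n\times\mathbb{R}^n\to[0,+\infty)$ be measurable with $K(x,y)=K(y,x)$ and $$\frac{1}{\Lambda|x-y|^{n+sp}}\le K(x,y)\le\frac{\Lambda}{|x-y|^{n+sp}}\qquad\text{for a.e. }x,y\in\mathbb{R}^n.$$ Let $f\in L^\infty(\Omega)$ and $f_0\ge\|f\|_{L^\infty(\Omega)}$. Let $u:\mathbb{R}^n\to\mathbb{R}$ be a measurable function with $$\int_{\mathbb{R}^n}\frac{|u(x)|^{p-1}}{(1+|x|)^{n+sp}}\,dx<+\infty,\qquad u|_\Omega\in L^p(\Omega),\qquad \iint_{\mathbb{R}^{2n}\setminus(\mathbb{R}^n\setminus\Omega)^2}\frac{|u(x)-u(y)|^p}{|x-y|^{n+sp}}\,dx\,dy<+\infty,$$ and suppose that $u$ is a weak solution of $\mathcal{L}_{K,p}u=f$ in $\Omega$,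 that is, $$\frac12\int_{\mathbb{R}^n}\int_{\mathbb{R}^n}|u(x)-u(y)|^{p-2}(u(x)-u(y))(\varphi(x)-\varphi(y))K(x,y)\,dx\,dy=\int_{\Omega}f(x)\varphi(x)\,dx$$ for every $\varphi\in W^{s,p}(\mathbb{R}^n)$ whose support is contained in $\Omega$. Here $W^{s,p}(\mathbb{R}^n)$ is the space of $\varphi\in L^p(\mathbb{R}^n)$ with $\iint_{\mathbb{R}^{2n}}\frac{|\varphi(x)-\varphi(y)|^p}{|x-y|^{n+sp}}\,dx\,dy<+\infty$. Then, after modification on a set of measure zero, $u\in C^{\alpha}_{\mathrm{loc}}(\Omega)$ (that is, $u$ is $\alpha$-Hölder continuous on each compact subset of $\Omega$), and $$\|u\|_{L^\infty(B_R(x_0))}+R^\alpha[u]_{C^\alpha(B_R(x_0))}\le C\left(\frac{\|u\|_{L^p(B_{2R}(x_0))}}{R^{n/p}}+\mathrm{Tail}_{s,p}(u;x_0,R)+R^{\frac{sp}{p-1}}f_0^{\frac1{p-1}}\right)$$ for every $x_0\in\Omega$ and every $0<R<\operatorname{dist}(x_0,\partial\Omega)/2$, where $$[u]_{C^\alpha(B_R(x_0))}:=\sup_{\substack{x,y\in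 B_R(x_0)\\x\ne y}}\frac{|u(x)-u(y)|}{|x-y|^\alpha},\qquad \mathrm{Tail}_{s,p}(u;x_0,R):=\left(R^{sp}\int_{\mathbb{R}^n\setminus B_R(x_0)}\frac{|u(x)|^{p-1}}{|x-x_0|^{n+sp}}\,dx\right)^{\frac1{p-1}}.$$ -/

import Mathlib

open MeasureTheory Set
open scoped NNReal ENNReal

namespace NonlocalEq

/-- The Euclidean space of dimension `n`. -/
abbrev Eucl (n : ℕ) : Type := EuclideanSpace ℝ (Fin n)

/-- The Gagliardo integral of `u` over a set `D` of pairs of points: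
the integral over `D` of `|u x - u y| ^ p / |x - y| ^ (n + s p)`, with values in `[0, ∞]`. -/
noncomputable def gagliardo {n : ℕ} (s p : ℝ) (D : Set (Eucl n × Eucl n))
    (u : Eucl n → ℝ) : ℝ≥0∞ :=
  ∫⁻ z in D, ENNReal.ofReal (|u z.1 - u z.2| ^ p / ‖z.1 - z.2‖ ^ ((n : ℝ) + s * p))

/-- The fractional Sobolev space `W^{s,p}(U)`: functions in `L^p(U)` with finite Gagliardo
seminorm on `U`. -/
def MemFracSobolev {n : ℕ} (s p : ℝ) (U : Set (Eucl n)) (u : Eucl n → ℝ) : Prop :=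
  MemLp u (ENNReal.ofReal p) (volume.restrict U) ∧ gagliardo s p (U ×ˢ U) u < ⊤

/-- The energy space of functions `u` on the whole space with `u ∈ L^p(Ω)` and finite Gagliardo
integral over the set of all pairs of points that do not both lie outside `Ω`. -/
def MemEnergySpace {n : ℕ} (s p : ℝ) (Ω : Set (Eucl n)) (u : Eucl n → ℝ) : Prop :=
  AEMeasurable u ∧ MemLp u (ENNReal.ofReal p) (volume.restrict Ω) ∧
    gagliardo s p (Ωᶜ ×ˢ Ωᶜ)ᶜ u < ⊤

/-- The weighted space `L^{p-1}_s` of (Lebesgue) measurable functions `u` on the whole space for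
which `|u x| ^ (p - 1) / (1 + |x|) ^ (n + s p)` is integrable. -/
def MemTailSpace {n : ℕ} (s p : ℝ) (u : Eucl n → ℝ) : Prop :=
  AEMeasurable u ∧
    Integrable (fun x : Eucl n => |u x| ^ (p - 1) / (1 + ‖x‖) ^ ((n : ℝ) + s * p))

/-- The nonlocal tail of `u` at `x₀` and radius `R`. The integral converges for `u` in the
weighted space `L^{p-1}_s`. -/
noncomputable def tail {n : ℕ} (s p : ℝ) (u : Eucl n → ℝ) (x₀ : Eucl n) (R : ℝ) : ℝ :=
  (R ^ (s * p) * ∫ x in (Metric.ball x₀ R)ᶜ,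
    |u x| ^ (p - 1) / ‖x - x₀‖ ^ ((n : ℝ) + s * p)) ^ (1 / (p - 1))

/-- Admissible kernels: non-negative, (Lebesgue) measurable, symmetric, and comparable to
`|x - y| ^ (-(n + s p))` with constant `Λ`, almost everywhere. -/
structure IsKernel {n : ℕ} (s p Λ : ℝ) (K : Eucl n → Eucl n → ℝ) : Prop where
  aemeasurable : AEMeasurable (fun z : Eucl n × Eucl n => K z.1 z.2)
  nonneg : ∀ x y, 0 ≤ K x y
  symm : ∀ᵐ z : Eucl n × Eucl n, K z.1 z.2 = K z.2 z.1
  lower : ∀ᵐ z : Eucl n × Eucl n, 1 / (Λ * ‖z.1 - z.2‖ ^ ((n : ℝ) + s * p)) ≤ K z.1 z.2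
  upper : ∀ᵐ z : Eucl n × Eucl n, K z.1 z.2 ≤ Λ / ‖z.1 - z.2‖ ^ ((n : ℝ) + s * p)

/-- Weak solutions of `L_{K,p} u = f` in `Ω`: the test functions are the elements of
`W^{s,p}` of the whole space whose (closed) support is contained in `Ω`. For such test functions
and `u` in the energy space both integrals converge absolutely. -/
def IsWeakSolution {n : ℕ} (s p : ℝ) (K : Eucl n → Eucl n → ℝ) (Ω : Set (Eucl n))
    (f u : Eucl n → ℝ) : Prop :=
  MemEnergySpace s p Ω u ∧
    ∀ φ : Eucl n → ℝ, MemFracSobolev s p univ φ → tsupport φ ⊆ Ω →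
      (1 / 2) * (∫ z : Eucl n × Eucl n,
        |u z.1 - u z.2| ^ (p - 2) * (u z.1 - u z.2) * (φ z.1 - φ z.2) * K z.1 z.2) =
      ∫ x in Ω, f x * φ x

/-- `v ∈ C^α_loc(Ω)`: `v` is Hölder continuous with exponent `α` on each compact subset
of `Ω`. -/
def LocallyHolder {n : ℕ} (α : ℝ≥0) (Ω : Set (Eucl n)) (v : Eucl n → ℝ) : Prop :=
  ∀ Q : Set (Eucl n), IsCompact Q → Q ⊆ Ω → ∃ c : ℝ≥0, HolderOnWith c α v Q

/-- The Hölder seminorm of `v` on `U`, with values in `[0, ∞]`. -/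
noncomputable def holderSeminorm {n : ℕ} (α : ℝ≥0) (U : Set (Eucl n)) (v : Eucl n → ℝ) :
    ℝ≥0∞ :=
  eHolderNorm α (U.domRestrict v)

end NonlocalEq

/-!
The idea is that solutions lie in a fractional De Giorgi class and that such classes consist of
locally Hölder continuous functions. Testing the equation with `ξ ^ p * (u - k)₊`, for a cutoff
`ξ`, gives a Caccioppoli estimate in which the far part of `u` enters through its tail only. By the
fractional Sobolev inequality on small supports it improves the integrability of `(u - k)₊`, and
iterating over increasing levels `k` bounds `u` from above. The Caccioppoli estimate
also controls the product of the masses of `{u > k}` and `{u < h}`; hence `u` cannot be close to its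
supremum unless it is so on most of a ball, and its oscillation contracts by a fixed factor from
each ball to the one of a quarter of the radius, with the tails contracting along. The resulting
values at the points of `Ω` form a Hölder continuous representative.
-/

namespace NonlocalEq

section RealPowers

variable {p a b e f r : ℝ}

lemma add_rpow_le_two_rpow_mul (ha : 0 ≤ a) (hb : 0 ≤ b) (hr : 0 ≤ r) :
    (a + b) ^ r ≤ 2 ^ r * (a ^ r + b ^ r) :=
  calc (a + b) ^ r ≤ (2 * max a b) ^ r := by
        gcongr
        linarith [le_max_left a b, le_max_right a b]
    _ = 2 ^ r * max (a ^ r) (b ^ r) := by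
        rw [Real.mul_rpow zero_le_two (le_max_of_le_left ha),
          (Real.monotoneOn_rpow_Ici_of_exponent_nonneg hr).map_max ha hb]
    _ ≤ 2 ^ r * (a ^ r + b ^ r) := by
        gcongr
        exact max_le_add_of_nonneg (by positivity) (by positivity)

lemma rpow_sub_one_mul_self (ha : 0 ≤ a) (hr : r ≠ 0) : a ^ (r - 1) * a = a ^ r := by
  rw [← Real.rpow_add_one' ha (by simpa using hr), sub_add_cancel]

lemma rpow_sub_rpow_le (hp : 1 ≤ p) (he : 0 ≤ e) (hef : e ≤ f) :
    f ^ p - e ^ p ≤ p * f ^ (p - 1) * (f - e) := by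
  rcases (he.trans hef).eq_or_lt with rfl | hf
  · simp [le_antisymm hef he]
  have bernoulli := one_add_mul_self_le_rpow_one_add (s := e / f - 1)
    (by linarith [div_nonneg he hf.le]) hp
  rw [add_sub_cancel, Real.div_rpow he hf.le, le_div_iff₀ (by positivity)] at bernoulli
  have hexpand : (1 + p * (e / f - 1)) * f ^ p = f ^ p - p * f ^ (p - 1) * (f - e) := by
    rw [← rpow_sub_one_mul_self hf.le (by linarith : p ≠ 0)]
    field_simp
    ring
  linarith

lemma abs_rpow_sub_rpow_le (hp : 1 ≤ p) (he : 0 ≤ e) (he1 : e ≤ 1) (hf : 0 ≤ f) (hf1 : f ≤ 1) :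
    |e ^ p - f ^ p| ≤ p * |e - f| := by
  wlog hfe : f ≤ e generalizing e f
  · rw [abs_sub_comm, abs_sub_comm e]
    exact this hf hf1 he he1 (le_of_not_ge hfe)
  have hmono : f ^ p ≤ e ^ p := Real.rpow_le_rpow hf hfe (by linarith)
  rw [abs_of_nonneg (sub_nonneg.2 hmono), abs_of_nonneg (sub_nonneg.2 hfe)]
  refine (rpow_sub_rpow_le hp hf hfe).trans ?_
  have : 0 ≤ e - f := sub_nonneg.2 hfe
  gcongr
  exact mul_le_of_le_one_right (by linarith) (Real.rpow_le_one he he1 (by linarith))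

lemma rpow_sub_one_mul_le_add (hp : 1 ≤ p) (ha : 0 ≤ a) (hb : 0 ≤ b) :
    a ^ (p - 1) * b ≤ a ^ p + b ^ p := by
  have hp0 : p ≠ 0 := by linarith
  rcases le_total a b with h | h
  · calc a ^ (p - 1) * b ≤ b ^ (p - 1) * b := by gcongr
      _ = b ^ p := rpow_sub_one_mul_self hb hp0
      _ ≤ _ := le_add_of_nonneg_left (by positivity)
  · calc a ^ (p - 1) * b ≤ a ^ (p - 1) * a := by gcongr
      _ = a ^ p := rpow_sub_one_mul_self ha hp0
      _ ≤ _ := le_add_of_nonneg_right (by positivity)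

lemma abs_mul_sub_mul_rpow_le (hp : 0 ≤ p) (hf : |f| ≤ 1) :
    |e * a - f * b| ^ p ≤ 2 ^ p * (|a - b| ^ p + |a| ^ p * |e - f| ^ p) := by
  have hsplit : |e * a - f * b| ≤ |a - b| + |a| * |e - f| :=
    calc |e * a - f * b| = |f * (a - b) + a * (e - f)| := by ring_nf
      _ ≤ |f| * |a - b| + |a| * |e - f| := by
        simpa only [abs_mul] using abs_add_le (f * (a - b)) (a * (e - f))
      _ ≤ _ := by gcongr; exact mul_le_of_le_one_left (abs_nonneg _) hf
  rw [← Real.mul_rpow (abs_nonneg _) (abs_nonneg _)]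
  exact (Real.rpow_le_rpow (abs_nonneg _) hsplit hp).trans
    (add_rpow_le_two_rpow_mul (abs_nonneg _) (by positivity) hp)

lemma rpow_sub_one_mul_le_half_add (hp : 1 ≤ p) (ha : 0 ≤ a) (hb : 0 ≤ b) :
    a ^ (p - 1) * b ≤ a ^ p / 2 + 2 ^ p * b ^ p := by
  have hp0 : p ≠ 0 := by linarith
  rcases le_total b (a / 2) with h | h
  · calc a ^ (p - 1) * b ≤ a ^ (p - 1) * (a / 2) := by gcongr
      _ = a ^ p / 2 := by rw [← rpow_sub_one_mul_self ha hp0]; ring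
      _ ≤ _ := le_add_of_nonneg_right (by positivity)
  · calc a ^ (p - 1) * b ≤ (2 * b) ^ (p - 1) * (2 * b) := by gcongr <;> linarith
      _ = 2 ^ p * b ^ p := by
        rw [rpow_sub_one_mul_self (by positivity) hp0, Real.mul_rpow zero_le_two hb]
      _ ≤ _ := le_add_of_nonneg_left (by positivity)

lemma two_rpow_neg_add_one_mul_two_rpow (p : ℝ) : (2 : ℝ) ^ (-(p + 1)) * 2 ^ p = 1 / 2 := by
  rw [← Real.rpow_add zero_lt_two, show -(p + 1) + p = -1 by ring, Real.rpow_neg_one, one_div]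

lemma two_rpow_neg_add_one_le_half (hp : 0 ≤ p) : (2 : ℝ) ^ (-(p + 1)) ≤ 1 / 2 := by
  rw [← two_rpow_neg_add_one_mul_two_rpow p]
  exact le_mul_of_one_le_right (by positivity) (Real.one_le_rpow one_le_two hp)

lemma scaled_rpow_add_rpow_le (hp : 1 ≤ p) (ha : 0 ≤ a) (hb : 0 ≤ b) :
    2 ^ (-(p + 1)) * (a ^ (p - 1) + b ^ (p - 1)) ≤ (a + b) ^ (p - 1) := by
  have ha' : a ^ (p - 1) ≤ (a + b) ^ (p - 1) := Real.rpow_le_rpow ha (by linarith) (by linarith)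
  have hb' : b ^ (p - 1) ≤ (a + b) ^ (p - 1) := Real.rpow_le_rpow hb (by linarith) (by linarith)
  calc 2 ^ (-(p + 1)) * (a ^ (p - 1) + b ^ (p - 1))
      ≤ 1 / 2 * ((a + b) ^ (p - 1) + (a + b) ^ (p - 1)) := by
        gcongr
        exact two_rpow_neg_add_one_le_half (by linarith)
    _ = (a + b) ^ (p - 1) := by ring

/-- The odd power `t ↦ |t| ^ (p - 2) * t` of exponent `p - 1`, which the weak formulation applies
to the differences of the solution. -/
noncomputable def oddPow (p t : ℝ) : ℝ := |t| ^ (p - 2) * t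

lemma oddPow_of_nonneg (hp : p ≠ 1) (ha : 0 ≤ a) : oddPow p a = a ^ (p - 1) := by
  rw [oddPow, abs_of_nonneg ha, show p - 2 = p - 1 - 1 by ring,
    rpow_sub_one_mul_self ha (sub_ne_zero.2 hp)]

lemma oddPow_neg (p t : ℝ) : oddPow p (-t) = -oddPow p t := by
  rw [oddPow, oddPow, abs_neg, mul_neg]

lemma abs_oddPow (hp : p ≠ 1) (t : ℝ) : |oddPow p t| = |t| ^ (p - 1) := by
  rw [← oddPow_of_nonneg hp (abs_nonneg t), oddPow, oddPow, abs_mul, abs_abs,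
    abs_of_nonneg (Real.rpow_nonneg (abs_nonneg t) _)]

lemma neg_rpow_le_oddPow (hp : 1 < p) (hb : 0 ≤ b) (hab : -b ≤ a) :
    -b ^ (p - 1) ≤ oddPow p a := by
  rcases le_total 0 a with ha | ha
  · rw [oddPow_of_nonneg hp.ne' ha]
    linarith [Real.rpow_nonneg ha (p - 1), Real.rpow_nonneg hb (p - 1)]
  · rw [← neg_neg a, oddPow_neg, oddPow_of_nonneg hp.ne' (neg_nonneg.2 ha), neg_le_neg_iff]
    exact Real.rpow_le_rpow (neg_nonneg.2 ha) (neg_le.1 hab) (by linarith)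

lemma abs_mul_sub_mul_le_max_mul (hb : 0 ≤ b) (hba : b ≤ a) (he : 0 ≤ e) :
    |e * a - f * b| ≤ max e f * (a - b) + |e - f| * a := by
  rcases max_cases e f with ⟨h, hfe⟩ | ⟨h, hef⟩
  · rw [h, abs_of_nonneg (sub_nonneg.2 hfe), abs_le]
    have := mul_nonneg he (sub_nonneg.2 hba)
    constructor <;> nlinarith
  · rw [h, abs_of_nonpos (sub_nonpos.2 hef.le), abs_le]
    have := mul_nonneg (he.trans hef.le) (sub_nonneg.2 hba)
    constructor <;> nlinarith

lemma max_rpow_mul_sub_le (hp : 1 ≤ p) (ha : 0 ≤ a) (hb : 0 ≤ b) (he : 0 ≤ e) (hf : 0 ≤ f) :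
    max e f ^ p * (a - b) ≤
      e ^ p * a - f ^ p * b + p * max e f ^ (p - 1) * |e - f| * a := by
  set m := max e f with hm
  have : 0 ≤ m := le_max_of_le_left he
  have hfm : f ^ p ≤ m ^ p := Real.rpow_le_rpow hf (le_max_right e f) (by linarith)
  have hme : m - e ≤ |e - f| := by
    rcases max_choice e f with h | h <;> rw [hm, h]
    · simp
    · rw [abs_sub_comm]; exact le_abs_self _
  have hweight : m ^ p - e ^ p ≤ p * m ^ (p - 1) * |e - f| :=
    (rpow_sub_rpow_le hp he (le_max_left e f)).trans (by gcongr)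
  linarith [mul_le_mul_of_nonneg_right hweight ha, mul_le_mul_of_nonneg_right hfm hb]

-- Writing `m = max e f`, both differences reduce to the single quantity `m (a - b)`: it controls
-- `e a - f b` up to `|e - f| a`, and the weights `e ^ p`, `f ^ p` differ from `m ^ p` by a
-- Bernoulli error that Young's inequality absorbs.
lemma rpow_abs_sub_le_weighted (hp : 1 ≤ p) (hb : 0 ≤ b) (hba : b ≤ a) (he : 0 ≤ e)
    (hf : 0 ≤ f) :
    2 ^ (-(p + 1)) * |e * a - f * b| ^ p ≤
      (a - b) ^ (p - 1) * (e ^ p * a - f ^ p * b) +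
        (2 ^ p * p ^ p + 1) * (a ^ p * |e - f| ^ p) := by
  set m := max e f
  have ha : 0 ≤ a := hb.trans hba
  have hD : 0 ≤ a - b := sub_nonneg.2 hba
  have hm0 : 0 ≤ m := le_max_of_le_left he
  have hp0 : 0 ≤ p := by linarith
  have hpow : 2 ^ (-(p + 1)) * |e * a - f * b| ^ p ≤
      (m * (a - b)) ^ p / 2 + (|e - f| * a) ^ p / 2 := by
    calc _ ≤ 2 ^ (-(p + 1)) * (2 ^ p * ((m * (a - b)) ^ p + (|e - f| * a) ^ p)) := by
          gcongr
          exact (Real.rpow_le_rpow (abs_nonneg _) (abs_mul_sub_mul_le_max_mul hb hba he) hp0).trans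
            (add_rpow_le_two_rpow_mul (by positivity) (by positivity) hp0)
      _ = _ := by rw [← mul_assoc, two_rpow_neg_add_one_mul_two_rpow]; ring
  have hYoung : (a - b) ^ (p - 1) * (p * m ^ (p - 1) * |e - f| * a) ≤
      (m * (a - b)) ^ p / 2 + 2 ^ p * p ^ p * (a ^ p * |e - f| ^ p) := by
    have := rpow_sub_one_mul_le_half_add hp (mul_nonneg hm0 hD)
      (b := p * (|e - f| * a)) (by positivity)
    rw [Real.mul_rpow hp0 (by positivity), Real.mul_rpow (abs_nonneg _) ha,
      Real.mul_rpow hm0 hD (z := p - 1)] at this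
    linarith
  have hmD : (m * (a - b)) ^ p = (a - b) ^ (p - 1) * (m ^ p * (a - b)) := by
    rw [Real.mul_rpow hm0 hD, ← rpow_sub_one_mul_self hD (by linarith : p ≠ 0)]
    ring
  have hscaled := mul_le_mul_of_nonneg_left (max_rpow_mul_sub_le hp ha hb he hf)
    (by positivity : 0 ≤ (a - b) ^ (p - 1))
  have herr : 0 ≤ a ^ p * |e - f| ^ p := by positivity
  rw [Real.mul_rpow (abs_nonneg _) ha] at hpow
  linarith

lemma oddPow_cutoff_of_le (hp : 1 < p) (hba : b ≤ a) (he : 0 ≤ e) (hf : 0 ≤ f) :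
    2 ^ (-(p + 1)) * (|e * max a 0 - f * max b 0| ^ p +
        (max (-b) 0 ^ (p - 1) * max a 0 * e ^ p + max (-a) 0 ^ (p - 1) * max b 0 * f ^ p)) ≤
      oddPow p (a - b) * (e ^ p * max a 0 - f ^ p * max b 0) +
        (2 ^ p * p ^ p + 1) * ((max a 0 ^ p + max b 0 ^ p) * |e - f| ^ p) := by
  have hp0 : p ≠ 0 := by linarith
  rw [oddPow_of_nonneg hp.ne' (sub_nonneg.2 hba)]
  rcases le_or_gt a 0 with ha | ha
  · simp [max_eq_right ha, max_eq_right (hba.trans ha), Real.zero_rpow hp0]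
  rcases le_or_gt b 0 with hb | hb
  · have hnb : 0 ≤ -b := neg_nonneg.2 hb
    have hcoeff := scaled_rpow_add_rpow_le hp.le ha.le hnb
    rw [← sub_eq_add_neg] at hcoeff
    simp only [max_eq_left ha.le, max_eq_right hb, max_eq_left hnb, mul_zero, zero_mul, sub_zero,
      add_zero, Real.zero_rpow hp0]
    rw [abs_of_nonneg (by positivity), Real.mul_rpow he ha.le, ← rpow_sub_one_mul_self ha.le hp0]
    have hscaled := mul_le_mul_of_nonneg_right hcoeff (by positivity : 0 ≤ e ^ p * a)
    have herr : 0 ≤ (2 ^ p * p ^ p + 1) * (a ^ (p - 1) * a * |e - f| ^ p) := by positivity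
    linarith
  · simp only [max_eq_left ha.le, max_eq_left hb.le, max_eq_right (neg_nonpos.2 ha.le),
      max_eq_right (neg_nonpos.2 hb.le), Real.zero_rpow (sub_ne_zero.2 hp.ne'), zero_mul, add_zero]
    refine (rpow_abs_sub_le_weighted hp.le hb.le hba he hf).trans ?_
    gcongr
    exact le_add_of_nonneg_right (by positivity)

lemma oddPow_cutoff (a b : ℝ) (hp : 1 < p) (he : 0 ≤ e) (hf : 0 ≤ f) :
    2 ^ (-(p + 1)) * (|e * max a 0 - f * max b 0| ^ p +
        (max (-b) 0 ^ (p - 1) * max a 0 * e ^ p + max (-a) 0 ^ (p - 1) * max b 0 * f ^ p)) ≤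
      oddPow p (a - b) * (e ^ p * max a 0 - f ^ p * max b 0) +
        (2 ^ p * p ^ p + 1) * ((max a 0 ^ p + max b 0 ^ p) * |e - f| ^ p) := by
  rcases le_total b a with h | h
  · exact oddPow_cutoff_of_le hp h he hf
  · have := oddPow_cutoff_of_le hp h hf he
    rw [← neg_sub a b, oddPow_neg, abs_sub_comm, abs_sub_comm f e] at this
    linarith

lemma rpow_add_negPart_rpow_le_oddPow_sub (hp : 1 < p) (ha : 0 ≤ a) (b : ℝ) :
    2 ^ (-(p + 1)) * (a ^ (p - 1) + max (-b) 0 ^ (p - 1)) ≤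
      oddPow p (a - b) + 2 * max b 0 ^ (p - 1) := by
  have hp1 : 0 ≤ p - 1 := by linarith
  rcases le_total b 0 with hb | hb
  · have hnb : 0 ≤ -b := neg_nonneg.2 hb
    rw [max_eq_right hb, max_eq_left hnb, oddPow_of_nonneg hp.ne' (by linarith)]
    rw [sub_eq_add_neg]
    exact (scaled_rpow_add_rpow_le hp.le ha hnb).trans (le_add_of_nonneg_right (by positivity))
  · rw [max_eq_left hb, max_eq_right (neg_nonpos.2 hb), Real.zero_rpow (by linarith), add_zero]
    have hpos : max (a - b) 0 ^ (p - 1) - b ^ (p - 1) ≤ oddPow p (a - b) := by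
      rcases le_total b a with h | h
      · rw [max_eq_left (sub_nonneg.2 h), oddPow_of_nonneg hp.ne' (sub_nonneg.2 h)]
        exact sub_le_self _ (by positivity)
      · rw [max_eq_right (sub_nonpos.2 h), Real.zero_rpow (by linarith), zero_sub]
        exact neg_rpow_le_oddPow hp hb (by linarith)
    have hsplit : 2 ^ (-(p + 1)) * a ^ (p - 1) ≤ max (a - b) 0 ^ (p - 1) + b ^ (p - 1) :=
      calc 2 ^ (-(p + 1)) * a ^ (p - 1)
          ≤ 2 ^ (-(p + 1)) * (max (a - b) 0 + b) ^ (p - 1) := by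
            gcongr
            linarith [le_max_left (a - b) 0]
        _ ≤ 2 ^ (-(p + 1)) * (2 ^ p * (max (a - b) 0 ^ (p - 1) + b ^ (p - 1))) := by
            gcongr
            refine (add_rpow_le_two_rpow_mul (le_max_right _ _) hb hp1).trans ?_
            gcongr
            · exact one_le_two
            · linarith
        _ = 1 / 2 * (max (a - b) 0 ^ (p - 1) + b ^ (p - 1)) := by
            rw [← mul_assoc, two_rpow_neg_add_one_mul_two_rpow]
        _ ≤ _ := by
            have : 0 ≤ max (a - b) 0 ^ (p - 1) + b ^ (p - 1) := by positivity
            linarith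
    linarith

lemma oddPow_cutoff_tail (a b : ℝ) (hp : 1 < p) (he : 0 ≤ e) :
    2 ^ (-(p + 1)) * ((e * max a 0) ^ p + max (-b) 0 ^ (p - 1) * max a 0 * e ^ p) ≤
      oddPow p (a - b) * (e ^ p * max a 0) + 2 * (max b 0 ^ (p - 1) * max a 0 * e ^ p) := by
  have hp0 : p ≠ 0 := by linarith
  rcases le_total a 0 with ha | ha
  · simp [max_eq_right ha, Real.zero_rpow hp0]
  have := mul_le_mul_of_nonneg_right (rpow_add_negPart_rpow_le_oddPow_sub hp ha b)
    (by positivity : 0 ≤ e ^ p * a)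
  rw [max_eq_left ha, Real.mul_rpow he ha, ← rpow_sub_one_mul_self ha hp0]
  linarith

end RealPowers

section RadialIntegrals

variable {n : ℕ} {p r γ σ : ℝ}

/-- The volume of the unit ball of `Eucl n`, as a real number. -/
noncomputable def unitVol (n : ℕ) : ℝ := volume.real (Metric.ball (0 : Eucl n) 1)

lemma unitVol_pos (n : ℕ) : 0 < unitVol n :=
  ENNReal.toReal_pos (Metric.measure_ball_pos _ _ one_pos).ne' measure_ball_lt_top.ne

lemma volume_ball_eq (x : Eucl n) (hr : 0 < r) :
    volume (Metric.ball x r) = ENNReal.ofReal (unitVol n * r ^ (n : ℝ)) := by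
  rw [Measure.addHaar_ball_of_pos volume x hr, finrank_euclideanSpace_fin, Real.rpow_natCast,
    mul_comm, ENNReal.ofReal_mul (unitVol_pos n).le, unitVol, measureReal_def,
    ENNReal.ofReal_toReal measure_ball_lt_top.ne]

lemma lintegral_eq_mul_lintegral_comp_smul (F : Eucl n → ℝ≥0∞) (hr : 0 < r) :
    ∫⁻ y, F y = ENNReal.ofReal (r ^ (n : ℝ)) * ∫⁻ z, F (r • z) := by
  have hmap : ∫⁻ z, F (r • z) = ∫⁻ y, F y ∂(Measure.map (r • ·) volume) :=
    (lintegral_map_equiv F (Homeomorph.smulOfNeZero r hr.ne').toMeasurableEquiv).symm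
  rw [hmap, Measure.map_addHaar_smul volume hr.ne', lintegral_smul_measure, smul_eq_mul,
    ← mul_assoc, finrank_euclideanSpace_fin, Real.rpow_natCast,
    ← ENNReal.ofReal_mul (by positivity), abs_of_pos (by positivity),
    mul_inv_cancel₀ (by positivity), ENNReal.ofReal_one, one_mul]

lemma lintegral_radial_scale (g : ℝ → ℝ≥0∞) (q : ℝ) (x₀ : Eucl n) (hr : 0 < r) :
    ∫⁻ y, g (‖y - x₀‖ / r) * ENNReal.ofReal (‖y - x₀‖ ^ (-q)) =
      ENNReal.ofReal (r ^ ((n : ℝ) - q)) *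
        ∫⁻ z : Eucl n, g ‖z‖ * ENNReal.ofReal (‖z‖ ^ (-q)) := by
  rw [lintegral_sub_right_eq_self (fun y => g (‖y‖ / r) * ENNReal.ofReal (‖y‖ ^ (-q))) x₀,
    lintegral_eq_mul_lintegral_comp_smul _ hr, sub_eq_add_neg, Real.rpow_add hr,
    ENNReal.ofReal_mul (by positivity), mul_assoc]
  congr 1
  rw [← lintegral_const_mul' _ _ ENNReal.ofReal_ne_top]
  refine lintegral_congr fun z => ?_
  rw [norm_smul, Real.norm_of_nonneg hr.le, mul_div_cancel_left₀ _ hr.ne',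
    Real.mul_rpow hr.le (norm_nonneg _), ENNReal.ofReal_mul (by positivity)]
  ring

lemma exists_lintegral_radial_le {g : ℝ → ℝ≥0∞}
    (hg : ∫⁻ z : Eucl n, g ‖z‖ * ENNReal.ofReal (‖z‖ ^ (-((n : ℝ) + σ))) < ⊤) :
    ∃ C : ℝ, 1 ≤ C ∧ ∀ (x₀ : Eucl n) (r : ℝ), 0 < r →
      ∫⁻ y, g (‖y - x₀‖ / r) * ENNReal.ofReal (‖y - x₀‖ ^ (-((n : ℝ) + σ))) ≤
        ENNReal.ofReal (C * r ^ (-σ)) := by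
  refine ⟨max 1 (∫⁻ z : Eucl n, g ‖z‖ * ENNReal.ofReal (‖z‖ ^ (-((n : ℝ) + σ)))).toReal,
    le_max_left _ _, fun x₀ r hr => ?_⟩
  rw [lintegral_radial_scale g _ x₀ hr, mul_comm, ENNReal.ofReal_mul (by positivity),
    sub_add_cancel_left]
  gcongr
  exact ENNReal.le_ofReal_iff_toReal_le hg.ne (by positivity) |>.2 (le_max_right _ _)

lemma integrable_radial (hn : 1 ≤ n) {G : ℝ → ℝ}
    (h : IntegrableOn (fun t => t ^ ((n : ℝ) - 1) * G t) (Ioi 0)) :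
    Integrable (fun z : Eucl n => G ‖z‖) := by
  have : Nonempty (Fin n) := ⟨⟨0, hn⟩⟩
  rw [integrable_fun_norm_addHaar, finrank_euclideanSpace_fin]
  refine h.congr_fun (fun t _ => ?_) measurableSet_Ioi
  rw [smul_eq_mul, ← Real.rpow_natCast, Nat.cast_sub hn, Nat.cast_one]

lemma lintegral_min_kernel_lt_top (hn : 1 ≤ n) (hσ : 0 < σ) (hσp : σ < p) :
    ∫⁻ z : Eucl n, ENNReal.ofReal (min 1 ‖z‖ ^ p) *
      ENNReal.ofReal (‖z‖ ^ (-((n : ℝ) + σ))) < ⊤ := by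
  have near : IntegrableOn (fun t : ℝ =>
      t ^ ((n : ℝ) - 1) * (min 1 t ^ p * t ^ (-((n : ℝ) + σ)))) (Ioc 0 1) := by
    have : IntegrableOn (fun t : ℝ => t ^ (p - σ - 1)) (Ioc 0 1) := by
      rw [← intervalIntegrable_iff_integrableOn_Ioc_of_le zero_le_one]
      exact intervalIntegral.intervalIntegrable_rpow' (by linarith)
    refine this.congr_fun (fun t ht => ?_) measurableSet_Ioc
    simp only [min_eq_right ht.2]
    rw [← Real.rpow_add ht.1, ← Real.rpow_add ht.1]
    ring_nf
  have far : IntegrableOn (fun t : ℝ =>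
      t ^ ((n : ℝ) - 1) * (min 1 t ^ p * t ^ (-((n : ℝ) + σ)))) (Ioi 1) := by
    have : IntegrableOn (fun t : ℝ => t ^ (-1 - σ)) (Ioi 1) :=
      integrableOn_Ioi_rpow_of_lt (by linarith) one_pos
    refine this.congr_fun (fun t ht => ?_) measurableSet_Ioi
    have ht1 : 1 < t := ht
    simp only [min_eq_left ht1.le, Real.one_rpow, one_mul]
    rw [← Real.rpow_add (one_pos.trans ht1)]
    ring_nf
  have hint := integrable_radial hn (G := fun t => min 1 t ^ p * t ^ (-((n : ℝ) + σ))) <| by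
    rw [← Ioc_union_Ioi_eq_Ioi zero_le_one]
    exact near.union far
  refine lt_of_eq_of_lt (lintegral_congr fun z => ?_) hint.lintegral_lt_top
  rw [ENNReal.ofReal_mul (by positivity)]

lemma lintegral_growth_kernel_lt_top (hn : 1 ≤ n) (hγ : γ < σ) :
    ∫⁻ z : Eucl n, (Ici (1 : ℝ)).indicator (fun t => ENNReal.ofReal (t ^ γ)) ‖z‖ *
      ENNReal.ofReal (‖z‖ ^ (-((n : ℝ) + σ))) < ⊤ := by
  have hint : Integrable (fun z : Eucl n =>
      (Ici (1 : ℝ)).indicator (fun t => t ^ (γ + -((n : ℝ) + σ))) ‖z‖) := by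
    apply integrable_radial hn
    have hpow : IntegrableOn (fun t : ℝ => t ^ (-1 + (γ - σ))) (Ici 1) := by
      rw [integrableOn_Ici_iff_integrableOn_Ioi]
      exact integrableOn_Ioi_rpow_of_lt (by linarith) one_pos
    refine ((integrable_indicator_iff measurableSet_Ici).2 hpow).integrableOn.congr_fun
      (fun t ht => ?_) measurableSet_Ioi
    by_cases h : t ∈ Ici (1 : ℝ)
    · simp only [indicator_of_mem h]
      rw [← Real.rpow_add ht]
      ring_nf
    · simp only [indicator_of_notMem h, mul_zero]
  refine lt_of_eq_of_lt (lintegral_congr fun z => ?_) hint.lintegral_lt_top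
  by_cases h : ‖z‖ ∈ Ici (1 : ℝ)
  · rw [indicator_of_mem h, indicator_of_mem h,
      ← ENNReal.ofReal_mul (Real.rpow_nonneg (norm_nonneg z) γ), Real.rpow_add (one_pos.trans_le h)]
  · simp only [indicator_of_notMem h, zero_mul, ENNReal.ofReal_zero]

lemma exists_lintegral_min_kernel_le (hn : 1 ≤ n) (hσ : 0 < σ) (hσp : σ < p) :
    ∃ C : ℝ, 1 ≤ C ∧ ∀ (x : Eucl n) (L : ℝ), 0 < L →
      ∫⁻ y, ENNReal.ofReal (min 1 (L * ‖y - x‖) ^ p * ‖y - x‖ ^ (-((n : ℝ) + σ))) ≤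
        ENNReal.ofReal (C * L ^ σ) := by
  obtain ⟨C, hC, h⟩ := exists_lintegral_radial_le (n := n)
    (g := fun t => ENNReal.ofReal (min 1 t ^ p)) (lintegral_min_kernel_lt_top hn hσ hσp)
  refine ⟨C, hC, fun x L hL => ?_⟩
  have hscaled := h x L⁻¹ (inv_pos.2 hL)
  rw [Real.inv_rpow hL.le, Real.rpow_neg hL.le, inv_inv] at hscaled
  refine le_of_eq_of_le (lintegral_congr fun y => ?_) hscaled
  rw [div_inv_eq_mul, mul_comm L, ENNReal.ofReal_mul (by positivity)]

lemma exists_lintegral_growth_kernel_le (hn : 1 ≤ n) (hγ : γ < σ) :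
    ∃ C : ℝ, 1 ≤ C ∧ ∀ (x₀ : Eucl n) (r : ℝ), 0 < r →
      ∫⁻ y in (Metric.ball x₀ r)ᶜ,
        ENNReal.ofReal ((‖y - x₀‖ / r) ^ γ * ‖y - x₀‖ ^ (-((n : ℝ) + σ))) ≤
        ENNReal.ofReal (C * r ^ (-σ)) := by
  obtain ⟨C, hC, h⟩ := exists_lintegral_radial_le (lintegral_growth_kernel_lt_top hn hγ)
  refine ⟨C, hC, fun x₀ r hr => le_of_eq_of_le ?_ (h x₀ r hr)⟩
  rw [← lintegral_indicator Metric.isOpen_ball.measurableSet.compl]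
  refine lintegral_congr fun y => ?_
  have hmem : y ∈ (Metric.ball x₀ r)ᶜ ↔ ‖y - x₀‖ / r ∈ Ici (1 : ℝ) := by
    rw [mem_compl_iff, mem_ball_iff_norm, not_lt, mem_Ici, one_le_div hr]
  by_cases hy : y ∈ (Metric.ball x₀ r)ᶜ
  · rw [indicator_of_mem hy, indicator_of_mem (hmem.1 hy), ENNReal.ofReal_mul (by positivity)]
  · rw [indicator_of_notMem hy, indicator_of_notMem (mt hmem.2 hy), zero_mul]

lemma exists_lintegral_kernel_compl_ball_le (hn : 1 ≤ n) (hσ : 0 < σ) :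
    ∃ C : ℝ, 1 ≤ C ∧ ∀ (x₀ : Eucl n) (r : ℝ), 0 < r →
      ∫⁻ y in (Metric.ball x₀ r)ᶜ, ENNReal.ofReal (‖y - x₀‖ ^ (-((n : ℝ) + σ))) ≤
        ENNReal.ofReal (C * r ^ (-σ)) := by
  simpa only [Real.rpow_zero, one_mul] using exists_lintegral_growth_kernel_le hn hσ

end RadialIntegrals

section FaberKrahn

variable {n : ℕ} {p q r σ a : ℝ} {h : Eucl n → ℝ}

lemma rpow_mul_volume_zeros_le_lintegral (hm : Measurable h) (hq : 0 ≤ q) {x : Eucl n}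
    (hx : h x ≠ 0) :
    ENNReal.ofReal (|h x| ^ p * r ^ (-q)) * volume (Metric.ball x r \ {y | h y ≠ 0}) ≤
      ∫⁻ y, ENNReal.ofReal (|h x - h y| ^ p * ‖x - y‖ ^ (-q)) := by
  have hne : MeasurableSet {y | h y ≠ 0} := (measurableSet_singleton (0 : ℝ)).compl.preimage hm
  rw [← setLIntegral_const]
  refine (setLIntegral_mono' (Metric.isOpen_ball.measurableSet.diff hne) fun y hy => ?_).trans
    (setLIntegral_le_lintegral _ _)
  have hy0 : h y = 0 := by simpa using hy.2
  have hxy : 0 < ‖x - y‖ := norm_pos_iff.2 (sub_ne_zero.2 fun hxy => hx (hxy ▸ hy0))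
  have hlt : ‖x - y‖ < r := by rw [norm_sub_rev]; exact mem_ball_iff_norm.1 hy.1
  rw [hy0, sub_zero]
  gcongr ENNReal.ofReal (_ * ?_)
  exact Real.rpow_le_rpow_of_nonpos hxy hlt.le (by linarith)

-- A ball of twice the volume of the support meets the zero set of `h` in at least half of its
-- volume.
lemma rpow_le_lintegral_of_volume_support_le (hp : p ≠ 0) (hq : 0 ≤ q) (hm : Measurable h)
    (ha : 0 < a) (hsupp : volume {y | h y ≠ 0} ≤ ENNReal.ofReal a) (hr : 0 < r)
    (hvol : unitVol n * r ^ (n : ℝ) = 2 * a) (x : Eucl n) :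
    ENNReal.ofReal (|h x| ^ p) ≤ ENNReal.ofReal (r ^ q / a) *
      ∫⁻ y, ENNReal.ofReal (|h x - h y| ^ p * ‖x - y‖ ^ (-q)) := by
  by_cases hx : h x = 0
  · simp [hx, Real.zero_rpow hp]
  have hzeros : ENNReal.ofReal a ≤ volume (Metric.ball x r \ {y | h y ≠ 0}) :=
    calc ENNReal.ofReal a = ENNReal.ofReal (2 * a) - ENNReal.ofReal a := by
          rw [← ENNReal.ofReal_sub _ ha.le]; congr 1; ring
      _ ≤ volume (Metric.ball x r) - volume {y | h y ≠ 0} := by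
          rw [volume_ball_eq x hr, hvol]; gcongr
      _ ≤ _ := le_measure_sdiff
  calc ENNReal.ofReal (|h x| ^ p)
      = ENNReal.ofReal (r ^ q / a) *
          (ENNReal.ofReal (|h x| ^ p * r ^ (-q)) * ENNReal.ofReal a) := by
        rw [← ENNReal.ofReal_mul (by positivity), ← ENNReal.ofReal_mul (by positivity),
          Real.rpow_neg hr.le]
        congr 1
        field_simp
    _ ≤ _ := by
        gcongr
        exact le_trans (by gcongr) (rpow_mul_volume_zeros_le_lintegral (r := r) hm hq hx)

lemma exists_faberKrahn (hn : 1 ≤ n) (hσ : 0 < σ) (hp : p ≠ 0) :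
    ∃ C : ℝ, 1 ≤ C ∧ ∀ (h : Eucl n → ℝ), Measurable h → ∀ a : ℝ, 0 < a →
      volume {x | h x ≠ 0} ≤ ENNReal.ofReal a →
      ∫⁻ x, ENNReal.ofReal (|h x| ^ p) ≤ ENNReal.ofReal (C * a ^ (σ / n)) *
        ∫⁻ x, ∫⁻ y, ENNReal.ofReal (|h x - h y| ^ p * ‖x - y‖ ^ (-((n : ℝ) + σ))) := by
  have hn0 : (0 : ℝ) < n := by exact_mod_cast hn
  have hω : 0 < unitVol n := unitVol_pos n
  refine ⟨max 1 ((2 / unitVol n) ^ (((n : ℝ) + σ) / n)), le_max_left _ _,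
    fun h hm a ha hsupp => ?_⟩
  set r := (2 / unitVol n * a) ^ (1 / (n : ℝ)) with hr
  have hvol : unitVol n * r ^ (n : ℝ) = 2 * a := by
    rw [hr, ← Real.rpow_mul (by positivity), one_div_mul_cancel hn0.ne', Real.rpow_one]
    field_simp
  have hscale : r ^ ((n : ℝ) + σ) / a = (2 / unitVol n) ^ (((n : ℝ) + σ) / n) * a ^ (σ / n) := by
    rw [hr, ← Real.rpow_mul (by positivity), one_div_mul_eq_div,
      Real.mul_rpow (by positivity) ha.le, add_div _ _ (n : ℝ), div_self hn0.ne',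
      Real.rpow_one_add' ha.le (by positivity)]
    field_simp
  calc ∫⁻ x, ENNReal.ofReal (|h x| ^ p) ≤ ∫⁻ x, ENNReal.ofReal (r ^ ((n : ℝ) + σ) / a) *
      ∫⁻ y, ENNReal.ofReal (|h x - h y| ^ p * ‖x - y‖ ^ (-((n : ℝ) + σ))) :=
        lintegral_mono <| rpow_le_lintegral_of_volume_support_le hp (by positivity) hm ha hsupp
          (by positivity) hvol
    _ = ENNReal.ofReal (r ^ ((n : ℝ) + σ) / a) * ∫⁻ x,
      ∫⁻ y, ENNReal.ofReal (|h x - h y| ^ p * ‖x - y‖ ^ (-((n : ℝ) + σ))) :=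
        lintegral_const_mul' _ _ ENNReal.ofReal_ne_top
    _ ≤ _ := by
      rw [hscale]
      gcongr
      exact le_max_right _ _

end FaberKrahn

section Cutoff

variable {E : Type*} [SeminormedAddCommGroup E] (x₀ : E) (r ρ : ℝ)

/-- The cutoff function between the balls of radii `r < ρ` about `x₀`: it equals `1` on the smaller
ball, has Lipschitz constant `2 / (ρ - r)` and vanishes already at distance `(r + ρ) / 2` from `x₀`,
so that its closed support lies in the open ball of radius `ρ`. -/
noncomputable def cutoff (x : E) : ℝ := max 0 (min 1 (2 / (ρ - r) * ((r + ρ) / 2 - ‖x - x₀‖)))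

lemma cutoff_nonneg (x : E) : 0 ≤ cutoff x₀ r ρ x := le_max_left _ _

lemma cutoff_le_one (x : E) : cutoff x₀ r ρ x ≤ 1 := max_le zero_le_one (min_le_left _ _)

lemma cutoff_rpow_le_one {p : ℝ} (hp : 0 ≤ p) (x : E) : cutoff x₀ r ρ x ^ p ≤ 1 :=
  Real.rpow_le_one (cutoff_nonneg ..) (cutoff_le_one ..) hp

lemma continuous_cutoff : Continuous (cutoff x₀ r ρ) := by unfold cutoff; fun_prop

variable {x₀ r ρ}

lemma cutoff_eq_zero (hrρ : r ≤ ρ) {x : E} (hx : (r + ρ) / 2 ≤ ‖x - x₀‖) :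
    cutoff x₀ r ρ x = 0 :=
  max_eq_left <| (min_le_right _ _).trans <|
    mul_nonpos_of_nonneg_of_nonpos (div_nonneg zero_le_two (sub_nonneg.2 hrρ)) (sub_nonpos.2 hx)

lemma cutoff_eq_zero_of_notMem_ball (hrρ : r ≤ ρ) {x : E} (hx : x ∉ Metric.ball x₀ ρ) :
    cutoff x₀ r ρ x = 0 := by
  rw [mem_ball_iff_norm, not_lt] at hx
  exact cutoff_eq_zero hrρ (by linarith)

lemma cutoff_eq_one_of_mem_ball (hrρ : r < ρ) {x : E} (hx : x ∈ Metric.ball x₀ r) :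
    cutoff x₀ r ρ x = 1 := by
  have h : 1 ≤ 2 / (ρ - r) * ((r + ρ) / 2 - ‖x - x₀‖) := by
    rw [div_mul_eq_mul_div, one_le_div (sub_pos.2 hrρ)]
    linarith [mem_ball_iff_norm.1 hx]
  rw [cutoff, min_eq_left h, max_eq_right zero_le_one]

lemma abs_cutoff_sub_le (hrρ : r ≤ ρ) (x y : E) :
    |cutoff x₀ r ρ x - cutoff x₀ r ρ y| ≤ min 1 (2 / (ρ - r) * ‖y - x‖) := by
  refine le_min (abs_sub_le_of_nonneg_of_le (cutoff_nonneg ..) (cutoff_le_one ..)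
    (cutoff_nonneg ..) (cutoff_le_one ..)) ?_
  have hL : 0 ≤ 2 / (ρ - r) := div_nonneg zero_le_two (sub_nonneg.2 hrρ)
  have hlip : |2 / (ρ - r) * ((r + ρ) / 2 - ‖x - x₀‖) - 2 / (ρ - r) * ((r + ρ) / 2 - ‖y - x₀‖)| ≤
      2 / (ρ - r) * ‖y - x‖ := by
    rw [← mul_sub, abs_mul, abs_of_nonneg hL, sub_sub_sub_cancel_left]
    gcongr
    simpa only [sub_sub_sub_cancel_right] using abs_norm_sub_norm_le (y - x₀) (x - x₀)
  have h0 : |(0 : ℝ) - 0| ≤ 2 / (ρ - r) * ‖y - x‖ := by rw [sub_zero, abs_zero]; positivity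
  have h1 : |(1 : ℝ) - 1| ≤ 2 / (ρ - r) * ‖y - x‖ := by rw [sub_self, abs_zero]; positivity
  exact (abs_max_sub_max_le_max _ _ _ _).trans <|
    max_le h0 <| (abs_min_sub_min_le_max _ _ _ _).trans <| max_le h1 hlip

lemma abs_cutoff_rpow_sub_le {p : ℝ} (hp : 1 ≤ p) (hrρ : r ≤ ρ) (x y : E) :
    |cutoff x₀ r ρ x ^ p - cutoff x₀ r ρ y ^ p| ≤ p * min 1 (2 / (ρ - r) * ‖y - x‖) :=
  (abs_rpow_sub_rpow_le hp (cutoff_nonneg ..) (cutoff_le_one ..) (cutoff_nonneg ..)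
    (cutoff_le_one ..)).trans <|
    mul_le_mul_of_nonneg_left (abs_cutoff_sub_le hrρ x y) (zero_le_one.trans hp)

end Cutoff

section EnergySpace

variable {n : ℕ} {s p Λ f₀ M : ℝ} {K : Eucl n → Eucl n → ℝ} {Ω Ω' : Set (Eucl n)}
  {f u w ξ φ : Eucl n → ℝ}

/-- Measurable kernels comparable to `|x - y| ^ (-(n + s p))` with constant `Λ`, almost
everywhere. -/
structure HasKernelBounds (s p Λ : ℝ) (K : Eucl n → Eucl n → ℝ) : Prop where
  aemeasurable : AEMeasurable (fun z : Eucl n × Eucl n => K z.1 z.2)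
  lower : ∀ᵐ z : Eucl n × Eucl n, Λ⁻¹ * ‖z.1 - z.2‖ ^ (-((n : ℝ) + s * p)) ≤ K z.1 z.2
  upper : ∀ᵐ z : Eucl n × Eucl n, K z.1 z.2 ≤ Λ * ‖z.1 - z.2‖ ^ (-((n : ℝ) + s * p))

lemma IsKernel.hasKernelBounds (hK : IsKernel s p Λ K) : HasKernelBounds s p Λ K where
  aemeasurable := hK.aemeasurable
  lower := by
    filter_upwards [hK.lower] with z hz
    rwa [Real.rpow_neg (norm_nonneg _), ← mul_inv, ← one_div]
  upper := by
    filter_upwards [hK.upper] with z hz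
    rwa [Real.rpow_neg (norm_nonneg _), ← div_eq_mul_inv]

lemma gagliardo_eq (s p : ℝ) (D : Set (Eucl n × Eucl n)) (u : Eucl n → ℝ) :
    gagliardo s p D u = ∫⁻ z in D,
      ENNReal.ofReal (|u z.1 - u z.2| ^ p * ‖z.1 - z.2‖ ^ (-((n : ℝ) + s * p))) := by
  simp only [gagliardo, Real.rpow_neg (norm_nonneg _), div_eq_mul_inv]

lemma gagliardo_univ (s p : ℝ) (u : Eucl n → ℝ) :
    gagliardo s p (univ ×ˢ univ) u = ∫⁻ z : Eucl n × Eucl n,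
      ENNReal.ofReal (|u z.1 - u z.2| ^ p * ‖z.1 - z.2‖ ^ (-((n : ℝ) + s * p))) := by
  rw [gagliardo_eq, univ_prod_univ, setLIntegral_univ]

lemma MemEnergySpace.mono (hu : MemEnergySpace s p Ω u) (h : Ω' ⊆ Ω) :
    MemEnergySpace s p Ω' u :=
  ⟨hu.1, hu.2.1.mono_measure (Measure.restrict_mono h le_rfl),
    (lintegral_mono_set <| compl_subset_compl.2 <|
      prod_mono (compl_subset_compl.2 h) (compl_subset_compl.2 h)).trans_lt hu.2.2⟩

lemma setIntegral_mul_eq_of_tsupport_subset (hΩ : MeasurableSet Ω) (h : Ω' ⊆ Ω)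
    (hφ : tsupport φ ⊆ Ω') : ∫ x in Ω, f x * φ x = ∫ x in Ω', f x * φ x :=
  setIntegral_eq_of_subset_of_forall_sdiff_eq_zero hΩ h fun x hx => by
    rw [image_eq_zero_of_notMem_tsupport fun hx' => hx.2 (hφ hx'), mul_zero]

lemma IsWeakSolution.mono (hu : IsWeakSolution s p K Ω f u) (hΩ : MeasurableSet Ω)
    (h : Ω' ⊆ Ω) : IsWeakSolution s p K Ω' f u :=
  ⟨hu.1.mono h, fun φ hφ hsupp => by
    rw [hu.2 φ hφ (hsupp.trans h), setIntegral_mul_eq_of_tsupport_subset hΩ h hsupp]⟩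

lemma exists_lintegral_fst_mul_min_kernel_le (hn : 1 ≤ n) (hs0 : 0 < s) (hs1 : s < 1)
    (hp : 0 < p) :
    ∃ C : ℝ, 1 ≤ C ∧ ∀ (W : Eucl n → ℝ≥0∞), Measurable W → ∀ L : ℝ, 0 < L →
      ∫⁻ z : Eucl n × Eucl n, W z.1 * ENNReal.ofReal
        (min 1 (L * ‖z.2 - z.1‖) ^ p * ‖z.1 - z.2‖ ^ (-((n : ℝ) + s * p))) ≤
      ENNReal.ofReal (C * L ^ (s * p)) * ∫⁻ x, W x := by
  obtain ⟨C, hC, h⟩ := exists_lintegral_min_kernel_le hn (by positivity : 0 < s * p)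
    (mul_lt_of_lt_one_left hp hs1)
  refine ⟨C, hC, fun W hW L hL => ?_⟩
  rw [Measure.volume_eq_prod, lintegral_prod _ (by fun_prop), mul_comm (ENNReal.ofReal _),
    ← lintegral_mul_const' _ _ ENNReal.ofReal_ne_top]
  refine lintegral_mono fun x => ?_
  simp only
  rw [lintegral_const_mul _ (by fun_prop)]
  gcongr
  refine le_of_eq_of_le (lintegral_congr fun y => ?_) (h x L hL)
  rw [norm_sub_rev x y]

lemma lintegral_comp_swap {α : Type*} [MeasureSpace α] [SFinite (volume : Measure α)]
    (H : α × α → ℝ≥0∞) : ∫⁻ z : α × α, H z.swap = ∫⁻ z, H z := by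
  rw [Measure.volume_eq_prod]
  exact lintegral_prod_swap H

lemma lintegral_indicator_rpow_lt_top {α : Type*} [MeasurableSpace α] {μ : Measure α}
    {A : Set α} {w : α → ℝ} (hp : 0 < p) (hA : MeasurableSet A)
    (hw : MemLp w (ENNReal.ofReal p) (μ.restrict A)) :
    ∫⁻ x, A.indicator (fun x => ENNReal.ofReal (|w x| ^ p)) x ∂μ < ⊤ := by
  rw [lintegral_indicator hA]
  refine lt_of_eq_of_lt (lintegral_congr fun x => ?_)
    (lintegral_rpow_enorm_lt_top_of_eLpNorm_lt_top (by simpa using hp)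
      ENNReal.ofReal_ne_top hw.2)
  rw [ENNReal.toReal_ofReal hp.le, Real.enorm_eq_ofReal_abs,
    ENNReal.ofReal_rpow_of_nonneg (abs_nonneg _) hp.le]

lemma memLp_cutoff_mul {q : ℝ≥0∞} (hΩ : MeasurableSet Ω)
    (hw : MemLp w q (volume.restrict Ω)) (hξm : Measurable ξ) (hξ1 : ∀ x, |ξ x| ≤ 1)
    (hξz : ∀ x ∉ Ω, ξ x = 0) : MemLp (fun x => ξ x * w x) q := by
  have hindicator : (fun x => ξ x * w x) = Ω.indicator fun x => ξ x * w x := by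
    refine (indicator_eq_self.2 fun x hx => ?_).symm
    by_contra hxΩ
    exact hx (by simp only [hξz x hxΩ, zero_mul])
  rw [hindicator, memLp_indicator_iff_restrict hΩ]
  refine hw.of_le (hξm.aestronglyMeasurable.mul hw.1) (.of_forall fun x => ?_)
  rw [norm_mul]
  exact mul_le_of_le_one_left (norm_nonneg _) (hξ1 x)

lemma ofReal_abs_mul_sub_mul_rpow_le {a b e f d κ : ℝ} (hp : 0 ≤ p) (hM : 0 ≤ M) (hd : 0 ≤ d)
    (hκ : 0 ≤ κ) (hf : |f| ≤ 1) (hef : |e - f| ≤ M * d) :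
    ENNReal.ofReal (|e * a - f * b| ^ p * κ) ≤ ENNReal.ofReal (2 ^ p) *
      (ENNReal.ofReal (|a - b| ^ p * κ) +
        ENNReal.ofReal (M ^ p) * (ENNReal.ofReal (|a| ^ p) * ENNReal.ofReal (d ^ p * κ))) := by
  rw [← ENNReal.ofReal_mul (by positivity), ← ENNReal.ofReal_mul (by positivity),
    ← ENNReal.ofReal_add (by positivity) (by positivity), ← ENNReal.ofReal_mul (by positivity)]
  apply ENNReal.ofReal_le_ofReal
  calc |e * a - f * b| ^ p * κ ≤ 2 ^ p * (|a - b| ^ p + |a| ^ p * (M * d) ^ p) * κ := by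
        gcongr
        exact (abs_mul_sub_mul_rpow_le hp hf).trans (by gcongr)
    _ = _ := by rw [Real.mul_rpow hM hd]; ring

lemma MemEnergySpace.memFracSobolev_cutoff_mul (hn : 1 ≤ n) (hs0 : 0 < s) (hs1 : s < 1)
    (hp : 0 < p) (hΩ : MeasurableSet Ω) (hwm : Measurable w) (hw : MemEnergySpace s p Ω w)
    (hξm : Measurable ξ) (hξ1 : ∀ x, |ξ x| ≤ 1) (hξz : ∀ x ∉ Ω, ξ x = 0) (hM : 0 ≤ M)
    {L : ℝ} (hL : 0 < L) (hξL : ∀ x y, |ξ x - ξ y| ≤ M * min 1 (L * ‖y - x‖)) :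
    MemFracSobolev s p univ (fun x => ξ x * w x) := by
  refine ⟨by rw [Measure.restrict_univ]; exact memLp_cutoff_mul hΩ hw.2.1 hξm hξ1 hξz, ?_⟩
  have hE := hw.2.2
  rw [gagliardo_eq, ← lintegral_indicator (hΩ.compl.prod hΩ.compl).compl] at hE
  rw [gagliardo_univ]
  set W : Eucl n → ℝ≥0∞ := Ω.indicator fun x => ENNReal.ofReal (|w x| ^ p)
  set H : Eucl n × Eucl n → ℝ≥0∞ := fun z => ENNReal.ofReal
    (min 1 (L * ‖z.2 - z.1‖) ^ p * ‖z.1 - z.2‖ ^ (-((n : ℝ) + s * p)))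
  have hWm : Measurable W := Measurable.indicator (by fun_prop) hΩ
  obtain ⟨C, -, hC⟩ := exists_lintegral_fst_mul_min_kernel_le hn hs0 hs1 hp (n := n)
  have hfst : ∫⁻ z : Eucl n × Eucl n, W z.1 * H z < ⊤ :=
    (hC W hWm L hL).trans_lt <| ENNReal.mul_lt_top ENNReal.ofReal_lt_top <|
      lintegral_indicator_rpow_lt_top hp hΩ hw.2.1
  have hsnd : ∫⁻ z : Eucl n × Eucl n, W z.2 * H z.swap < ⊤ :=
    (lintegral_comp_swap fun z => W z.1 * H z).trans_lt hfst
  have hfin : ENNReal.ofReal (2 ^ p) * ∫⁻ z, ((Ωᶜ ×ˢ Ωᶜ)ᶜ.indicator (fun z : Eucl n × Eucl n =>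
      ENNReal.ofReal (|w z.1 - w z.2| ^ p * ‖z.1 - z.2‖ ^ (-((n : ℝ) + s * p)))) z +
      ENNReal.ofReal (M ^ p) * (W z.1 * H z + W z.2 * H z.swap)) < ⊤ := by
    rw [lintegral_add_right _ (by fun_prop), lintegral_const_mul' _ _ ENNReal.ofReal_ne_top,
      lintegral_add_right _ (by fun_prop)]
    finiteness
  refine lt_of_le_of_lt ?_ hfin
  rw [← lintegral_const_mul' _ _ ENNReal.ofReal_ne_top]
  refine lintegral_mono fun ⟨x, y⟩ => ?_
  have hd (x y : Eucl n) : 0 ≤ min 1 (L * ‖y - x‖) := le_min zero_le_one (by positivity)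
  by_cases hxy : (x, y) ∈ Ωᶜ ×ˢ Ωᶜ
  · simp [hξz x hxy.1, hξz y hxy.2, Real.zero_rpow hp.ne']
  rw [indicator_of_mem (show (x, y) ∈ (Ωᶜ ×ˢ Ωᶜ)ᶜ from hxy)]
  rcases not_and_or.1 hxy with hx | hy
  · refine (ofReal_abs_mul_sub_mul_rpow_le hp.le hM (hd x y) (by positivity) (hξ1 y)
      (hξL x y)).trans ?_
    rw [← indicator_of_mem (notMem_compl_iff.1 hx) fun x => ENNReal.ofReal (|w x| ^ p)]
    gcongr
    exact le_self_add
  · dsimp only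
    rw [abs_sub_comm, abs_sub_comm (w x), norm_sub_rev x y]
    refine (ofReal_abs_mul_sub_mul_rpow_le hp.le hM (hd y x) (by positivity) (hξ1 x)
      (hξL y x)).trans ?_
    rw [← indicator_of_mem (notMem_compl_iff.1 hy) fun x => ENNReal.ofReal (|w x| ^ p)]
    gcongr
    exact le_add_self

lemma integrable_form (hp : 1 < p) (hΛ : 0 ≤ Λ) (hK : HasKernelBounds s p Λ K)
    (hΩ : MeasurableSet Ω) (hu : Measurable u) (hφ : Measurable φ)
    (hE : gagliardo s p (Ωᶜ ×ˢ Ωᶜ)ᶜ u < ⊤) (hG : gagliardo s p (univ ×ˢ univ) φ < ⊤)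
    (hφz : ∀ x ∉ Ω, φ x = 0) :
    Integrable (fun z : Eucl n × Eucl n =>
      oddPow p (u z.1 - u z.2) * (φ z.1 - φ z.2) * K z.1 z.2) := by
  rw [gagliardo_eq, ← lintegral_indicator (hΩ.compl.prod hΩ.compl).compl] at hE
  rw [gagliardo_univ] at hG
  have hmeas : AEStronglyMeasurable (fun z : Eucl n × Eucl n =>
      oddPow p (u z.1 - u z.2) * (φ z.1 - φ z.2) * K z.1 z.2) := by
    refine (AEMeasurable.mul (Measurable.aemeasurable ?_) hK.aemeasurable).aestronglyMeasurable
    unfold oddPow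
    fun_prop
  refine ⟨hmeas, ?_⟩
  rw [hasFiniteIntegral_iff_norm]
  have hfin : ENNReal.ofReal Λ * (∫⁻ z, ((Ωᶜ ×ˢ Ωᶜ)ᶜ.indicator (fun z : Eucl n × Eucl n =>
      ENNReal.ofReal (|u z.1 - u z.2| ^ p * ‖z.1 - z.2‖ ^ (-((n : ℝ) + s * p)))) z +
      ENNReal.ofReal (|φ z.1 - φ z.2| ^ p * ‖z.1 - z.2‖ ^ (-((n : ℝ) + s * p))))) < ⊤ := by
    rw [lintegral_add_right _ (by fun_prop)]
    finiteness
  refine lt_of_le_of_lt ?_ hfin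
  rw [← lintegral_const_mul' _ _ ENNReal.ofReal_ne_top]
  refine lintegral_mono_ae ?_
  filter_upwards [hK.lower, hK.upper] with z hlower hupper
  have hK0 : 0 ≤ K z.1 z.2 := le_trans (by positivity) hlower
  by_cases hz : z ∈ Ωᶜ ×ˢ Ωᶜ
  · simp [hφz z.1 hz.1, hφz z.2 hz.2]
  rw [indicator_of_mem (show z ∈ (Ωᶜ ×ˢ Ωᶜ)ᶜ from hz),
    ← ENNReal.ofReal_add (by positivity) (by positivity), ← ENNReal.ofReal_mul hΛ]
  apply ENNReal.ofReal_le_ofReal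
  rw [norm_mul, norm_mul, Real.norm_eq_abs, Real.norm_eq_abs, Real.norm_of_nonneg hK0,
    abs_oddPow hp.ne']
  calc |u z.1 - u z.2| ^ (p - 1) * |φ z.1 - φ z.2| * K z.1 z.2
      ≤ (|u z.1 - u z.2| ^ p + |φ z.1 - φ z.2| ^ p) *
          (Λ * ‖z.1 - z.2‖ ^ (-((n : ℝ) + s * p))) := by
        gcongr
        exact rpow_sub_one_mul_le_add hp.le (abs_nonneg _) (abs_nonneg _)
    _ = _ := by ring

lemma IsWeakSolution.integral_form_le (hu : IsWeakSolution s p K Ω f u) (hf₀ : 0 ≤ f₀)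
    (hf : ∀ᵐ x ∂volume.restrict Ω, |f x| ≤ f₀) (hφ : MemFracSobolev s p univ φ)
    (hsupp : tsupport φ ⊆ Ω) {W : ℝ} (hW : 0 ≤ W)
    (hφW : ∫⁻ x in Ω, ENNReal.ofReal |φ x| ≤ ENNReal.ofReal W) :
    ∫ z : Eucl n × Eucl n, oddPow p (u z.1 - u z.2) * (φ z.1 - φ z.2) * K z.1 z.2 ≤
      2 * (f₀ * W) := by
  have hrhs : ∫ x in Ω, f x * φ x ≤ f₀ * W := by
    refine ((le_abs_self _).trans (norm_integral_le_lintegral_norm fun x => f x * φ x)).trans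
      (ENNReal.toReal_le_of_le_ofReal (by positivity) ?_)
    calc ∫⁻ x in Ω, ENNReal.ofReal ‖f x * φ x‖
        ≤ ∫⁻ x in Ω, ENNReal.ofReal f₀ * ENNReal.ofReal |φ x| := by
          refine lintegral_mono_ae ?_
          filter_upwards [hf] with x hx
          rw [← ENNReal.ofReal_mul hf₀, norm_mul, Real.norm_eq_abs, Real.norm_eq_abs]
          gcongr
      _ ≤ ENNReal.ofReal (f₀ * W) := by
          rw [lintegral_const_mul' _ _ ENNReal.ofReal_ne_top, ENNReal.ofReal_mul hf₀]
          gcongr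
  have hweak := hu.2 φ hφ hsupp
  simp only [oddPow]
  linarith

end EnergySpace

section Excess

variable {α : Type*} {u : α → ℝ}

/-- The truncation `(u - k)₊`. -/
noncomputable def excess (u : α → ℝ) (k : ℝ) (x : α) : ℝ := max (u x - k) 0

lemma excess_nonneg (u : α → ℝ) (k : ℝ) (x : α) : 0 ≤ excess u k x := le_max_right _ _

lemma measurable_excess [MeasurableSpace α] (hu : Measurable u) (k : ℝ) :
    Measurable (excess u k) := by
  unfold excess; fun_prop

lemma abs_excess_sub_le (u : α → ℝ) (k : ℝ) (x y : α) :
    |excess u k x - excess u k y| ≤ |u x - u y| := by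
  simpa only [excess, sub_sub_sub_cancel_right] using
    abs_max_sub_max_le_abs (u x - k) (u y - k) 0

lemma excess_anti (u : α → ℝ) {k l : ℝ} (h : k ≤ l) (x : α) : excess u l x ≤ excess u k x :=
  max_le_max_right 0 (sub_le_sub_left h _)

lemma MemEnergySpace.excess {n : ℕ} {s p : ℝ} {Ω : Set (Eucl n)} {u : Eucl n → ℝ} (hp : 0 ≤ p)
    (hΩ : volume Ω ≠ ⊤) (hum : Measurable u) (hu : MemEnergySpace s p Ω u) (k : ℝ) :
    MemEnergySpace s p Ω (excess u k) := by
  have : IsFiniteMeasure (volume.restrict Ω) := isFiniteMeasure_restrict.2 hΩ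
  refine ⟨(measurable_excess hum k).aemeasurable, ?_, lt_of_le_of_lt ?_ hu.2.2⟩
  · have hsub : MemLp (fun x => u x - k) (ENNReal.ofReal p) (volume.restrict Ω) :=
      hu.2.1.sub (memLp_const k)
    refine hsub.of_le (measurable_excess hum k).aestronglyMeasurable (.of_forall fun x => ?_)
    rw [Real.norm_of_nonneg (excess_nonneg u k x), Real.norm_eq_abs]
    exact max_le (le_abs_self _) (abs_nonneg _)
  · refine lintegral_mono fun z => ENNReal.ofReal_le_ofReal ?_
    have := abs_excess_sub_le u k z.1 z.2
    gcongr

end Excess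

section CutoffEnergy

variable {n : ℕ} {p L k r ρ : ℝ} {B : Set (Eucl n)} {u w η : Eucl n → ℝ} {x₀ : Eucl n}

/-- The energy density controlled by the Caccioppoli estimate: the energy of the cut-off truncation
`η (u - k)₊`, together with its interaction with the deficit `(k - u)₊`, which survives in
the nonlocal setting. -/
noncomputable def cutoffEnergy (p : ℝ) (u : Eucl n → ℝ) (k : ℝ) (η : Eucl n → ℝ)
    (z : Eucl n × Eucl n) : ℝ :=
  |η z.1 * excess u k z.1 - η z.2 * excess u k z.2| ^ p +
    (max (k - u z.2) 0 ^ (p - 1) * excess u k z.1 * η z.1 ^ p +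
      max (k - u z.1) 0 ^ (p - 1) * excess u k z.2 * η z.2 ^ p)

/-- The error density of the Caccioppoli estimate: the local contribution of the gradient of the
cutoff, and the nonlocal contribution of the values of `w` outside `B`. -/
noncomputable def cutoffError (p L : ℝ) (B : Set (Eucl n)) (w η : Eucl n → ℝ)
    (z : Eucl n × Eucl n) : ℝ :=
  B.indicator (fun x => w x ^ p) z.1 * min 1 (L * ‖z.2 - z.1‖) ^ p +
    Bᶜ.indicator (fun y => w y ^ (p - 1)) z.2 * (w z.1 * η z.1 ^ p)

lemma cutoffEnergy_swap (p : ℝ) (u : Eucl n → ℝ) (k : ℝ) (η : Eucl n → ℝ)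
    (z : Eucl n × Eucl n) : cutoffEnergy p u k η z.swap = cutoffEnergy p u k η z := by
  simp only [cutoffEnergy, Prod.fst_swap, Prod.snd_swap]
  rw [abs_sub_comm, add_comm (_ * η z.2 ^ p)]

lemma cutoffEnergy_nonneg (hη : ∀ x, 0 ≤ η x) (z : Eucl n × Eucl n) :
    0 ≤ cutoffEnergy p u k η z := by
  have := hη z.1
  have := hη z.2
  have := excess_nonneg u k z.1
  have := excess_nonneg u k z.2
  unfold cutoffEnergy
  positivity

lemma cutoffError_nonneg (hL : 0 ≤ L) (hw : ∀ x, 0 ≤ w x) (hη : ∀ x, 0 ≤ η x)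
    (z : Eucl n × Eucl n) : 0 ≤ cutoffError p L B w η z := by
  have : 0 ≤ min 1 (L * ‖z.2 - z.1‖) := le_min zero_le_one (by positivity)
  exact add_nonneg
    (mul_nonneg (indicator_nonneg (fun x _ => Real.rpow_nonneg (hw x) _) _) (by positivity))
    (mul_nonneg (indicator_nonneg (fun x _ => Real.rpow_nonneg (hw x) _) _)
      (mul_nonneg (hw _) (Real.rpow_nonneg (hη _) _)))

lemma measurable_cutoffError (hB : MeasurableSet B) (hw : Measurable w) (hη : Measurable η) :
    Measurable (cutoffError p L B w η) := by
  have : Measurable (B.indicator fun x => w x ^ p) := Measurable.indicator (by fun_prop) hB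
  have : Measurable (Bᶜ.indicator fun x => w x ^ (p - 1)) :=
    Measurable.indicator (by fun_prop) hB.compl
  unfold cutoffError
  fun_prop

lemma cutoffError_of_mem {z : Eucl n × Eucl n} (h₁ : z.1 ∈ B) (h₂ : z.2 ∈ B) :
    cutoffError p L B w η z = w z.1 ^ p * min 1 (L * ‖z.2 - z.1‖) ^ p := by
  simp [cutoffError, h₁, h₂]

lemma le_cutoffError_of_snd_notMem (hL : 0 ≤ L) (hw : ∀ x, 0 ≤ w x) {z : Eucl n × Eucl n}
    (h : z.2 ∉ B) : w z.2 ^ (p - 1) * w z.1 * η z.1 ^ p ≤ cutoffError p L B w η z := by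
  have : 0 ≤ min 1 (L * ‖z.2 - z.1‖) := le_min zero_le_one (by positivity)
  rw [cutoffError, indicator_of_mem (mem_compl h), mul_assoc]
  exact le_add_of_nonneg_left
    (mul_nonneg (indicator_nonneg (fun x _ => Real.rpow_nonneg (hw x) _) _) (by positivity))

lemma cutoffEnergy_le_of_snd_notMem (hp : 1 < p) (hL : 0 ≤ L) (hη : ∀ x, 0 ≤ η x)
    (hηB : ∀ x ∉ B, η x = 0) {z : Eucl n × Eucl n} (hz : z.2 ∉ B) :
    2 ^ (-(p + 1)) * cutoffEnergy p u k η z ≤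
      oddPow p (u z.1 - u z.2) * (η z.1 ^ p * excess u k z.1 - η z.2 ^ p * excess u k z.2) +
        2 * cutoffError p L B (excess u k) η z := by
  have hp0 : p ≠ 0 := by linarith
  have htail := oddPow_cutoff_tail (u z.1 - k) (u z.2 - k) hp (hη z.1)
  rw [neg_sub, sub_sub_sub_cancel_right] at htail
  have herr := le_cutoffError_of_snd_notMem (p := p) (η := η) hL (excess_nonneg u k) hz
  rw [cutoffEnergy, hηB _ hz, Real.zero_rpow hp0, zero_mul, mul_zero, sub_zero, sub_zero,
    add_zero, abs_of_nonneg (mul_nonneg (hη z.1) (excess_nonneg u k z.1))]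
  exact htail.trans (add_le_add le_rfl (mul_le_mul_of_nonneg_left herr zero_le_two))

lemma cutoffEnergy_le_of_mem (hp : 1 < p) (hη : ∀ x, 0 ≤ η x)
    (hηL : ∀ x y, |η x - η y| ≤ min 1 (L * ‖y - x‖)) {z : Eucl n × Eucl n} (h₁ : z.1 ∈ B)
    (h₂ : z.2 ∈ B) :
    2 ^ (-(p + 1)) * cutoffEnergy p u k η z ≤
      oddPow p (u z.1 - u z.2) * (η z.1 ^ p * excess u k z.1 - η z.2 ^ p * excess u k z.2) +
        (2 ^ p * p ^ p + 1) * (cutoffError p L B (excess u k) η z +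
          cutoffError p L B (excess u k) η z.swap) := by
  have h := oddPow_cutoff (u z.1 - k) (u z.2 - k) hp (hη z.1) (hη z.2)
  rw [neg_sub, neg_sub, sub_sub_sub_cancel_right] at h
  rw [cutoffError_of_mem h₁ h₂, cutoffError_of_mem (z := z.swap) h₂ h₁, Prod.fst_swap,
    Prod.snd_swap, norm_sub_rev z.1 z.2, ← add_mul]
  refine h.trans ?_
  have := excess_nonneg u k z.1
  have := excess_nonneg u k z.2
  unfold excess at *
  gcongr
  exact hηL z.1 z.2

lemma cutoffEnergy_le (hp : 1 < p) (hL : 0 ≤ L) (hη : ∀ x, 0 ≤ η x)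
    (hηB : ∀ x ∉ B, η x = 0) (hηL : ∀ x y, |η x - η y| ≤ min 1 (L * ‖y - x‖))
    (z : Eucl n × Eucl n) :
    2 ^ (-(p + 1)) * cutoffEnergy p u k η z ≤
      oddPow p (u z.1 - u z.2) * (η z.1 ^ p * excess u k z.1 - η z.2 ^ p * excess u k z.2) +
        (2 ^ p * p ^ p + 2) * (cutoffError p L B (excess u k) η z +
          cutoffError p L B (excess u k) η z.swap) := by
  have herr := cutoffError_nonneg (p := p) (B := B) hL (excess_nonneg u k) hη
  have hC : (0 : ℝ) ≤ 2 ^ p * p ^ p := by positivity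
  by_cases h₂ : z.2 ∈ B
  · by_cases h₁ : z.1 ∈ B
    · refine (cutoffEnergy_le_of_mem hp hη hηL h₁ h₂).trans ?_
      have := add_nonneg (herr z) (herr z.swap)
      gcongr
      norm_num
    · have h := cutoffEnergy_le_of_snd_notMem (u := u) (k := k) hp hL hη hηB (z := z.swap) h₁
      rw [cutoffEnergy_swap, Prod.fst_swap, Prod.snd_swap, ← neg_sub, oddPow_neg,
        ← neg_sub (η z.1 ^ p * _), neg_mul_neg] at h
      nlinarith [herr z, herr z.swap]
  · have h := cutoffEnergy_le_of_snd_notMem (u := u) (k := k) hp hL hη hηB h₂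
    nlinarith [herr z, herr z.swap]

end CutoffEnergy

section Caccioppoli

lemma rpow_neg_le_of_le_mul {a c d q : ℝ} (ha : 0 < a) (hc : 0 ≤ c) (hq : 0 ≤ q)
    (h : a ≤ c * d) : d ^ (-q) ≤ c ^ q * a ^ (-q) := by
  have hcd : 0 < c * d := ha.trans_le h
  have hc' : 0 < c := hc.lt_of_ne' fun h0 => by simp [h0] at hcd
  have hd : 0 < d := pos_of_mul_pos_right hcd hc
  calc d ^ (-q) = c ^ q * (c * d) ^ (-q) := by
        rw [Real.mul_rpow hc hd.le, ← mul_assoc, ← Real.rpow_add hc', add_neg_cancel,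
          Real.rpow_zero, one_mul]
    _ ≤ c ^ q * a ^ (-q) := by
        gcongr c ^ q * ?_
        exact Real.rpow_le_rpow_of_nonpos ha h (neg_nonpos.2 hq)

lemma norm_sub_center_le {E : Type*} [SeminormedAddCommGroup E] {x y x₀ : E} {r ρ : ℝ}
    (hr : 0 ≤ r) (hrρ : r < ρ) (hx : ‖x - x₀‖ ≤ (r + ρ) / 2) (hy : ρ ≤ ‖y - x₀‖) :
    ‖y - x₀‖ ≤ 2 * (ρ / (ρ - r)) * ‖x - y‖ := by
  have htri : ‖y - x₀‖ ≤ ‖x - y‖ + ‖x - x₀‖ := by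
    simpa only [norm_sub_rev y x] using norm_sub_le_norm_sub_add_norm_sub y x x₀
  rw [mul_div_assoc', div_mul_eq_mul_div, le_div_iff₀ (sub_pos.2 hrρ)]
  nlinarith

lemma lintegral_ofReal_le_of_le_add {α : Type*} [MeasurableSpace α] {μ : Measure α}
    {F E G : α → ℝ} {e f : ℝ} (hF : Integrable F μ) (hE : AEStronglyMeasurable E μ)
    (hE0 : 0 ≤ᵐ[μ] E) (hG0 : 0 ≤ᵐ[μ] G) (h : ∀ᵐ x ∂μ, G x ≤ F x + E x) (he : 0 ≤ e)
    (hEe : ∫⁻ x, ENNReal.ofReal (E x) ∂μ ≤ ENNReal.ofReal e) (hFf : ∫ x, F x ∂μ ≤ f) :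
    ∫⁻ x, ENNReal.ofReal (G x) ∂μ ≤ ENNReal.ofReal (f + e) := by
  have hEi : Integrable E μ :=
    ⟨hE, (hasFiniteIntegral_iff_ofReal hE0).2 (hEe.trans_lt ENNReal.ofReal_lt_top)⟩
  have hEint : ∫ x, E x ∂μ ≤ e := by
    rw [integral_eq_lintegral_of_nonneg_ae hE0 hE]
    exact ENNReal.toReal_le_of_le_ofReal he hEe
  calc ∫⁻ x, ENNReal.ofReal (G x) ∂μ ≤ ∫⁻ x, ENNReal.ofReal ((F + E) x) ∂μ :=
        lintegral_mono_ae (h.mono fun x hx => ENNReal.ofReal_le_ofReal hx)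
    _ = ENNReal.ofReal (∫ x, (F + E) x ∂μ) :=
        (ofReal_integral_eq_lintegral_ofReal (hF.add hEi) (hG0.trans h)).symm
    _ ≤ ENNReal.ofReal (f + e) := by
        rw [integral_add' hF hEi]
        gcongr

variable {n : ℕ} {s p Λ f₀ k r ρ Y W T : ℝ} {K : Eucl n → Eucl n → ℝ} {f u w : Eucl n → ℝ}
  {x₀ : Eucl n}

/-- Bounds for the truncation `(u - k)₊` on a ball and for its nonlocal tail. -/
structure ExcessBounds (s p : ℝ) (u : Eucl n → ℝ) (x₀ : Eucl n) (ρ k Y W T : ℝ) : Prop where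
  nonneg_Y : 0 ≤ Y
  nonneg_W : 0 ≤ W
  nonneg_T : 0 ≤ T
  bound_Y : ∫⁻ x in Metric.ball x₀ ρ, ENNReal.ofReal (excess u k x ^ p) ≤ ENNReal.ofReal Y
  bound_W : ∫⁻ x in Metric.ball x₀ ρ, ENNReal.ofReal (excess u k x) ≤ ENNReal.ofReal W
  bound_T : ∫⁻ y in (Metric.ball x₀ ρ)ᶜ, ENNReal.ofReal
    (excess u k y ^ (p - 1) * ‖y - x₀‖ ^ (-((n : ℝ) + s * p))) ≤ ENNReal.ofReal T

/-- The right-hand side of the Caccioppoli estimate between the balls of radii `r < ρ`, in terms of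
the bounds `Y`, `W`, `T` of `ExcessBounds` and a bound `f₀` for the source. -/
noncomputable def energyBound (n : ℕ) (s p r ρ f₀ Y W T : ℝ) : ℝ :=
  (ρ - r) ^ (-(s * p)) * Y + ((ρ / (ρ - r)) ^ ((n : ℝ) + s * p) * T + f₀) * W

lemma mul_le_energyBound (hr : 0 ≤ r) (hrρ : r < ρ) (hY : 0 ≤ Y) (hW : 0 ≤ W) (hT : 0 ≤ T) :
    f₀ * W ≤ energyBound n s p r ρ f₀ Y W T := by
  have : 0 < ρ - r := sub_pos.2 hrρ
  have hρ : 0 < ρ := hr.trans_lt hrρ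
  have hsplit : energyBound n s p r ρ f₀ Y W T =
      (ρ - r) ^ (-(s * p)) * Y + (ρ / (ρ - r)) ^ ((n : ℝ) + s * p) * T * W + f₀ * W := by
    unfold energyBound; ring
  rw [hsplit]
  exact le_add_of_nonneg_left (by positivity)

lemma energyBound_nonneg (hr : 0 ≤ r) (hrρ : r < ρ) (hf : 0 ≤ f₀) (hY : 0 ≤ Y) (hW : 0 ≤ W)
    (hT : 0 ≤ T) : 0 ≤ energyBound n s p r ρ f₀ Y W T :=
  (mul_nonneg hf hW).trans (mul_le_energyBound hr hrρ hY hW hT)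

lemma tail_mul_kernel_le (hsp : 0 ≤ s * p) (hp : 0 < p) (hw : ∀ x, 0 ≤ w x) (hr : 0 ≤ r)
    (hrρ : r < ρ) (x : Eucl n) {y : Eucl n} (hy : y ∉ Metric.ball x₀ ρ) :
    w y ^ (p - 1) * (w x * cutoff x₀ r ρ x ^ p) * ‖x - y‖ ^ (-((n : ℝ) + s * p)) ≤
      (2 * (ρ / (ρ - r))) ^ ((n : ℝ) + s * p) * ((Metric.ball x₀ ρ).indicator w x *
        (w y ^ (p - 1) * ‖y - x₀‖ ^ (-((n : ℝ) + s * p)))) := by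
  have hρ : 0 < ρ := hr.trans_lt hrρ
  have hρr : 0 < ρ - r := sub_pos.2 hrρ
  have hwx := hw x
  have hwy := hw y
  rw [mem_ball_iff_norm, not_lt] at hy
  rcases le_or_gt ((r + ρ) / 2) ‖x - x₀‖ with hx | hx
  · rw [cutoff_eq_zero hrρ.le hx, Real.zero_rpow hp.ne', mul_zero, mul_zero, zero_mul]
    have := indicator_nonneg (s := Metric.ball x₀ ρ) (fun x _ => hw x) x
    positivity
  rw [indicator_of_mem (mem_ball_iff_norm.2 (hx.trans (by linarith)))]
  have hκ := rpow_neg_le_of_le_mul (hρ.trans_le hy) (by positivity)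
    (by positivity : 0 ≤ (n : ℝ) + s * p) (norm_sub_center_le hr hrρ hx.le hy)
  have := cutoff_nonneg x₀ r ρ x
  calc w y ^ (p - 1) * (w x * cutoff x₀ r ρ x ^ p) * ‖x - y‖ ^ (-((n : ℝ) + s * p))
      ≤ w y ^ (p - 1) * (w x * 1) * ((2 * (ρ / (ρ - r))) ^ ((n : ℝ) + s * p) *
          ‖y - x₀‖ ^ (-((n : ℝ) + s * p))) := by
        gcongr
        exact cutoff_rpow_le_one x₀ r ρ hp.le x
    _ = _ := by ring

lemma ofReal_cutoffError_mul_kernel_le (hsp : 0 ≤ s * p) (hp : 0 < p) (hw : ∀ x, 0 ≤ w x)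
    (hr : 0 ≤ r) (hrρ : r < ρ) (L : ℝ) (z : Eucl n × Eucl n) :
    ENNReal.ofReal (cutoffError p L (Metric.ball x₀ ρ) w (cutoff x₀ r ρ) z *
        ‖z.1 - z.2‖ ^ (-((n : ℝ) + s * p))) ≤
      (Metric.ball x₀ ρ).indicator (fun x => ENNReal.ofReal (w x ^ p)) z.1 *
          ENNReal.ofReal (min 1 (L * ‖z.2 - z.1‖) ^ p * ‖z.1 - z.2‖ ^ (-((n : ℝ) + s * p))) +
        ENNReal.ofReal ((2 * (ρ / (ρ - r))) ^ ((n : ℝ) + s * p)) *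
          ((Metric.ball x₀ ρ).indicator (fun x => ENNReal.ofReal (w x)) z.1 *
            (Metric.ball x₀ ρ)ᶜ.indicator (fun y => ENNReal.ofReal
              (w y ^ (p - 1) * ‖y - x₀‖ ^ (-((n : ℝ) + s * p)))) z.2) := by
  have : 0 < ρ - r := sub_pos.2 hrρ
  have hρ : 0 < ρ := hr.trans_lt hrρ
  rw [cutoffError, add_mul]
  refine ENNReal.ofReal_add_le.trans (add_le_add (le_of_eq ?_) ?_)
  · by_cases hx : z.1 ∈ Metric.ball x₀ ρ
    · rw [indicator_of_mem hx, indicator_of_mem hx, mul_assoc,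
        ENNReal.ofReal_mul (Real.rpow_nonneg (hw _) _)]
    · simp only [indicator_of_notMem hx, zero_mul, ENNReal.ofReal_zero]
  · by_cases hy : z.2 ∈ Metric.ball x₀ ρ
    · simp [hy]
    have hind : (Metric.ball x₀ ρ).indicator (fun x => ENNReal.ofReal (w x)) z.1 =
        ENNReal.ofReal ((Metric.ball x₀ ρ).indicator w z.1) := by
      by_cases hx : z.1 ∈ Metric.ball x₀ ρ <;> simp [hx]
    rw [indicator_of_mem (mem_compl hy), indicator_of_mem (mem_compl hy), hind,
      ← ENNReal.ofReal_mul (indicator_nonneg (fun x _ => hw x) _),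
      ← ENNReal.ofReal_mul (by positivity)]
    exact ENNReal.ofReal_le_ofReal (tail_mul_kernel_le hsp hp hw hr hrρ z.1 hy)

lemma exists_lintegral_cutoffError_le (hn : 1 ≤ n) (hs0 : 0 < s) (hs1 : s < 1) (hp : 0 < p) :
    ∃ C : ℝ, 1 ≤ C ∧ ∀ (u : Eucl n → ℝ), Measurable u → ∀ (x₀ : Eucl n) (r ρ k : ℝ), 0 ≤ r →
      r < ρ → ∀ Y W T f₀ : ℝ, ExcessBounds s p u x₀ ρ k Y W T → 0 ≤ f₀ →
      ∫⁻ z : Eucl n × Eucl n, ENNReal.ofReal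
        (cutoffError p (2 / (ρ - r)) (Metric.ball x₀ ρ) (excess u k) (cutoff x₀ r ρ) z *
          ‖z.1 - z.2‖ ^ (-((n : ℝ) + s * p))) ≤
      ENNReal.ofReal (C * energyBound n s p r ρ f₀ Y W T) := by
  obtain ⟨C, hC, hlocal⟩ := exists_lintegral_fst_mul_min_kernel_le hn hs0 hs1 hp (n := n)
  set q := (n : ℝ) + s * p with hq
  refine ⟨max (C * 2 ^ (s * p)) (2 ^ q), le_max_of_le_right
    (Real.one_le_rpow one_le_two (by positivity)), ?_⟩
  intro u hu x₀ r ρ k hr hrρ Y W T f₀ hb hf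
  have hρr : 0 < ρ - r := sub_pos.2 hrρ
  have hρ : 0 < ρ := hr.trans_lt hrρ
  have hw : Measurable (excess u k) := measurable_excess hu k
  have hB : MeasurableSet (Metric.ball x₀ ρ) := measurableSet_ball
  have hL : (2 / (ρ - r)) ^ (s * p) = 2 ^ (s * p) * (ρ - r) ^ (-(s * p)) := by
    rw [Real.div_rpow zero_le_two hρr.le, Real.rpow_neg hρr.le, div_eq_mul_inv]
  have hY := hb.nonneg_Y
  have hW := hb.nonneg_W
  have hT := hb.nonneg_T
  refine (lintegral_mono (ofReal_cutoffError_mul_kernel_le (by positivity) hp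
    (excess_nonneg u k) hr hrρ _)).trans ?_
  have := hB.compl
  rw [lintegral_add_right _ (by fun_prop), lintegral_const_mul' _ _ ENNReal.ofReal_ne_top]
  calc _ ≤ ENNReal.ofReal (C * (2 / (ρ - r)) ^ (s * p)) * ENNReal.ofReal Y +
        ENNReal.ofReal ((2 * (ρ / (ρ - r))) ^ q) * (ENNReal.ofReal W * ENNReal.ofReal T) := by
        gcongr
        · refine (hlocal _ (Measurable.indicator (by fun_prop) hB) _ (by positivity)).trans ?_
          rw [lintegral_indicator hB]
          gcongr
          exact hb.bound_Y
        · rw [Measure.volume_eq_prod, lintegral_prod_mul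
            (Measurable.indicator (by fun_prop) hB).aemeasurable
            (Measurable.indicator (by fun_prop) hB.compl).aemeasurable,
            lintegral_indicator hB, lintegral_indicator hB.compl]
          exact mul_le_mul' hb.bound_W hb.bound_T
    _ = ENNReal.ofReal (C * 2 ^ (s * p) * ((ρ - r) ^ (-(s * p)) * Y) +
          2 ^ q * ((ρ / (ρ - r)) ^ q * T * W)) := by
        rw [← ENNReal.ofReal_mul hW, ← ENNReal.ofReal_mul (by positivity),
          ← ENNReal.ofReal_mul (by positivity),
          ← ENNReal.ofReal_add (by positivity) (by positivity), hL,
          Real.mul_rpow zero_le_two (by positivity)]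
        ring_nf
    _ ≤ _ := by
        rw [energyBound, ← hq, mul_add]
        gcongr
        · exact le_max_left _ _
        · exact le_max_right _ _
        · exact le_add_of_nonneg_right hf

end Caccioppoli

section DeGiorgiClass

variable {n : ℕ} {s p Λ f₀ k r ρ L Y W T C a : ℝ} {K : Eucl n → Eucl n → ℝ} {B : Set (Eucl n)}
  {f u η : Eucl n → ℝ} {x₀ : Eucl n}

lemma tsupport_cutoff_rpow_mul_subset (hp : p ≠ 0) (hrρ : r < ρ) :
    tsupport (fun x => cutoff x₀ r ρ x ^ p * u x) ⊆ Metric.ball x₀ ρ := by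
  refine (closure_minimal (fun x hx => ?_) Metric.isClosed_closedBall).trans
    (Metric.closedBall_subset_ball (by linarith : (r + ρ) / 2 < ρ))
  rw [mem_closedBall_iff_norm]
  by_contra! h
  exact hx (by simp only [cutoff_eq_zero hrρ.le h.le, Real.zero_rpow hp, zero_mul])

lemma memFracSobolev_cutoff_rpow_mul_excess (hn : 1 ≤ n) (hs0 : 0 < s) (hs1 : s < 1)
    (hp : 1 ≤ p) (hrρ : r < ρ) (hum : Measurable u)
    (hu : MemEnergySpace s p (Metric.ball x₀ ρ) u) (k : ℝ) :
    MemFracSobolev s p univ (fun x => cutoff x₀ r ρ x ^ p * excess u k x) := by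
  have : 0 < ρ - r := sub_pos.2 hrρ
  have hp0 : 0 < p := by linarith
  have hηm : Measurable (cutoff x₀ r ρ) := (continuous_cutoff x₀ r ρ).measurable
  refine (hu.excess hp0.le measure_ball_lt_top.ne hum k).memFracSobolev_cutoff_mul hn hs0 hs1 hp0
    measurableSet_ball (measurable_excess hum k) (by fun_prop) (fun x => ?_) (fun x hx => ?_)
    hp0.le (by positivity : 0 < 2 / (ρ - r)) (abs_cutoff_rpow_sub_le hp hrρ.le)
  · rw [abs_of_nonneg (Real.rpow_nonneg (cutoff_nonneg x₀ r ρ x) p)]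
    exact cutoff_rpow_le_one x₀ r ρ hp0.le x
  · rw [cutoff_eq_zero_of_notMem_ball hrρ.le hx, Real.zero_rpow hp0.ne']

lemma ae_cutoffEnergy_mul_kernel_le (hp : 1 < p) (hΛ : 0 < Λ) (hK : HasKernelBounds s p Λ K)
    (hL : 0 ≤ L) (hη : ∀ x, 0 ≤ η x) (hηB : ∀ x ∉ B, η x = 0)
    (hηL : ∀ x y, |η x - η y| ≤ min 1 (L * ‖y - x‖)) (u : Eucl n → ℝ) (k : ℝ) :
    ∀ᵐ z : Eucl n × Eucl n,
      2 ^ (-(p + 1)) / Λ * (cutoffEnergy p u k η z * ‖z.1 - z.2‖ ^ (-((n : ℝ) + s * p))) ≤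
        oddPow p (u z.1 - u z.2) * (η z.1 ^ p * excess u k z.1 - η z.2 ^ p * excess u k z.2) *
            K z.1 z.2 +
          (2 ^ p * p ^ p + 2) * Λ *
            (cutoffError p L B (excess u k) η z * ‖z.1 - z.2‖ ^ (-((n : ℝ) + s * p)) +
              cutoffError p L B (excess u k) η z.swap *
                ‖z.swap.1 - z.swap.2‖ ^ (-((n : ℝ) + s * p))) := by
  filter_upwards [hK.lower, hK.upper] with z hlower hupper
  have hK0 : 0 ≤ K z.1 z.2 := le_trans (by positivity) hlower
  have herr := cutoffError_nonneg (p := p) (B := B) hL (excess_nonneg u k) hη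
  have henergy := cutoffEnergy_nonneg (p := p) (u := u) (k := k) hη z
  have herr_add := add_nonneg (herr z) (herr z.swap)
  calc _ = 2 ^ (-(p + 1)) * cutoffEnergy p u k η z *
          (Λ⁻¹ * ‖z.1 - z.2‖ ^ (-((n : ℝ) + s * p))) := by ring
    _ ≤ 2 ^ (-(p + 1)) * cutoffEnergy p u k η z * K z.1 z.2 := by gcongr
    _ ≤ _ := mul_le_mul_of_nonneg_right (cutoffEnergy_le hp hL hη hηB hηL z) hK0
    _ = oddPow p (u z.1 - u z.2) * (η z.1 ^ p * excess u k z.1 - η z.2 ^ p * excess u k z.2) *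
            K z.1 z.2 + (2 ^ p * p ^ p + 2) * (cutoffError p L B (excess u k) η z +
          cutoffError p L B (excess u k) η z.swap) * K z.1 z.2 := add_mul _ _ _
    _ ≤ _ + (2 ^ p * p ^ p + 2) * (cutoffError p L B (excess u k) η z +
          cutoffError p L B (excess u k) η z.swap) *
            (Λ * ‖z.1 - z.2‖ ^ (-((n : ℝ) + s * p))) := by gcongr
    _ = _ := by rw [Prod.fst_swap, Prod.snd_swap, norm_sub_rev z.2 z.1]; ring

lemma IsWeakSolution.integral_cutoff_form_le (hn : 1 ≤ n) (hs0 : 0 < s) (hs1 : s < 1)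
    (hp : 1 < p) (hrρ : r < ρ) (hum : Measurable u)
    (hu : IsWeakSolution s p K (Metric.ball x₀ ρ) f u) (hf₀ : 0 ≤ f₀)
    (hf : ∀ᵐ x ∂volume.restrict (Metric.ball x₀ ρ), |f x| ≤ f₀) (hW : 0 ≤ W)
    (hkW : ∫⁻ x in Metric.ball x₀ ρ, ENNReal.ofReal (excess u k x) ≤ ENNReal.ofReal W) :
    ∫ z : Eucl n × Eucl n, oddPow p (u z.1 - u z.2) *
        (cutoff x₀ r ρ z.1 ^ p * excess u k z.1 - cutoff x₀ r ρ z.2 ^ p * excess u k z.2) *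
          K z.1 z.2 ≤ 2 * (f₀ * W) := by
  refine hu.integral_form_le hf₀ hf
    (memFracSobolev_cutoff_rpow_mul_excess hn hs0 hs1 hp.le hrρ hum hu.1 k)
    (tsupport_cutoff_rpow_mul_subset (by linarith) hrρ) hW (le_trans ?_ hkW)
  refine lintegral_mono fun x => ENNReal.ofReal_le_ofReal ?_
  have hw := excess_nonneg u k x
  rw [abs_of_nonneg (mul_nonneg (Real.rpow_nonneg (cutoff_nonneg x₀ r ρ x) p) hw)]
  exact mul_le_of_le_one_left hw (cutoff_rpow_le_one x₀ r ρ (by linarith) x)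

lemma lintegral_cutoffEnergy_le (hn : 1 ≤ n) (hs0 : 0 < s) (hs1 : s < 1) (hp : 1 < p)
    (hΛ : 0 < Λ) (hK : HasKernelBounds s p Λ K) (hrρ : r < ρ) (hum : Measurable u)
    (hu : IsWeakSolution s p K (Metric.ball x₀ ρ) f u) (hf₀ : 0 ≤ f₀)
    (hf : ∀ᵐ x ∂volume.restrict (Metric.ball x₀ ρ), |f x| ≤ f₀) (hW : 0 ≤ W)
    (hkW : ∫⁻ x in Metric.ball x₀ ρ, ENNReal.ofReal (excess u k x) ≤ ENNReal.ofReal W)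
    {e : ℝ} (he : 0 ≤ e)
    (herr : ∫⁻ z : Eucl n × Eucl n, ENNReal.ofReal
      (cutoffError p (2 / (ρ - r)) (Metric.ball x₀ ρ) (excess u k) (cutoff x₀ r ρ) z *
        ‖z.1 - z.2‖ ^ (-((n : ℝ) + s * p))) ≤ ENNReal.ofReal e) :
    ENNReal.ofReal (2 ^ (-(p + 1)) / Λ) * ∫⁻ z : Eucl n × Eucl n, ENNReal.ofReal
        (cutoffEnergy p u k (cutoff x₀ r ρ) z * ‖z.1 - z.2‖ ^ (-((n : ℝ) + s * p))) ≤
      ENNReal.ofReal (2 * (f₀ * W) + (2 ^ p * p ^ p + 2) * Λ * (2 * e)) := by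
  have hL : 0 ≤ 2 / (ρ - r) := div_nonneg zero_le_two (sub_nonneg.2 hrρ.le)
  have hηm : Measurable (cutoff x₀ r ρ) := (continuous_cutoff x₀ r ρ).measurable
  have hη := cutoff_nonneg x₀ r ρ
  have hηB (x : Eucl n) := cutoff_eq_zero_of_notMem_ball (x := x) (x₀ := x₀) hrρ.le
  have hwm := measurable_excess hum k
  set E : Eucl n × Eucl n → ℝ := fun z =>
    cutoffError p (2 / (ρ - r)) (Metric.ball x₀ ρ) (excess u k) (cutoff x₀ r ρ) z *
      ‖z.1 - z.2‖ ^ (-((n : ℝ) + s * p))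
  have hEm : Measurable E :=
    (measurable_cutoffError measurableSet_ball hwm hηm).mul (by fun_prop)
  have hE0 (z : Eucl n × Eucl n) : 0 ≤ E z :=
    mul_nonneg (cutoffError_nonneg hL (excess_nonneg u k) hη z) (by positivity)
  have hφ := memFracSobolev_cutoff_rpow_mul_excess hn hs0 hs1 hp.le hrρ hum hu.1 k
  have hF := integrable_form hp hΛ.le hK measurableSet_ball hum (by fun_prop) hu.1.2.2 hφ.2
    fun x hx => by rw [hηB x hx, Real.zero_rpow (by linarith), zero_mul]
  rw [← lintegral_const_mul' _ _ ENNReal.ofReal_ne_top]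
  simp only [← ENNReal.ofReal_mul (by positivity : 0 ≤ 2 ^ (-(p + 1)) / Λ)]
  refine lintegral_ofReal_le_of_le_add hF
    (E := fun z => (2 ^ p * p ^ p + 2) * Λ * (E z + E z.swap)) (by fun_prop)
    (.of_forall fun z => ?_) (.of_forall fun z => ?_)
    (ae_cutoffEnergy_mul_kernel_le hp hΛ hK hL hη hηB (abs_cutoff_sub_le hrρ.le) u k)
    (by positivity) ?_ (hu.integral_cutoff_form_le hn hs0 hs1 hp hrρ hum hf₀ hf hW hkW)
  · have := add_nonneg (hE0 z) (hE0 z.swap)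
    positivity
  · have := cutoffEnergy_nonneg (p := p) (u := u) (k := k) hη z
    positivity
  · simp only [ENNReal.ofReal_mul (by positivity : 0 ≤ (2 ^ p * p ^ p + 2) * Λ),
      ENNReal.ofReal_add (hE0 _) (hE0 _), ENNReal.ofReal_add he he, two_mul e]
    rw [lintegral_const_mul' _ _ ENNReal.ofReal_ne_top, lintegral_add_left (by fun_prop),
      lintegral_comp_swap fun z => ENNReal.ofReal (E z)]
    gcongr

theorem exists_caccioppoli (hn : 1 ≤ n) (hs0 : 0 < s) (hs1 : s < 1) (hp : 1 < p)
    (hΛ : 0 < Λ) :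
    ∃ C : ℝ, 1 ≤ C ∧ ∀ K : Eucl n → Eucl n → ℝ, HasKernelBounds s p Λ K →
      ∀ (x₀ : Eucl n) (r ρ : ℝ), 0 ≤ r → r < ρ →
      ∀ (f : Eucl n → ℝ) (f₀ : ℝ), 0 ≤ f₀ →
        (∀ᵐ x ∂volume.restrict (Metric.ball x₀ ρ), |f x| ≤ f₀) →
      ∀ u : Eucl n → ℝ, Measurable u → IsWeakSolution s p K (Metric.ball x₀ ρ) f u →
      ∀ k Y W T : ℝ, ExcessBounds s p u x₀ ρ k Y W T →
      ∫⁻ z : Eucl n × Eucl n, ENNReal.ofReal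
        (cutoffEnergy p u k (cutoff x₀ r ρ) z * ‖z.1 - z.2‖ ^ (-((n : ℝ) + s * p))) ≤
      ENNReal.ofReal (C * energyBound n s p r ρ f₀ Y W T) := by
  obtain ⟨C, hC, herr⟩ := exists_lintegral_cutoffError_le hn hs0 hs1 (by linarith : 0 < p)
    (n := n)
  set c : ℝ := 2 ^ (-(p + 1)) / Λ with hc
  have hc0 : 0 < c := by positivity
  refine ⟨max 1 (c⁻¹ * (2 + (2 ^ p * p ^ p + 2) * Λ * (2 * C))), le_max_left _ _, ?_⟩
  intro K hK x₀ r ρ hr hrρ f f₀ hf₀ hf u hum hu k Y W T hb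
  have hX := energyBound_nonneg (n := n) (s := s) (p := p) hr hrρ hf₀ hb.nonneg_Y hb.nonneg_W
    hb.nonneg_T
  have hfW : f₀ * W ≤ energyBound n s p r ρ f₀ Y W T :=
    mul_le_energyBound hr hrρ hb.nonneg_Y hb.nonneg_W hb.nonneg_T
  have hmain := lintegral_cutoffEnergy_le hn hs0 hs1 hp hΛ hK hrρ hum hu hf₀ hf hb.nonneg_W
    hb.bound_W (by positivity) (herr u hum x₀ r ρ k hr hrρ Y W T f₀ hb hf₀)
  rw [← hc] at hmain
  set X := energyBound n s p r ρ f₀ Y W T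
  calc _ = ENNReal.ofReal c⁻¹ * (ENNReal.ofReal c * _) := by
        rw [← mul_assoc, ← ENNReal.ofReal_mul (by positivity), inv_mul_cancel₀ hc0.ne',
          ENNReal.ofReal_one, one_mul]
    _ ≤ ENNReal.ofReal c⁻¹ *
          ENNReal.ofReal (2 * (f₀ * W) + (2 ^ p * p ^ p + 2) * Λ * (2 * (C * X))) := by gcongr
    _ = ENNReal.ofReal
          (c⁻¹ * (2 * (f₀ * W) + (2 ^ p * p ^ p + 2) * Λ * (2 * (C * X)))) := by
        rw [← ENNReal.ofReal_mul (by positivity)]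
    _ ≤ ENNReal.ofReal (c⁻¹ * (2 * X + (2 ^ p * p ^ p + 2) * Λ * (2 * (C * X)))) := by gcongr
    _ = ENNReal.ofReal (c⁻¹ * (2 + (2 ^ p * p ^ p + 2) * Λ * (2 * C)) * X) := by ring_nf
    _ ≤ _ := by gcongr; exact le_max_right _ _

/-- A fractional De Giorgi class of functions on `Ω`. The first estimate gains a power of
the measure `a` of a superlevel set; the second bounds the product of the truncation above `k` with
the deficit below `k`. -/
structure IsDeGiorgi (s p C f₀ : ℝ) (Ω : Set (Eucl n)) (u : Eucl n → ℝ) : Prop where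
  measurable : Measurable u
  nonneg : 0 ≤ f₀
  level_le : ∀ (x₀ : Eucl n) (r ρ k Y W T a : ℝ), 0 < r → r < ρ → Metric.ball x₀ ρ ⊆ Ω →
    ExcessBounds s p u x₀ ρ k Y W T → 0 < a →
    volume (Metric.ball x₀ ρ ∩ {x | k < u x}) ≤ ENNReal.ofReal a →
    ∫⁻ x in Metric.ball x₀ r, ENNReal.ofReal (excess u k x ^ p) ≤
      ENNReal.ofReal (C * a ^ (s * p / n) * energyBound n s p r ρ f₀ Y W T)
  product_le : ∀ (x₀ : Eucl n) (r ρ k Y W T : ℝ), 0 < r → r < ρ → Metric.ball x₀ ρ ⊆ Ω →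
    ExcessBounds s p u x₀ ρ k Y W T →
    (∫⁻ x in Metric.ball x₀ r, ENNReal.ofReal (excess u k x)) *
      ∫⁻ y in Metric.ball x₀ r, ENNReal.ofReal (max (k - u y) 0 ^ (p - 1)) ≤
    ENNReal.ofReal (C * r ^ ((n : ℝ) + s * p) * energyBound n s p r ρ f₀ Y W T)

lemma cutoff_mul_excess_of_mem_ball (hrρ : r < ρ) (u : Eucl n → ℝ) (k : ℝ) {x : Eucl n}
    (hx : x ∈ Metric.ball x₀ r) : cutoff x₀ r ρ x * excess u k x = excess u k x := by
  rw [cutoff_eq_one_of_mem_ball hrρ hx, one_mul]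

lemma excess_eq_zero {u : Eucl n → ℝ} {x : Eucl n} (h : u x ≤ k) : excess u k x = 0 :=
  max_eq_right (sub_nonpos.2 h)

lemma exists_lintegral_excess_rpow_le (hn : 1 ≤ n) (hsp : 0 < s * p) (hp : 0 < p) :
    ∃ C : ℝ, 1 ≤ C ∧ ∀ u : Eucl n → ℝ, Measurable u → ∀ (x₀ : Eucl n) (r ρ k a e : ℝ),
      r < ρ → 0 < a → volume (Metric.ball x₀ ρ ∩ {x | k < u x}) ≤ ENNReal.ofReal a →
      ∫⁻ z : Eucl n × Eucl n, ENNReal.ofReal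
        (cutoffEnergy p u k (cutoff x₀ r ρ) z * ‖z.1 - z.2‖ ^ (-((n : ℝ) + s * p))) ≤
          ENNReal.ofReal e →
      ∫⁻ x in Metric.ball x₀ r, ENNReal.ofReal (excess u k x ^ p) ≤
        ENNReal.ofReal (C * a ^ (s * p / n) * e) := by
  obtain ⟨C, hC, hFK⟩ := exists_faberKrahn hn hsp hp.ne' (n := n)
  refine ⟨C, hC, fun u hum x₀ r ρ k a e hrρ ha hvol he => ?_⟩
  set h : Eucl n → ℝ := fun x => cutoff x₀ r ρ x * excess u k x
  have hwm := measurable_excess hum k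
  have hηm : Measurable (cutoff x₀ r ρ) := (continuous_cutoff x₀ r ρ).measurable
  have hsupp : volume {x | h x ≠ 0} ≤ ENNReal.ofReal a := by
    refine (measure_mono fun x hx => ?_).trans hvol
    obtain ⟨hη, hw⟩ := mul_ne_zero_iff.1 hx
    exact ⟨not_imp_comm.1 (cutoff_eq_zero_of_notMem_ball hrρ.le) hη,
      not_le.1 fun hle => hw (excess_eq_zero hle)⟩
  calc ∫⁻ x in Metric.ball x₀ r, ENNReal.ofReal (excess u k x ^ p)
      = ∫⁻ x in Metric.ball x₀ r, ENNReal.ofReal (|h x| ^ p) :=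
        setLIntegral_congr_fun measurableSet_ball fun x hx => by
          simp only [h, cutoff_mul_excess_of_mem_ball hrρ u k hx,
            abs_of_nonneg (excess_nonneg u k x)]
    _ ≤ ∫⁻ x, ENNReal.ofReal (|h x| ^ p) := setLIntegral_le_lintegral _ _
    _ ≤ _ := hFK h (by fun_prop) a ha hsupp
    _ ≤ ENNReal.ofReal (C * a ^ (s * p / n)) * ENNReal.ofReal e := by
        gcongr
        refine le_trans ?_ he
        rw [Measure.volume_eq_prod, ← lintegral_prod
          (fun z => ENNReal.ofReal (|h z.1 - h z.2| ^ p * ‖z.1 - z.2‖ ^ (-((n : ℝ) + s * p))))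
          (by fun_prop)]
        refine lintegral_mono fun z => ?_
        have := cutoff_nonneg x₀ r ρ z.1
        have := cutoff_nonneg x₀ r ρ z.2
        have := excess_nonneg u k z.1
        have := excess_nonneg u k z.2
        gcongr
        exact le_add_of_nonneg_right (by positivity)
    _ = _ := (ENNReal.ofReal_mul (by positivity)).symm

lemma excess_mul_deficit_rpow_self (hp : p ≠ 1) (u : Eucl n → ℝ) (k : ℝ) (x : Eucl n) :
    excess u k x * max (k - u x) 0 ^ (p - 1) = 0 := by
  rcases le_total (u x) k with h | h
  · rw [excess_eq_zero h, zero_mul]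
  · rw [max_eq_right (sub_nonpos.2 h), Real.zero_rpow (sub_ne_zero.2 hp), mul_zero]

lemma excess_mul_deficit_le (hp : 1 < p) (hsp : 0 ≤ s * p) (hr : 0 < r) (hrρ : r < ρ)
    (u : Eucl n → ℝ) (k : ℝ) {z : Eucl n × Eucl n} (h₁ : z.1 ∈ Metric.ball x₀ r)
    (h₂ : z.2 ∈ Metric.ball x₀ r) :
    excess u k z.1 * max (k - u z.2) 0 ^ (p - 1) ≤ (2 * r) ^ ((n : ℝ) + s * p) *
      (cutoffEnergy p u k (cutoff x₀ r ρ) z * ‖z.1 - z.2‖ ^ (-((n : ℝ) + s * p))) := by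
  have henergy := cutoffEnergy_nonneg (p := p) (u := u) (k := k) (cutoff_nonneg x₀ r ρ) z
  rcases eq_or_ne z.1 z.2 with heq | hne
  · rw [← heq, excess_mul_deficit_rpow_self hp.ne']
    positivity
  have hdist : ‖z.1 - z.2‖ ≤ 2 * r * 1 := by
    rw [mul_one, ← dist_eq_norm, two_mul]
    exact (dist_triangle_right _ _ x₀).trans (add_le_add h₁.le h₂.le)
  have hκ := rpow_neg_le_of_le_mul (norm_pos_iff.2 (sub_ne_zero.2 hne)) (by positivity)
    (by positivity : 0 ≤ (n : ℝ) + s * p) hdist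
  rw [Real.one_rpow] at hκ
  have hle : excess u k z.1 * max (k - u z.2) 0 ^ (p - 1) ≤
      cutoffEnergy p u k (cutoff x₀ r ρ) z := by
    have := excess_nonneg u k z.2
    rw [cutoffEnergy, cutoff_eq_one_of_mem_ball hrρ h₁, cutoff_eq_one_of_mem_ball hrρ h₂,
      Real.one_rpow, mul_one, mul_one, mul_comm, ← add_assoc, add_right_comm]
    exact le_add_of_nonneg_left (by positivity)
  calc _ ≤ cutoffEnergy p u k (cutoff x₀ r ρ) z := hle
    _ ≤ cutoffEnergy p u k (cutoff x₀ r ρ) z *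
          ((2 * r) ^ ((n : ℝ) + s * p) * ‖z.1 - z.2‖ ^ (-((n : ℝ) + s * p))) :=
        le_mul_of_one_le_right henergy hκ
    _ = _ := by ring

lemma lintegral_excess_mul_lintegral_deficit_le (hp : 1 < p) (hsp : 0 ≤ s * p) (hr : 0 < r)
    (hrρ : r < ρ) (hum : Measurable u) {e : ℝ}
    (he : ∫⁻ z : Eucl n × Eucl n, ENNReal.ofReal
      (cutoffEnergy p u k (cutoff x₀ r ρ) z * ‖z.1 - z.2‖ ^ (-((n : ℝ) + s * p))) ≤
        ENNReal.ofReal e) :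
    (∫⁻ x in Metric.ball x₀ r, ENNReal.ofReal (excess u k x)) *
      ∫⁻ y in Metric.ball x₀ r, ENNReal.ofReal (max (k - u y) 0 ^ (p - 1)) ≤
    ENNReal.ofReal ((2 * r) ^ ((n : ℝ) + s * p) * e) := by
  have hwm := measurable_excess hum k
  rw [← lintegral_prod_mul (by fun_prop) (by fun_prop), Measure.prod_restrict,
    ← Measure.volume_eq_prod, ENNReal.ofReal_mul (by positivity)]
  calc _ ≤ ∫⁻ z in Metric.ball x₀ r ×ˢ Metric.ball x₀ r,
        ENNReal.ofReal ((2 * r) ^ ((n : ℝ) + s * p)) * ENNReal.ofReal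
          (cutoffEnergy p u k (cutoff x₀ r ρ) z * ‖z.1 - z.2‖ ^ (-((n : ℝ) + s * p))) := by
        refine setLIntegral_mono' (measurableSet_ball.prod measurableSet_ball) fun z hz => ?_
        rw [← ENNReal.ofReal_mul (excess_nonneg u k z.1), ← ENNReal.ofReal_mul (by positivity)]
        exact ENNReal.ofReal_le_ofReal (excess_mul_deficit_le hp hsp hr hrρ u k hz.1 hz.2)
    _ ≤ _ := setLIntegral_le_lintegral _ _
    _ ≤ _ := by
        rw [lintegral_const_mul' _ _ ENNReal.ofReal_ne_top]
        gcongr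

theorem exists_isDeGiorgi (hn : 1 ≤ n) (hs0 : 0 < s) (hs1 : s < 1) (hp : 1 < p)
    (hΛ : 0 < Λ) :
    ∃ C : ℝ, 1 ≤ C ∧ ∀ K : Eucl n → Eucl n → ℝ, HasKernelBounds s p Λ K →
      ∀ Ω : Set (Eucl n), MeasurableSet Ω → ∀ (f : Eucl n → ℝ) (f₀ : ℝ), 0 ≤ f₀ →
        (∀ᵐ x ∂volume.restrict Ω, |f x| ≤ f₀) →
      ∀ u : Eucl n → ℝ, Measurable u → IsWeakSolution s p K Ω f u →
      IsDeGiorgi s p C f₀ Ω u := by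
  have hp0 : 0 < p := by linarith
  obtain ⟨C₁, hC₁, hcac⟩ := exists_caccioppoli hn hs0 hs1 hp hΛ (n := n)
  obtain ⟨C₂, hC₂, hlevel⟩ := exists_lintegral_excess_rpow_le hn (mul_pos hs0 hp0) hp0 (n := n)
  refine ⟨max (C₂ * C₁) (2 ^ ((n : ℝ) + s * p) * C₁),
    le_max_of_le_left (one_le_mul_of_one_le_of_one_le hC₂ hC₁), ?_⟩
  intro K hK Ω hΩ f f₀ hf₀ hf u hum hu
  have henergy (x₀ : Eucl n) (r ρ k Y W T : ℝ) (hr : 0 < r) (hrρ : r < ρ)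
      (hball : Metric.ball x₀ ρ ⊆ Ω) (hb : ExcessBounds s p u x₀ ρ k Y W T) :=
    hcac K hK x₀ r ρ hr.le hrρ f f₀ hf₀ (ae_mono (Measure.restrict_mono hball le_rfl) hf) u hum
      (hu.mono hΩ hball) k Y W T hb
  refine ⟨hum, hf₀, fun x₀ r ρ k Y W T a hr hrρ hball hb ha hvol => ?_,
    fun x₀ r ρ k Y W T hr hrρ hball hb => ?_⟩
  · have hX := energyBound_nonneg (n := n) (s := s) (p := p) hr.le hrρ hf₀ hb.nonneg_Y
      hb.nonneg_W hb.nonneg_T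
    refine (hlevel u hum x₀ r ρ k a _ hrρ ha hvol
      (henergy x₀ r ρ k Y W T hr hrρ hball hb)).trans (ENNReal.ofReal_le_ofReal ?_)
    rw [← mul_assoc, mul_right_comm C₂]
    gcongr
    exact le_max_left _ _
  · have hX := energyBound_nonneg (n := n) (s := s) (p := p) hr.le hrρ hf₀ hb.nonneg_Y
      hb.nonneg_W hb.nonneg_T
    refine (lintegral_excess_mul_lintegral_deficit_le hp (by positivity) hr hrρ hum
      (henergy x₀ r ρ k Y W T hr hrρ hball hb)).trans (ENNReal.ofReal_le_ofReal ?_)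
    rw [Real.mul_rpow zero_le_two hr.le, ← mul_assoc, mul_right_comm (2 ^ _)]
    gcongr
    exact le_max_right _ _

end DeGiorgiClass

section Iteration

variable {n : ℕ} {s p A C f₀ R T Y d k l r t y ρ : ℝ} {Ω : Set (Eucl n)} {u : Eucl n → ℝ}
  {x₀ : Eucl n}

lemma sub_le_excess (u : Eucl n → ℝ) {x : Eucl n} (hx : l ≤ u x) : l - k ≤ excess u k x :=
  le_max_of_le_left (by linarith)

lemma excess_le_rpow_mul (hp : 1 < p) (hkl : k < l) (u : Eucl n → ℝ) (x : Eucl n) :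
    excess u l x ≤ excess u k x ^ p * (l - k) ^ (-(p - 1)) := by
  have hgap : 0 < l - k := sub_pos.2 hkl
  have hk := excess_nonneg u k x
  rcases le_or_gt (u x) l with hx | hx
  · rw [excess_eq_zero hx]
    positivity
  · have hratio : 1 ≤ excess u k x ^ (p - 1) * (l - k) ^ (-(p - 1)) := by
      rw [Real.rpow_neg hgap.le, ← div_eq_mul_inv, one_le_div (by positivity)]
      exact Real.rpow_le_rpow hgap.le (sub_le_excess u hx.le) (by linarith)
    calc excess u l x ≤ excess u k x := excess_anti u hkl.le x
      _ ≤ excess u k x ^ (p - 1) * (l - k) ^ (-(p - 1)) * excess u k x :=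
          le_mul_of_one_le_left hk hratio
      _ = excess u k x ^ p * (l - k) ^ (-(p - 1)) := by
          rw [mul_right_comm, rpow_sub_one_mul_self hk (by linarith)]

lemma ofReal_mul_volume_inter_le {a : ℝ} {B S : Set (Eucl n)} {F : Eucl n → ℝ}
    (hS : MeasurableSet S) (h : ∀ x ∈ S, a ≤ F x) :
    ENNReal.ofReal a * volume (B ∩ S) ≤ ∫⁻ x in B, ENNReal.ofReal (F x) := by
  rw [inter_comm, ← Measure.restrict_apply hS, ← setLIntegral_const]
  exact (setLIntegral_mono' hS fun x hx => ENNReal.ofReal_le_ofReal (h x hx)).trans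
    (setLIntegral_le_lintegral _ _)

lemma volume_inter_lt_le (hp : 0 ≤ p) (hkl : k < l) (hu : Measurable u) {B : Set (Eucl n)}
    (hY : ∫⁻ x in B, ENNReal.ofReal (excess u k x ^ p) ≤ ENNReal.ofReal Y) :
    volume (B ∩ {x | l < u x}) ≤ ENNReal.ofReal (Y * (l - k) ^ (-p)) := by
  have hgap : 0 < l - k := sub_pos.2 hkl
  rw [Real.rpow_neg hgap.le, ← div_eq_mul_inv, ENNReal.ofReal_div_of_pos (by positivity),
    ENNReal.le_div_iff_mul_le (.inl (ENNReal.ofReal_pos.2 (by positivity)).ne')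
      (.inl ENNReal.ofReal_ne_top), mul_comm]
  refine (ofReal_mul_volume_inter_le (measurableSet_lt measurable_const hu) fun x hx => ?_).trans hY
  exact Real.rpow_le_rpow hgap.le (sub_le_excess u (le_of_lt hx)) hp

lemma excessBounds_of_lower_level (hp : 1 < p) (hY0 : 0 ≤ Y) (hT0 : 0 ≤ T) (hrρ : r ≤ ρ)
    (hdk : d ≤ k) (hkl : k < l)
    (hY : ∫⁻ x in Metric.ball x₀ ρ, ENNReal.ofReal (excess u k x ^ p) ≤ ENNReal.ofReal Y)
    (hT : ∫⁻ x in (Metric.ball x₀ r)ᶜ, ENNReal.ofReal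
      (excess u d x ^ (p - 1) * ‖x - x₀‖ ^ (-((n : ℝ) + s * p))) ≤ ENNReal.ofReal T) :
    ExcessBounds s p u x₀ ρ l Y (Y * (l - k) ^ (-(p - 1))) T where
  nonneg_Y := hY0
  nonneg_W := mul_nonneg hY0 (Real.rpow_nonneg (sub_nonneg.2 hkl.le) _)
  nonneg_T := hT0
  bound_Y := by
    refine (lintegral_mono fun x => ENNReal.ofReal_le_ofReal ?_).trans hY
    exact Real.rpow_le_rpow (excess_nonneg u l x) (excess_anti u hkl.le x) (by linarith)
  bound_W :=
    calc ∫⁻ x in Metric.ball x₀ ρ, ENNReal.ofReal (excess u l x)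
        ≤ ∫⁻ x in Metric.ball x₀ ρ,
            ENNReal.ofReal (excess u k x ^ p) * ENNReal.ofReal ((l - k) ^ (-(p - 1))) := by
          refine lintegral_mono fun x => ?_
          rw [← ENNReal.ofReal_mul (Real.rpow_nonneg (excess_nonneg u k x) _)]
          exact ENNReal.ofReal_le_ofReal (excess_le_rpow_mul hp hkl u x)
      _ ≤ ENNReal.ofReal (Y * (l - k) ^ (-(p - 1))) := by
          rw [lintegral_mul_const' _ _ ENNReal.ofReal_ne_top, ENNReal.ofReal_mul hY0]
          gcongr
  bound_T := by
    refine (lintegral_mono fun x => ENNReal.ofReal_le_ofReal ?_).trans ((lintegral_mono_set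
      (compl_subset_compl.2 (Metric.ball_subset_ball hrρ))).trans hT)
    gcongr
    · exact excess_nonneg u l x
    · exact excess_anti u (hdk.trans hkl.le) x

lemma mul_half_rpow_neg_le (hd : 0 < d) (ht : 0 < t) (hr : 0 ≤ r) :
    (d * (t / 2)) ^ (-r) ≤ (4 / t) ^ r * d ^ (-r) :=
  rpow_neg_le_of_le_mul hd (by positivity) hr
    (by rw [show 4 / t * (d * (t / 2)) = 2 * d by field_simp; norm_num]; linarith)

lemma energyBound_iteration_le (hsp : 0 ≤ s * p) (hp : 1 ≤ p) (hA : 1 ≤ A) (hf₀ : 0 ≤ f₀)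
    (hR : 0 < R) (hd : 0 < d) (ht : 0 < t) (ht1 : t ≤ 1) (hY : 0 ≤ Y)
    (hf : f₀ ≤ A * d ^ (p - 1) * R ^ (-(s * p))) :
    energyBound n s p (R * (1 + t / 2)) (R * (1 + t)) f₀ Y (Y * (d * (t / 2)) ^ (-(p - 1)))
        (A * d ^ (p - 1) * R ^ (-(s * p))) ≤
      3 * A * (4 / t) ^ ((n : ℝ) + s * p + p) * R ^ (-(s * p)) * Y := by
  have hb : 1 ≤ 4 / t := by rw [one_le_div ht]; linarith
  have hgap : R * (1 + t) - R * (1 + t / 2) = R * (t / 2) := by ring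
  rw [energyBound, hgap]
  set q := (n : ℝ) + s * p with hq
  have hq0 : 0 ≤ q := by positivity
  have hlocal : (R * (t / 2)) ^ (-(s * p)) ≤ A * (4 / t) ^ (q + p) * R ^ (-(s * p)) := by
    refine (mul_half_rpow_neg_le hR ht hsp).trans ?_
    gcongr
    calc (4 / t) ^ (s * p) ≤ (4 / t) ^ (q + p) :=
          Real.rpow_le_rpow_of_exponent_le hb
            (by rw [hq]; linarith [Nat.cast_nonneg (α := ℝ) n])
      _ ≤ A * (4 / t) ^ (q + p) := le_mul_of_one_le_left (by positivity) hA
  have hfar : (R * (1 + t) / (R * (t / 2))) ^ q ≤ (4 / t) ^ q := by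
    apply Real.rpow_le_rpow (by positivity) _ hq0
    rw [mul_div_mul_left _ _ hR.ne', div_le_div_iff₀ (by positivity) ht]
    nlinarith
  have hone : 1 ≤ (4 / t) ^ q := Real.one_le_rpow hb hq0
  have hsource : f₀ ≤ (4 / t) ^ q * (A * d ^ (p - 1) * R ^ (-(s * p))) :=
    hf.trans (le_mul_of_one_le_left (hf₀.trans hf) hone)
  have hnonlocal : ((R * (1 + t) / (R * (t / 2))) ^ q * (A * d ^ (p - 1) * R ^ (-(s * p))) + f₀) *
      (Y * (d * (t / 2)) ^ (-(p - 1))) ≤ 2 * A * (4 / t) ^ (q + p) * R ^ (-(s * p)) * Y := by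
    calc _ ≤ ((4 / t) ^ q * (A * d ^ (p - 1) * R ^ (-(s * p))) +
              (4 / t) ^ q * (A * d ^ (p - 1) * R ^ (-(s * p)))) *
            (Y * ((4 / t) ^ (p - 1) * d ^ (-(p - 1)))) := by
          gcongr
          exact mul_half_rpow_neg_le hd ht (by linarith)
      _ = 2 * A * (4 / t) ^ (q + (p - 1)) * R ^ (-(s * p)) * Y *
            (d ^ (p - 1) * d ^ (-(p - 1))) := by
          rw [Real.rpow_add (by positivity) q]; ring
      _ ≤ 2 * A * (4 / t) ^ (q + p) * R ^ (-(s * p)) * Y := by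
          rw [← Real.rpow_add hd, add_neg_cancel, Real.rpow_zero, mul_one]
          gcongr
          linarith
  calc _ ≤ A * (4 / t) ^ (q + p) * R ^ (-(s * p)) * Y +
        2 * A * (4 / t) ^ (q + p) * R ^ (-(s * p)) * Y := by gcongr
    _ = _ := by ring

lemma levelVolume_rpow_le (hn : 1 ≤ n) (hsp : 0 ≤ s * p) (hp : 0 ≤ p) (hR : 0 < R) (hd : 0 < d)
    (ht : 0 < t) (hy : 0 ≤ y) :
    (y * R ^ (n : ℝ) * d ^ p * (d * (t / 2)) ^ (-p)) ^ (s * p / n) ≤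
      y ^ (s * p / n) * R ^ (s * p) * (4 / t) ^ (p * (s * p / n)) := by
  have hlevel : y * R ^ (n : ℝ) * d ^ p * (d * (t / 2)) ^ (-p) ≤
      y * R ^ (n : ℝ) * (4 / t) ^ p := by
    calc _ ≤ y * R ^ (n : ℝ) * d ^ p * ((4 / t) ^ p * d ^ (-p)) := by
          gcongr
          exact mul_half_rpow_neg_le hd ht hp
      _ = y * R ^ (n : ℝ) * (4 / t) ^ p * (d ^ p * d ^ (-p)) := by ring
      _ = _ := by rw [← Real.rpow_add hd, add_neg_cancel, Real.rpow_zero, mul_one]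
  refine (Real.rpow_le_rpow (by positivity) hlevel (by positivity)).trans_eq ?_
  rw [Real.mul_rpow (by positivity) (by positivity), Real.mul_rpow hy (by positivity),
    ← Real.rpow_mul hR.le, ← Real.rpow_mul (by positivity),
    mul_div_cancel₀ _ (Nat.cast_ne_zero.2 (Nat.one_le_iff_ne_zero.1 hn))]

lemma IsDeGiorgi.iteration_step (hu : IsDeGiorgi s p C f₀ Ω u) (hn : 1 ≤ n) (hsp : 0 ≤ s * p)
    (hp : 1 < p) (hC : 0 ≤ C) (hA : 1 ≤ A) (hR : 0 < R) (hd : 0 < d) (ht : 0 < t) (ht1 : t ≤ 1)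
    (hy : 0 < y) (hball : Metric.ball x₀ (2 * R) ⊆ Ω)
    (hY : ∫⁻ x in Metric.ball x₀ (R * (1 + t)), ENNReal.ofReal
      (excess u (k + d * (1 - t)) x ^ p) ≤ ENNReal.ofReal (y * R ^ (n : ℝ) * d ^ p))
    (hT : ∫⁻ x in (Metric.ball x₀ R)ᶜ, ENNReal.ofReal
      (excess u k x ^ (p - 1) * ‖x - x₀‖ ^ (-((n : ℝ) + s * p))) ≤
      ENNReal.ofReal (A * d ^ (p - 1) * R ^ (-(s * p))))
    (hf : f₀ ≤ A * d ^ (p - 1) * R ^ (-(s * p))) :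
    ∫⁻ x in Metric.ball x₀ (R * (1 + t / 2)), ENNReal.ofReal
      (excess u (k + d * (1 - t / 2)) x ^ p) ≤ ENNReal.ofReal
        (3 * A * C * y ^ (s * p / n) * (4 / t) ^ ((n : ℝ) + s * p + p + p * (s * p / n)) *
          (y * R ^ (n : ℝ) * d ^ p)) := by
  have hf₀ := hu.nonneg
  have hp0 : 0 < p := by linarith
  have hgap : k + d * (1 - t / 2) - (k + d * (1 - t)) = d * (t / 2) := by ring
  have hkl : k + d * (1 - t) < k + d * (1 - t / 2) := by
    rw [← sub_pos, hgap]
    positivity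
  have hb := excessBounds_of_lower_level hp (by positivity) (by positivity)
    (by nlinarith : R ≤ R * (1 + t)) (by nlinarith : k ≤ k + d * (1 - t)) hkl hY hT
  have hvol := volume_inter_lt_le hp0.le hkl hu.measurable hY
  rw [hgap] at hb hvol
  set Y := y * R ^ (n : ℝ) * d ^ p
  set T := A * d ^ (p - 1) * R ^ (-(s * p))
  refine (hu.level_le x₀ (R * (1 + t / 2)) (R * (1 + t)) _ _ _ _ _ (by positivity) (by nlinarith)
    ((Metric.ball_subset_ball (by nlinarith)).trans hball) hb (by positivity) hvol).trans
    (ENNReal.ofReal_le_ofReal ?_)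
  have hX0 : 0 ≤ energyBound n s p (R * (1 + t / 2)) (R * (1 + t)) f₀ Y
      (Y * (d * (t / 2)) ^ (-(p - 1))) T :=
    energyBound_nonneg (by positivity) (by nlinarith) hf₀ hb.nonneg_Y hb.nonneg_W hb.nonneg_T
  calc _ ≤ C * (y ^ (s * p / n) * R ^ (s * p) * (4 / t) ^ (p * (s * p / n))) *
        (3 * A * (4 / t) ^ ((n : ℝ) + s * p + p) * R ^ (-(s * p)) * Y) := by
        gcongr
        · exact levelVolume_rpow_le hn hsp hp0.le hR hd ht hy.le
        · exact energyBound_iteration_le hsp hp.le hA hf₀ hR hd ht ht1 hb.nonneg_Y hf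
    _ = 3 * A * C * y ^ (s * p / n) *
        ((4 / t) ^ ((n : ℝ) + s * p + p) * (4 / t) ^ (p * (s * p / n))) *
        (R ^ (s * p) * R ^ (-(s * p))) * Y := by ring
    _ = _ := by
      rw [← Real.rpow_add (by positivity), ← Real.rpow_add hR, add_neg_cancel, Real.rpow_zero,
        mul_one]

lemma exists_decay_constants {B β γ : ℝ} (hB : 0 < B) (hβ : 0 < β) (hγ : 0 < γ) :
    ∃ ε a : ℝ, 0 < ε ∧ 0 < a ∧ a < 1 ∧
      ∀ j : ℕ, B * (ε * a ^ j) ^ β * (4 / (1 / 2) ^ j) ^ γ = a := by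
  set a : ℝ := 2 ^ (-(γ / β)) with ha
  have ha0 : 0 < a := by positivity
  have haβ : a ^ β * 2 ^ γ = 1 := by
    rw [ha, ← Real.rpow_mul zero_le_two, neg_mul, div_mul_cancel₀ _ hβ.ne',
      ← Real.rpow_add zero_lt_two, neg_add_cancel, Real.rpow_zero]
  set ε : ℝ := (a / (B * 4 ^ γ)) ^ β⁻¹ with hε
  have hε0 : 0 < ε := by positivity
  have hεβ : ε ^ β = a / (B * 4 ^ γ) := by rw [hε, Real.rpow_inv_rpow (by positivity) hβ.ne']
  refine ⟨ε, a, hε0, ha0, Real.rpow_lt_one_of_one_lt_of_neg one_lt_two (by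
    rw [neg_lt_zero]; positivity), fun j => ?_⟩
  have hpow : (ε * a ^ j) ^ β = ε ^ β * (a ^ β) ^ j := by
    rw [Real.mul_rpow hε0.le (by positivity), Real.rpow_pow_comm ha0.le]
  have hdyadic : (4 / (1 / 2) ^ j : ℝ) ^ γ = 4 ^ γ * (2 ^ γ) ^ j := by
    rw [one_div, inv_pow, div_inv_eq_mul, Real.mul_rpow (by norm_num) (by positivity),
      Real.rpow_pow_comm zero_le_two]
  calc B * (ε * a ^ j) ^ β * (4 / (1 / 2) ^ j) ^ γ
      = B * 4 ^ γ * ε ^ β * (a ^ β * 2 ^ γ) ^ j := by rw [hpow, hdyadic, mul_pow]; ring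
    _ = a := by rw [haβ, one_pow, mul_one, hεβ]; field_simp

lemma ae_le_of_lintegral_excess_rpow_eq_zero (hu : Measurable u) {B : Set (Eucl n)}
    (h : ∫⁻ x in B, ENNReal.ofReal (excess u k x ^ p) = 0) :
    ∀ᵐ x ∂volume.restrict B, u x ≤ k := by
  have hm := measurable_excess hu k
  rw [lintegral_eq_zero_iff (by fun_prop)] at h
  filter_upwards [h] with x hx
  by_contra! hlt
  have hpos : 0 < excess u k x := lt_max_of_lt_left (sub_pos.2 hlt)
  exact (ENNReal.ofReal_pos.2 (Real.rpow_pos_of_pos hpos p)).ne' hx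

theorem exists_ae_le_of_lintegral_excess_le (hn : 1 ≤ n) (hsp : 0 < s * p) (hp : 1 < p)
    (hC : 0 < C) (hA : 1 ≤ A) :
    ∃ ε : ℝ, 0 < ε ∧ ∀ (Ω : Set (Eucl n)) (u : Eucl n → ℝ) (f₀ : ℝ), IsDeGiorgi s p C f₀ Ω u →
      ∀ (x₀ : Eucl n) (R k d : ℝ), 0 < R → 0 < d → Metric.ball x₀ (2 * R) ⊆ Ω →
      ∫⁻ x in Metric.ball x₀ (2 * R), ENNReal.ofReal (excess u k x ^ p) ≤
        ENNReal.ofReal (ε * R ^ (n : ℝ) * d ^ p) →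
      ∫⁻ x in (Metric.ball x₀ R)ᶜ, ENNReal.ofReal
        (excess u k x ^ (p - 1) * ‖x - x₀‖ ^ (-((n : ℝ) + s * p))) ≤
        ENNReal.ofReal (A * d ^ (p - 1) * R ^ (-(s * p))) →
      f₀ ≤ A * d ^ (p - 1) * R ^ (-(s * p)) →
      ∀ᵐ x ∂volume.restrict (Metric.ball x₀ R), u x ≤ k + d := by
  have : (0 : ℝ) < n := by exact_mod_cast hn
  obtain ⟨ε, a, hε, ha, ha1, hdecay⟩ := exists_decay_constants (by positivity : 0 < 3 * A * C)
    (by positivity : 0 < s * p / n) (by positivity : 0 < (n : ℝ) + s * p + p + p * (s * p / n))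
  refine ⟨ε, hε, fun Ω u f₀ hu x₀ R k d hR hd hball hY hT hf => ?_⟩
  have hiter (j : ℕ) : ∫⁻ x in Metric.ball x₀ (R * (1 + (1 / 2) ^ j)), ENNReal.ofReal
      (excess u (k + d * (1 - (1 / 2) ^ j)) x ^ p) ≤
      ENNReal.ofReal (ε * a ^ j * R ^ (n : ℝ) * d ^ p) := by
    induction j with
    | zero => simpa only [pow_zero, sub_self, mul_zero, add_zero, mul_one, one_add_one_eq_two,
        mul_comm R] using hY
    | succ j ih =>
      have hstep := hu.iteration_step hn hsp.le hp hC.le hA hR hd (by positivity)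
        (pow_le_one₀ (by norm_num) (by norm_num)) (by positivity) hball ih hT hf
      rw [hdecay, ← mul_one_div, ← pow_succ] at hstep
      exact hstep.trans_eq (by ring_nf)
  apply ae_le_of_lintegral_excess_rpow_eq_zero (p := p) hu.measurable
  have hlim : Filter.Tendsto (fun j : ℕ => ENNReal.ofReal (ε * a ^ j * R ^ (n : ℝ) * d ^ p))
      Filter.atTop (nhds 0) := by
    rw [← ENNReal.ofReal_zero]
    apply ENNReal.tendsto_ofReal
    simpa using (((tendsto_pow_atTop_nhds_zero_of_lt_one ha.le ha1).const_mul ε).mul_const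
      (R ^ (n : ℝ))).mul_const (d ^ p)
  refine le_antisymm (ge_of_tendsto' hlim fun j => le_trans ?_ (hiter j)) zero_le
  have ht : (0 : ℝ) < (1 / 2) ^ j := by positivity
  refine (lintegral_mono_set (Metric.ball_subset_ball (by nlinarith))).trans
    (lintegral_mono fun x => ENNReal.ofReal_le_ofReal ?_)
  exact Real.rpow_le_rpow (excess_nonneg u _ x) (excess_anti u (by nlinarith) x) (by linarith)

end Iteration

section Growth

variable {n : ℕ} {s p C D D' M f₀ k r ρ : ℝ} {Ω : Set (Eucl n)} {u : Eucl n → ℝ} {x₀ : Eucl n}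

/-- The tail of `w` outside the ball of radius `ρ` and the source term `f₀` are at most
`D ^ (p - 1) * ρ ^ (-(s * p))`, their natural size for functions of height `D`. -/
structure HasTailBound (s p f₀ D : ℝ) (w : Eucl n → ℝ) (x₀ : Eucl n) (ρ : ℝ) : Prop where
  tail_le : ∫⁻ x in (Metric.ball x₀ ρ)ᶜ, ENNReal.ofReal
    (w x ^ (p - 1) * ‖x - x₀‖ ^ (-((n : ℝ) + s * p))) ≤
      ENNReal.ofReal (D ^ (p - 1) * ρ ^ (-(s * p)))
  source_le : f₀ ≤ D ^ (p - 1) * ρ ^ (-(s * p))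

/-- `M` bounds `u` from above on the ball of radius `ρ`, and outside that ball up to an error whose
tail has height `D`. -/
structure IsAlmostUpperBound (s p f₀ D : ℝ) (u : Eucl n → ℝ) (x₀ : Eucl n) (ρ M : ℝ) : Prop
    extends HasTailBound s p f₀ D (excess u M) x₀ ρ where
  ae_le : ∀ᵐ x ∂volume.restrict (Metric.ball x₀ ρ), u x ≤ M

lemma HasTailBound.mono {w : Eucl n → ℝ} (h : HasTailBound s p f₀ D w x₀ ρ) (hp : 1 ≤ p)
    (hρ : 0 ≤ ρ) (hD : 0 ≤ D) (hD' : D ≤ D') : HasTailBound s p f₀ D' w x₀ ρ := by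
  have hle : D ^ (p - 1) * ρ ^ (-(s * p)) ≤ D' ^ (p - 1) * ρ ^ (-(s * p)) := by
    gcongr
  exact ⟨h.tail_le.trans (ENNReal.ofReal_le_ofReal hle), h.source_le.trans hle⟩

lemma lintegral_rpow_mul_le_of_le_add {α : Type*} [MeasurableSpace α] {μ : Measure α}
    {q : ℝ} {w F G κ : α → ℝ} (hq : 0 ≤ q) (hF : Measurable F) (hκ : Measurable κ)
    (hw0 : ∀ x, 0 ≤ w x) (hF0 : ∀ x, 0 ≤ F x) (hG0 : ∀ x, 0 ≤ G x) (hκ0 : ∀ x, 0 ≤ κ x)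
    (h : ∀ᵐ x ∂μ, w x ≤ F x + G x) :
    ∫⁻ x, ENNReal.ofReal (w x ^ q * κ x) ∂μ ≤ ENNReal.ofReal (2 ^ q) *
      (∫⁻ x, ENNReal.ofReal (F x ^ q * κ x) ∂μ + ∫⁻ x, ENNReal.ofReal (G x ^ q * κ x) ∂μ) := by
  rw [← lintegral_add_left (by fun_prop), ← lintegral_const_mul' _ _ ENNReal.ofReal_ne_top]
  refine lintegral_mono_ae (h.mono fun x hx => ?_)
  have hF := hF0 x
  have hG := hG0 x
  have hκ := hκ0 x
  rw [← ENNReal.ofReal_add (by positivity) (by positivity), ← ENNReal.ofReal_mul (by positivity)]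
  apply ENNReal.ofReal_le_ofReal
  calc w x ^ q * κ x ≤ 2 ^ q * (F x ^ q + G x ^ q) * κ x := by
        gcongr
        exact (Real.rpow_le_rpow (hw0 x) hx hq).trans (add_rpow_le_two_rpow_mul hF hG hq)
    _ = 2 ^ q * (F x ^ q * κ x + G x ^ q * κ x) := by ring

lemma excess_sub_le (hD : 0 ≤ D) (u : Eucl n → ℝ) (M : ℝ) (x : Eucl n) :
    excess u (M - D) x ≤ D + excess u M x := by
  unfold excess
  exact max_le (by linarith [le_max_left (u x - M) 0]) (by positivity)

lemma excess_sub_le_of_le (hD : 0 ≤ D) {x : Eucl n} (h : u x ≤ M) : excess u (M - D) x ≤ D :=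
  max_le (by linarith) hD

lemma setLIntegral_indicator_rpow_mul_le {α : Type*} [MeasurableSpace α] {μ : Measure α}
    {q : ℝ} (hq : q ≠ 0) {A B : Set α} (hB : MeasurableSet B) (w κ : α → ℝ) :
    ∫⁻ x in A, ENNReal.ofReal (B.indicator w x ^ q * κ x) ∂μ ≤
      ∫⁻ x in B, ENNReal.ofReal (w x ^ q * κ x) ∂μ := by
  refine (setLIntegral_le_lintegral _ _).trans_eq ?_
  rw [← lintegral_indicator hB]
  refine lintegral_congr fun x => ?_
  by_cases hx : x ∈ B
  · rw [indicator_of_mem hx, indicator_of_mem hx]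
  · rw [indicator_of_notMem hx, indicator_of_notMem hx, Real.zero_rpow hq, zero_mul,
      ENNReal.ofReal_zero]

lemma IsAlmostUpperBound.exists_lintegral_tail_le (hn : 1 ≤ n) (hsp : 0 < s * p) (hp : 1 < p) :
    ∃ C : ℝ, 1 ≤ C ∧ ∀ {u : Eucl n → ℝ} {x₀ : Eucl n} {f₀ D r ρ M : ℝ}, 0 < r → r ≤ ρ → 0 ≤ D →
      IsAlmostUpperBound s p f₀ D u x₀ ρ M →
      ∫⁻ x in (Metric.ball x₀ r)ᶜ, ENNReal.ofReal
        (excess u (M - D) x ^ (p - 1) * ‖x - x₀‖ ^ (-((n : ℝ) + s * p))) ≤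
        ENNReal.ofReal (C * D ^ (p - 1) * r ^ (-(s * p))) := by
  obtain ⟨C, hC, hker⟩ := exists_lintegral_kernel_compl_ball_le hn hsp (n := n)
  have hp1 : 0 < p - 1 := by linarith
  refine ⟨2 ^ (p - 1) * (C + 1),
    one_le_mul_of_one_le_of_one_le (Real.one_le_rpow one_le_two hp1.le) (by linarith), ?_⟩
  intro u x₀ f₀ D r ρ M hr hrρ hD h
  have hsplit : ∀ᵐ x ∂volume.restrict (Metric.ball x₀ r)ᶜ,
      excess u (M - D) x ≤ D + (Metric.ball x₀ ρ)ᶜ.indicator (excess u M) x := by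
    filter_upwards [ae_restrict_of_ae ((ae_restrict_iff' measurableSet_ball).1 h.ae_le)] with x hx
    by_cases hxB : x ∈ Metric.ball x₀ ρ
    · rw [indicator_of_notMem (notMem_compl_iff.2 hxB), add_zero]
      exact excess_sub_le_of_le hD (hx hxB)
    · rw [indicator_of_mem (mem_compl hxB)]
      exact excess_sub_le hD u M x
  refine (lintegral_rpow_mul_le_of_le_add hp1.le measurable_const (by fun_prop)
    (excess_nonneg u _) (fun _ => hD) (indicator_nonneg fun x _ => excess_nonneg u M x)
    (fun _ => by positivity) hsplit).trans ?_
  have hnear : ∫⁻ x in (Metric.ball x₀ r)ᶜ,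
      ENNReal.ofReal (D ^ (p - 1) * ‖x - x₀‖ ^ (-((n : ℝ) + s * p))) ≤
      ENNReal.ofReal (D ^ (p - 1) * (C * r ^ (-(s * p)))) := by
    simp_rw [ENNReal.ofReal_mul (by positivity : 0 ≤ D ^ (p - 1))]
    rw [lintegral_const_mul' _ _ ENNReal.ofReal_ne_top]
    gcongr
    exact hker x₀ r hr
  have hfar := (setLIntegral_indicator_rpow_mul_le hp1.ne' (A := (Metric.ball x₀ r)ᶜ)
    measurableSet_ball.compl (excess u M) _).trans h.tail_le
  refine (mul_le_mul' le_rfl (add_le_add hnear hfar)).trans ?_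
  have : 0 ≤ ρ := hr.le.trans hrρ
  rw [← ENNReal.ofReal_add (by positivity) (by positivity), ← ENNReal.ofReal_mul (by positivity)]
  apply ENNReal.ofReal_le_ofReal
  calc 2 ^ (p - 1) * (D ^ (p - 1) * (C * r ^ (-(s * p))) + D ^ (p - 1) * ρ ^ (-(s * p)))
      ≤ 2 ^ (p - 1) * (D ^ (p - 1) * (C * r ^ (-(s * p))) + D ^ (p - 1) * r ^ (-(s * p))) := by
        gcongr 2 ^ (p - 1) * (_ + _ * ?_)
        exact Real.rpow_le_rpow_of_nonpos hr hrρ (by linarith)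
    _ = 2 ^ (p - 1) * (C + 1) * D ^ (p - 1) * r ^ (-(s * p)) := by ring

lemma setLIntegral_excess_rpow_le (hu : Measurable u) (hp : 0 < p) (hD : 0 ≤ D) {B : Set (Eucl n)}
    (h : ∀ᵐ x ∂volume.restrict B, u x ≤ M) :
    ∫⁻ x in B, ENNReal.ofReal (excess u (M - D) x ^ p) ≤
      ENNReal.ofReal (D ^ p) * volume (B ∩ {x | M - D < u x}) := by
  have hm : MeasurableSet {x | M - D < u x} := measurableSet_lt measurable_const hu
  rw [inter_comm, ← Measure.restrict_apply hm, ← lintegral_indicator_const hm]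
  refine lintegral_mono_ae (h.mono fun x hx => ?_)
  by_cases hxD : M - D < u x
  · rw [indicator_of_mem (mem_ofPred_eq ▸ hxD)]
    exact ENNReal.ofReal_le_ofReal
      (Real.rpow_le_rpow (excess_nonneg u _ x) (excess_sub_le_of_le hD hx) hp.le)
  · rw [excess_eq_zero (not_lt.1 hxD), Real.zero_rpow hp.ne', ENNReal.ofReal_zero]
    exact zero_le

lemma setLIntegral_ball_excess_rpow_le (hu : Measurable u) (hp : 0 < p) (hD : 0 ≤ D) (hρ : 0 < ρ)
    (h : ∀ᵐ x ∂volume.restrict (Metric.ball x₀ ρ), u x ≤ M) :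
    ∫⁻ x in Metric.ball x₀ ρ, ENNReal.ofReal (excess u (M - D) x ^ p) ≤
      ENNReal.ofReal (unitVol n * D ^ p * ρ ^ (n : ℝ)) := by
  refine (setLIntegral_excess_rpow_le hu hp hD h).trans ?_
  rw [mul_right_comm, mul_comm, ENNReal.ofReal_mul' (by positivity), ← volume_ball_eq x₀ hρ]
  gcongr
  exact inter_subset_left

lemma energyBound_ball_le (hD : 0 ≤ D) (hρ : 0 < ρ) (hp : 1 < p) {a : ℝ} (ha : 0 ≤ a)
    (hf : f₀ ≤ D ^ (p - 1) * ρ ^ (-(s * p))) :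
    energyBound n s p (ρ / 2) ρ f₀ (a * D ^ p * ρ ^ (n : ℝ)) (a * D * ρ ^ (n : ℝ))
        (C * D ^ (p - 1) * ρ ^ (-(s * p))) ≤
      a * (2 ^ (s * p) + 2 ^ ((n : ℝ) + s * p) * C + 1) * D ^ p * ρ ^ (n : ℝ) *
        ρ ^ (-(s * p)) := by
  rw [energyBound, sub_half, div_div_cancel₀ hρ.ne', div_eq_mul_inv, Real.mul_rpow hρ.le (by simp),
    ← Real.rpow_neg_one 2, ← Real.rpow_mul zero_le_two, neg_one_mul, neg_neg]
  calc _ ≤ ρ ^ (-(s * p)) * 2 ^ (s * p) * (a * D ^ p * ρ ^ (n : ℝ)) +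
        (2 ^ ((n : ℝ) + s * p) * (C * D ^ (p - 1) * ρ ^ (-(s * p))) +
          D ^ (p - 1) * ρ ^ (-(s * p))) * (a * D * ρ ^ (n : ℝ)) := by gcongr
    _ = ρ ^ (-(s * p)) * a * ρ ^ (n : ℝ) *
        (2 ^ (s * p) * D ^ p + (2 ^ ((n : ℝ) + s * p) * C + 1) * (D ^ (p - 1) * D)) := by ring
    _ = _ := by rw [rpow_sub_one_mul_self hD (by linarith)]; ring

lemma IsDeGiorgi.exists_lintegral_mul_lintegral_le (hn : 1 ≤ n) (hsp : 0 < s * p) (hp : 1 < p)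
    (hC : 0 < C) :
    ∃ C' : ℝ, 0 < C' ∧ ∀ {Ω : Set (Eucl n)} {u : Eucl n → ℝ} {x₀ : Eucl n} {f₀ D ρ M : ℝ},
      IsDeGiorgi s p C f₀ Ω u → 0 < ρ → 0 ≤ D → Metric.ball x₀ ρ ⊆ Ω →
      IsAlmostUpperBound s p f₀ D u x₀ ρ M →
      (∫⁻ x in Metric.ball x₀ (ρ / 2), ENNReal.ofReal (excess u (M - D) x)) *
        ∫⁻ x in Metric.ball x₀ (ρ / 2), ENNReal.ofReal (max (M - D - u x) 0 ^ (p - 1)) ≤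
      ENNReal.ofReal (C' * D ^ p * ρ ^ (n : ℝ) * ρ ^ (n : ℝ)) := by
  obtain ⟨C₁, hC₁, htail⟩ := IsAlmostUpperBound.exists_lintegral_tail_le hn hsp hp (n := n)
  have hω := unitVol_pos n
  refine ⟨C * (unitVol n * (2 ^ (s * p) + 2 ^ ((n : ℝ) + s * p) * C₁ + 1)), by positivity, ?_⟩
  intro Ω u x₀ f₀ D ρ M hu hρ hD hball h
  have hb : ExcessBounds s p u x₀ ρ (M - D) (unitVol n * D ^ p * ρ ^ (n : ℝ))
      (unitVol n * D * ρ ^ (n : ℝ)) (C₁ * D ^ (p - 1) * ρ ^ (-(s * p))) :=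
    { nonneg_Y := by positivity
      nonneg_W := by positivity
      nonneg_T := by positivity
      bound_Y := setLIntegral_ball_excess_rpow_le hu.measurable (by linarith) hD hρ h.ae_le
      bound_W := by
        simpa only [Real.rpow_one] using
          setLIntegral_ball_excess_rpow_le hu.measurable one_pos hD hρ h.ae_le
      bound_T := htail hρ le_rfl hD h }
  refine (hu.product_le x₀ (ρ / 2) ρ _ _ _ _ (half_pos hρ) (half_lt_self hρ) hball hb).trans
    (ENNReal.ofReal_le_ofReal ?_)
  set B := unitVol n * (2 ^ (s * p) + 2 ^ ((n : ℝ) + s * p) * C₁ + 1)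
  have : 0 ≤ B := by positivity
  calc _ ≤ C * ρ ^ ((n : ℝ) + s * p) * (B * D ^ p * ρ ^ (n : ℝ) * ρ ^ (-(s * p))) := by
        refine mul_le_mul ?_ (energyBound_ball_le hD hρ hp hω.le h.source_le)
          (energyBound_nonneg (by positivity) (half_lt_self hρ) hu.nonneg hb.nonneg_Y hb.nonneg_W
            hb.nonneg_T) (by positivity)
        gcongr
        linarith
    _ = C * B * D ^ p * ρ ^ (n : ℝ) * (ρ ^ ((n : ℝ) + s * p) * ρ ^ (-(s * p))) := by ring
    _ = _ := by rw [← Real.rpow_add hρ, add_neg_cancel_right]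

lemma ofReal_mul_half_volume_le (hu : Measurable u) (hp : 1 < p) {h : ℝ} (hh : 0 ≤ h)
    (hD : D ≤ h / 2) {B : Set (Eucl n)} (hB : volume B / 2 ≤ volume (B ∩ {x | u x ≤ M - h})) :
    ENNReal.ofReal ((h / 2) ^ (p - 1)) * (volume B / 2) ≤
      ∫⁻ x in B, ENNReal.ofReal (max (M - D - u x) 0 ^ (p - 1)) := by
  refine (mul_le_mul' le_rfl hB).trans
    (ofReal_mul_volume_inter_le (measurableSet_le hu measurable_const) fun x hx => ?_)
  rw [mem_ofPred_eq] at hx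
  exact Real.rpow_le_rpow (by positivity) (le_max_of_le_left (by linarith)) (by linarith)

lemma IsDeGiorgi.exists_volume_gt_le (hn : 1 ≤ n) (hsp : 0 < s * p) (hp : 1 < p) (hC : 0 < C) :
    ∃ m : ℝ, 0 < m ∧ ∀ {Ω : Set (Eucl n)} {u : Eucl n → ℝ} {x₀ : Eucl n} {f₀ δ ρ M h : ℝ},
      IsDeGiorgi s p C f₀ Ω u → 0 < δ → δ ≤ 1 / 4 → 0 < ρ → 0 < h → Metric.ball x₀ ρ ⊆ Ω →
      IsAlmostUpperBound s p f₀ (δ * h) u x₀ ρ M →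
      volume (Metric.ball x₀ (ρ / 2)) / 2 ≤
        volume (Metric.ball x₀ (ρ / 2) ∩ {x | u x ≤ M - h}) →
      volume (Metric.ball x₀ (ρ / 2) ∩ {x | M - δ * h < u x}) ≤
        ENNReal.ofReal (m * δ ^ (p - 1) * ρ ^ (n : ℝ)) := by
  obtain ⟨C', hC', hprod⟩ := IsDeGiorgi.exists_lintegral_mul_lintegral_le hn hsp hp hC (n := n)
  have hω := unitVol_pos n
  refine ⟨C' * 2 ^ p * 2 ^ (p - 1) * 2 ^ (n : ℝ) * 2 / unitVol n, by positivity, ?_⟩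
  intro Ω u x₀ f₀ δ ρ M h hu hδ hδ4 hρ hh hball hM hhalf
  have hle := hprod hu hρ (by positivity : 0 ≤ 2 * (δ * h)) hball
    ⟨hM.toHasTailBound.mono hp.le hρ.le (by positivity) (by nlinarith [mul_pos hδ hh]), hM.ae_le⟩
  have hupper : ENNReal.ofReal (δ * h) * volume (Metric.ball x₀ (ρ / 2) ∩ {x | M - δ * h < u x}) ≤
      ∫⁻ x in Metric.ball x₀ (ρ / 2), ENNReal.ofReal (excess u (M - 2 * (δ * h)) x) :=
    ofReal_mul_volume_inter_le (measurableSet_lt measurable_const hu.measurable) fun x hx =>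
      le_max_of_le_left (by linarith [mem_ofPred_eq ▸ hx])
  have hlower := ofReal_mul_half_volume_le hu.measurable hp hh.le
    (by nlinarith : 2 * (δ * h) ≤ h / 2) hhalf
  have hhalf_eq (a : ℝ) : ENNReal.ofReal a / 2 = ENNReal.ofReal (a / 2) := by
    rw [ENNReal.ofReal_div_of_pos zero_lt_two, ENNReal.ofReal_ofNat]
  rw [volume_ball_eq x₀ (half_pos hρ), hhalf_eq, ← ENNReal.ofReal_mul (by positivity)] at hlower
  set g := δ * h * ((h / 2) ^ (p - 1) * (unitVol n * (ρ / 2) ^ (n : ℝ) / 2)) with hg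
  have hg0 : 0 < g := by positivity
  refine (ENNReal.mul_le_mul_iff_right (ENNReal.ofReal_pos.2 hg0).ne' ENNReal.ofReal_ne_top).1 ?_
  calc _ = ENNReal.ofReal (δ * h) *
          volume (Metric.ball x₀ (ρ / 2) ∩ {x | M - δ * h < u x}) *
          ENNReal.ofReal ((h / 2) ^ (p - 1) * (unitVol n * (ρ / 2) ^ (n : ℝ) / 2)) := by
        rw [hg, ENNReal.ofReal_mul (by positivity), mul_right_comm]
    _ ≤ _ := (mul_le_mul' hupper hlower).trans hle
    _ = _ := by
        rw [← ENNReal.ofReal_mul hg0.le, hg]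
        congr 1
        rw [Real.mul_rpow zero_le_two (by positivity), ← rpow_sub_one_mul_self (a := δ * h)
          (by positivity) (by linarith : p ≠ 0), Real.mul_rpow hδ.le hh.le,
          Real.div_rpow hh.le zero_le_two, Real.div_rpow hρ.le zero_le_two]
        field_simp

lemma exists_mul_rpow_le {m a q : ℝ} (hm : 0 < m) (ha : 0 < a) (hq : 0 < q) :
    ∃ δ : ℝ, 0 < δ ∧ δ ≤ 1 / 4 ∧ m * δ ^ q ≤ a := by
  refine ⟨min (1 / 4) ((a / m) ^ q⁻¹), by positivity, min_le_left _ _, ?_⟩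
  rw [← le_div_iff₀' hm]
  exact (Real.rpow_le_rpow (by positivity) (min_le_right _ _) hq.le).trans_eq
    (Real.rpow_inv_rpow (by positivity) hq.ne')

theorem IsDeGiorgi.exists_growth (hn : 1 ≤ n) (hsp : 0 < s * p) (hp : 1 < p) (hC : 0 < C) :
    ∃ δ : ℝ, 0 < δ ∧ δ ≤ 1 / 4 ∧
      ∀ {Ω : Set (Eucl n)} {u : Eucl n → ℝ} {x₀ : Eucl n} {f₀ ρ M h : ℝ},
      IsDeGiorgi s p C f₀ Ω u → 0 < ρ → 0 < h → Metric.ball x₀ ρ ⊆ Ω →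
      IsAlmostUpperBound s p f₀ (δ * h) u x₀ ρ M →
      volume (Metric.ball x₀ (ρ / 2)) / 2 ≤
        volume (Metric.ball x₀ (ρ / 2) ∩ {x | u x ≤ M - h}) →
      ∀ᵐ x ∂volume.restrict (Metric.ball x₀ (ρ / 4)), u x ≤ M - δ * h / 2 := by
  obtain ⟨C₁, hC₁, htail⟩ := IsAlmostUpperBound.exists_lintegral_tail_le hn hsp hp (n := n)
  obtain ⟨m, hm, hvol⟩ := IsDeGiorgi.exists_volume_gt_le hn hsp hp hC (n := n)
  have hp1 : 0 < p - 1 := by linarith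
  set A : ℝ := 2 ^ (p - 1) * C₁ with hA
  have hA1 : 1 ≤ A := one_le_mul_of_one_le_of_one_le (Real.one_le_rpow one_le_two hp1.le) hC₁
  obtain ⟨ε, hε, hcrit⟩ := exists_ae_le_of_lintegral_excess_le hn hsp hp hC hA1 (n := n)
  obtain ⟨δ, hδ, hδ4, hδε⟩ := exists_mul_rpow_le hm
    (by positivity : 0 < ε * 4⁻¹ ^ (n : ℝ) * 2⁻¹ ^ p) hp1
  refine ⟨δ, hδ, hδ4, ?_⟩
  intro Ω u x₀ f₀ ρ M h hu hρ hh hball hM hhalf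
  have hv := hvol hu hδ hδ4 hρ hh hball hM hhalf
  set D := δ * h
  have hD : 0 < D := by positivity
  have hdouble : 2 * (ρ / 4) = ρ / 2 := by ring
  have hhalfball : Metric.ball x₀ (ρ / 2) ⊆ Metric.ball x₀ ρ :=
    Metric.ball_subset_ball (half_le_self hρ.le)
  have hscale : A * (D / 2) ^ (p - 1) * (ρ / 4) ^ (-(s * p)) =
      C₁ * D ^ (p - 1) * (ρ / 4) ^ (-(s * p)) := by
    rw [hA, Real.div_rpow hD.le zero_le_two]
    field_simp
  have hbelow := hcrit Ω u f₀ hu x₀ (ρ / 4) (M - D) (D / 2) (by positivity) (by positivity)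
    (hdouble ▸ hhalfball.trans hball) ?_ ?_ ?_
  · filter_upwards [hbelow] with x hx
    linarith
  · rw [hdouble]
    refine (setLIntegral_excess_rpow_le hu.measurable (by linarith) hD.le
      (ae_restrict_of_ae_restrict_of_subset hhalfball hM.ae_le)).trans
      ((mul_le_mul' le_rfl hv).trans ?_)
    rw [← ENNReal.ofReal_mul (by positivity)]
    apply ENNReal.ofReal_le_ofReal
    rw [div_eq_mul_inv, div_eq_mul_inv, Real.mul_rpow hρ.le (by norm_num),
      Real.mul_rpow hD.le (by norm_num)]
    calc D ^ p * (m * δ ^ (p - 1) * ρ ^ (n : ℝ))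
        ≤ D ^ p * (ε * 4⁻¹ ^ (n : ℝ) * 2⁻¹ ^ p * ρ ^ (n : ℝ)) := by gcongr
      _ = _ := by ring
  · rw [hscale]
    exact htail (by positivity) (by linarith) hD.le hM
  · rw [hscale]
    calc f₀ ≤ D ^ (p - 1) * ρ ^ (-(s * p)) := hM.source_le
      _ ≤ C₁ * D ^ (p - 1) * (ρ / 4) ^ (-(s * p)) := by
          gcongr ?_ * ?_
          · exact le_mul_of_one_le_left (by positivity) hC₁
          · exact Real.rpow_le_rpow_of_nonpos (by positivity) (by linarith) (by linarith)

end Growth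

section OscillationStep

variable {n : ℕ} {s p C α β τ ρ M O f₀ : ℝ} {Ω : Set (Eucl n)} {u E : Eucl n → ℝ} {x₀ : Eucl n}

lemma rpow_sub_one_le_div_mul_rpow {x : ℝ} (hx : 1 ≤ x) (hα : 0 < α) (hαβ : α ≤ β) :
    x ^ α - 1 ≤ α / β * x ^ β := by
  have hβ : 0 < β := hα.trans_le hαβ
  have hxβ : 0 < x ^ β := by positivity
  have hbernoulli := rpow_one_add_le_one_add_mul_self (s := x ^ β - 1) (by linarith) (p := α / β)
    (by positivity) ((div_le_one hβ).2 hαβ)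
  rw [add_sub_cancel, ← Real.rpow_mul (by linarith), mul_div_cancel₀ _ hβ.ne'] at hbernoulli
  have : 0 < α / β := by positivity
  linarith

lemma mul_rpow_four_sub_one_le {x : ℝ} (hO : 0 ≤ O) (hα : 0 < α) (hαβ : α ≤ β) (hx : 1 ≤ x) :
    O * ((4 * x) ^ α - 1) ≤ O * (α / β * 4 ^ β) * x ^ β := by
  calc O * ((4 * x) ^ α - 1) ≤ O * (α / β * (4 * x) ^ β) := by
        gcongr
        exact rpow_sub_one_le_div_mul_rpow (by linarith) hα hαβ
    _ = _ := by rw [Real.mul_rpow zero_le_four (by positivity)]; ring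

lemma one_sub_four_rpow_neg_le (hα : 0 ≤ α) : 1 - (4 : ℝ) ^ (-α) ≤ 2 * α := by
  have hlog : Real.log 4 ≤ 2 := by
    rw [show (4 : ℝ) = 2 ^ 2 by norm_num, Real.log_pow]
    have := Real.log_two_lt_d9
    push_cast
    linarith
  rw [Real.rpow_def_of_pos zero_lt_four]
  nlinarith [Real.add_one_le_exp (Real.log 4 * (-α))]

lemma exists_lintegral_rpow_growth_le (hn : 1 ≤ n) (hsp : 0 < s * p) (hp : 1 < p) :
    ∃ B : ℝ, 0 < B ∧ ∀ (x₀ : Eucl n) {a ρ : ℝ}, 0 ≤ a → 0 < ρ →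
      ∫⁻ x in (Metric.ball x₀ ρ)ᶜ, ENNReal.ofReal
        ((a * (‖x - x₀‖ / ρ) ^ (s * p / (2 * (p - 1)))) ^ (p - 1) *
          ‖x - x₀‖ ^ (-((n : ℝ) + s * p))) ≤
        ENNReal.ofReal ((B * a) ^ (p - 1) * ρ ^ (-(s * p))) := by
  obtain ⟨C, hC, hker⟩ := exists_lintegral_growth_kernel_le hn (half_lt_self hsp) (n := n)
  have hp1 : 0 < p - 1 := by linarith
  refine ⟨C ^ (p - 1)⁻¹, by positivity, fun x₀ a ρ ha hρ => ?_⟩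
  have hfactor (x : Eucl n) : (a * (‖x - x₀‖ / ρ) ^ (s * p / (2 * (p - 1)))) ^ (p - 1) *
      ‖x - x₀‖ ^ (-((n : ℝ) + s * p)) =
      a ^ (p - 1) * ((‖x - x₀‖ / ρ) ^ (s * p / 2) * ‖x - x₀‖ ^ (-((n : ℝ) + s * p))) := by
    rw [Real.mul_rpow ha (by positivity), ← Real.rpow_mul (by positivity), mul_assoc, ← div_div,
      div_mul_cancel₀ _ hp1.ne']
  simp_rw [hfactor, ENNReal.ofReal_mul (by positivity : 0 ≤ a ^ (p - 1))]
  rw [lintegral_const_mul' _ _ ENNReal.ofReal_ne_top, Real.mul_rpow (by positivity) ha,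
    Real.rpow_inv_rpow (by linarith) hp1.ne', mul_comm C, mul_assoc,
    ENNReal.ofReal_mul (by positivity)]
  gcongr
  exact hker x₀ ρ hρ

lemma exists_isAlmostUpperBound_of_growth (hn : 1 ≤ n) (hsp : 0 < s * p) (hp : 1 < p) :
    ∃ A B : ℝ, 0 < A ∧ 0 < B ∧
      ∀ {u E : Eucl n → ℝ} {x₀ : Eucl n} {f₀ α τ ρ M O : ℝ}, 0 < α →
      α ≤ s * p / (2 * (p - 1)) → α * B ≤ τ → 0 < ρ → 0 ≤ O → (∀ x, 0 ≤ E x) →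
      (∀ᵐ x ∂volume.restrict (Metric.ball x₀ ρ), u x ≤ M) →
      (∀ᵐ x ∂volume.restrict (Metric.ball x₀ ρ)ᶜ,
        excess u M x ≤ O * ((4 * ‖x - x₀‖ / ρ) ^ α - 1) + E x) →
      HasTailBound s p f₀ (τ * O) E x₀ ρ →
      IsAlmostUpperBound s p f₀ (A * τ * O) u x₀ ρ M := by
  obtain ⟨B, hB, hpower⟩ := exists_lintegral_rpow_growth_le hn hsp hp (n := n)
  have hp1 : 0 < p - 1 := by linarith
  set β := s * p / (2 * (p - 1))
  have : 0 < β := by positivity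
  have hA : 1 ≤ 2 * (2 : ℝ) ^ (p - 1)⁻¹ :=
    one_le_mul_of_one_le_of_one_le one_le_two (Real.one_le_rpow one_le_two (by positivity))
  refine ⟨2 * 2 ^ (p - 1)⁻¹, B * (4 ^ β / β), by positivity, by positivity, ?_⟩
  intro u E x₀ f₀ α τ ρ M O hα hαβ hατ hρ hO hE hM hoff htail
  have hτ : 0 < τ := (mul_pos hα (by positivity)).trans_le hατ
  set a := O * (α / β * 4 ^ β) with ha
  have ha0 : 0 ≤ a := by positivity
  have hBa : B * a ≤ τ * O := by
    rw [show B * a = α * (B * (4 ^ β / β)) * O by rw [ha]; ring]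
    gcongr
  have hgrowth : ∀ᵐ x ∂volume.restrict (Metric.ball x₀ ρ)ᶜ,
      excess u M x ≤ a * (‖x - x₀‖ / ρ) ^ β + E x := by
    filter_upwards [hoff, ae_restrict_mem measurableSet_ball.compl] with x hx hxB
    rw [mem_compl_iff, mem_ball_iff_norm, not_lt, ← one_le_div hρ] at hxB
    rw [mul_div_assoc] at hx
    exact hx.trans (add_le_add (mul_rpow_four_sub_one_le hO hα hαβ hxB) le_rfl)
  refine ⟨⟨?_, (htail.mono hp.le hρ.le (by positivity) ?_).source_le⟩, hM⟩
  · refine (lintegral_rpow_mul_le_of_le_add hp1.le (by fun_prop) (by fun_prop) (excess_nonneg u M)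
      (fun _ => by positivity) hE (fun _ => by positivity) hgrowth).trans
      ((mul_le_mul' le_rfl (add_le_add (hpower x₀ ha0 hρ) htail.tail_le)).trans ?_)
    rw [← ENNReal.ofReal_add (by positivity) (by positivity), ← ENNReal.ofReal_mul (by positivity)]
    apply ENNReal.ofReal_le_ofReal
    calc 2 ^ (p - 1) * ((B * a) ^ (p - 1) * ρ ^ (-(s * p)) + (τ * O) ^ (p - 1) * ρ ^ (-(s * p)))
        ≤ 2 ^ (p - 1) *
          ((τ * O) ^ (p - 1) * ρ ^ (-(s * p)) + (τ * O) ^ (p - 1) * ρ ^ (-(s * p))) := by gcongr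
      _ = 2 ^ (p - 1) * 2 * (τ * O) ^ (p - 1) * ρ ^ (-(s * p)) := by ring
      _ = _ := by
          rw [mul_assoc (2 * (2 : ℝ) ^ (p - 1)⁻¹), Real.mul_rpow (y := τ * O) (by positivity)
            (by positivity), Real.mul_rpow (x := 2) zero_le_two (by positivity),
            Real.rpow_inv_rpow zero_le_two hp1.ne']
  · rw [mul_assoc]
    exact le_mul_of_one_le_left (by positivity) hA

theorem IsDeGiorgi.exists_oscillation_step (hn : 1 ≤ n) (hsp : 0 < s * p) (hp : 1 < p)
    (hC : 0 < C) :
    ∃ α τ : ℝ, 0 < α ∧ α < 1 ∧ α * (p - 1) ≤ s * p ∧ 0 < τ ∧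
      ∀ {Ω : Set (Eucl n)} {u E : Eucl n → ℝ} {x₀ : Eucl n} {f₀ ρ M O : ℝ},
      IsDeGiorgi s p C f₀ Ω u → 0 < ρ → 0 < O → Metric.ball x₀ ρ ⊆ Ω → (∀ x, 0 ≤ E x) →
      (∀ᵐ x ∂volume.restrict (Metric.ball x₀ ρ), u x ≤ M) →
      (∀ᵐ x ∂volume.restrict (Metric.ball x₀ ρ)ᶜ,
        excess u M x ≤ O * ((4 * ‖x - x₀‖ / ρ) ^ α - 1) + E x) →
      HasTailBound s p f₀ (τ * O) E x₀ ρ →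
      volume (Metric.ball x₀ (ρ / 2)) / 2 ≤
        volume (Metric.ball x₀ (ρ / 2) ∩ {x | u x ≤ M - O / 2}) →
      ∀ᵐ x ∂volume.restrict (Metric.ball x₀ (ρ / 4)), u x ≤ M - (1 - 4 ^ (-α)) * O := by
  obtain ⟨δ, hδ, hδ4, hgrowth⟩ := IsDeGiorgi.exists_growth hn hsp hp hC (n := n)
  obtain ⟨A, B, hA, hB, hbound⟩ := exists_isAlmostUpperBound_of_growth hn hsp hp (n := n)
  have hp1 : 0 < p - 1 := by linarith
  set τ := δ / (2 * A) with hτ_def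
  have hτ : 0 < τ := by positivity
  have hAτ (O : ℝ) : A * τ * O = δ * (O / 2) := by rw [hτ_def]; field_simp
  set α := min (min (s * p / (2 * (p - 1))) (δ / 8)) (τ / B)
  have hα : 0 < α := by positivity
  have hαβ : α ≤ s * p / (2 * (p - 1)) := (min_le_left _ _).trans (min_le_left _ _)
  have hαδ : α ≤ δ / 8 := (min_le_left _ _).trans (min_le_right _ _)
  refine ⟨α, τ, hα, by linarith, ?_, hτ, ?_⟩
  · rw [← le_div_iff₀ hp1]
    refine hαβ.trans (div_le_div_of_nonneg_left hsp.le hp1 (by linarith))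
  intro Ω u E x₀ f₀ ρ M O hu hρ hO hball hE hM hoff htail hhalf
  have hupper := hbound hα hαβ ((le_div_iff₀ hB).1 (min_le_right _ _)) hρ hO.le hE hM hoff htail
  rw [hAτ] at hupper
  have hdecay : (1 - 4 ^ (-α)) * O ≤ δ * (O / 2) / 2 := by
    nlinarith [one_sub_four_rpow_neg_le hα.le]
  filter_upwards [hgrowth hu hρ (half_pos hO) hball hupper hhalf] with x hx
  linarith

end OscillationStep

/-- The geometric form of `α`-Hölder continuity of `u` at `z`, up to null sets and with value `c`
there: `u` is within `B * 4 ^ (-α * j)` of `c` almost everywhere on the ball of radius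
`R / 4 ^ j`. -/
def HasHolderDecay {X : Type*} [PseudoMetricSpace X] [MeasurableSpace X] (μ : Measure X)
    (α B R : ℝ) (u : X → ℝ) (z : X) (c : ℝ) : Prop :=
  ∀ j : ℕ, ∀ᵐ x ∂μ.restrict (Metric.ball z (R / 4 ^ j)), |u x - c| ≤ B * (4 ^ (-α)) ^ j

section OscillationDecay

variable {n : ℕ} {s p C D α τ ρ m O R f₀ : ℝ} {Ω : Set (Eucl n)} {u E : Eucl n → ℝ} {x₀ : Eucl n}

/-- `u` takes values in `[m, m + O]` on the ball of radius `ρ` and leaves this interval at most at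
the rate of the power `α` of the distance to `x₀`, up to the error `E`. The error is supported
outside the ball and its tail has height `τ * O`. -/
structure IsOscillationBound (s p f₀ α τ : ℝ) (u E : Eucl n → ℝ) (x₀ : Eucl n) (ρ m O : ℝ) : Prop
    extends HasTailBound s p f₀ (τ * O) E x₀ ρ where
  error_nonneg : ∀ x, 0 ≤ E x
  error_eq_zero : ∀ x ∈ Metric.ball x₀ ρ, E x = 0
  inside : ∀ᵐ x ∂volume.restrict (Metric.ball x₀ ρ), m ≤ u x ∧ u x ≤ m + O
  outside : ∀ᵐ x ∂volume.restrict (Metric.ball x₀ ρ)ᶜ,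
    m + O - (O * (4 * ‖x - x₀‖ / ρ) ^ α + E x) ≤ u x ∧
      u x ≤ m + (O * (4 * ‖x - x₀‖ / ρ) ^ α + E x)

lemma le_mul_rpow_four_div (hα : 0 ≤ α) (hρ : 0 < ρ) (hO : 0 ≤ O) {r : ℝ} (hr : ρ / 4 ≤ r) :
    O ≤ O * (4 * r / ρ) ^ α := by
  refine le_mul_of_one_le_right hO (Real.one_le_rpow ?_ hα)
  rw [one_le_div hρ]
  linarith

lemma rpow_neg_mul_rpow_four_div {r : ℝ} (hr : 0 ≤ r) (hρ : 0 < ρ) :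
    4 ^ (-α) * O * (4 * r / (ρ / 4)) ^ α = O * (4 * r / ρ) ^ α := by
  rw [show 4 * r / (ρ / 4) = 4 * (4 * r / ρ) by field_simp, Real.mul_rpow zero_le_four
    (by positivity), Real.rpow_neg zero_le_four]
  field_simp

lemma HasTailBound.div_four (h : HasTailBound s p f₀ D E x₀ ρ) (hp : 1 < p)
    (hαp : α * (p - 1) ≤ s * p) (hρ : 0 < ρ) (hD : 0 ≤ D)
    (hE : ∀ x ∈ Metric.ball x₀ ρ, E x = 0) :
    HasTailBound s p f₀ (4 ^ (-α) * D) E x₀ (ρ / 4) := by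
  have hp1 : 0 < p - 1 := by linarith
  have hle : D ^ (p - 1) * ρ ^ (-(s * p)) ≤
      (4 ^ (-α) * D) ^ (p - 1) * (ρ / 4) ^ (-(s * p)) := by
    rw [Real.mul_rpow (by positivity) hD, Real.div_rpow hρ.le zero_le_four, div_eq_mul_inv,
      ← Real.rpow_neg zero_le_four, neg_neg, ← Real.rpow_mul zero_le_four]
    have hone : 1 ≤ (4 : ℝ) ^ (-α * (p - 1)) * 4 ^ (s * p) := by
      rw [← Real.rpow_add zero_lt_four]
      exact Real.one_le_rpow (by norm_num) (by linarith)
    calc D ^ (p - 1) * ρ ^ (-(s * p))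
        ≤ 4 ^ (-α * (p - 1)) * 4 ^ (s * p) * (D ^ (p - 1) * ρ ^ (-(s * p))) :=
          le_mul_of_one_le_left (by positivity) hone
      _ = _ := by ring
  have hind : (Metric.ball x₀ ρ)ᶜ.indicator E = E :=
    indicator_eq_self.2 fun x hx hxB => hx (hE x hxB)
  refine ⟨?_, h.source_le.trans hle⟩
  have htail := setLIntegral_indicator_rpow_mul_le (μ := volume) hp1.ne'
    (A := (Metric.ball x₀ (ρ / 4))ᶜ)
    (B := (Metric.ball x₀ ρ)ᶜ) measurableSet_ball.compl E
    fun x => ‖x - x₀‖ ^ (-((n : ℝ) + s * p))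
  rw [hind] at htail
  exact htail.trans (h.tail_le.trans (ENNReal.ofReal_le_ofReal hle))

lemma IsOscillationBound.neg (h : IsOscillationBound s p f₀ α τ u E x₀ ρ m O) :
    IsOscillationBound s p f₀ α τ (-u) E x₀ ρ (-(m + O)) O where
  toHasTailBound := h.toHasTailBound
  error_nonneg := h.error_nonneg
  error_eq_zero := h.error_eq_zero
  inside := by
    filter_upwards [h.inside] with x hx
    rw [Pi.neg_apply]
    constructor <;> linarith
  outside := by
    filter_upwards [h.outside] with x hx
    rw [Pi.neg_apply]
    constructor <;> linarith

lemma IsOscillationBound.excess_le (h : IsOscillationBound s p f₀ α τ u E x₀ ρ m O) (hα : 0 ≤ α)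
    (hρ : 0 < ρ) (hO : 0 ≤ O) :
    ∀ᵐ x ∂volume.restrict (Metric.ball x₀ ρ)ᶜ,
      excess u (m + O) x ≤ O * ((4 * ‖x - x₀‖ / ρ) ^ α - 1) + E x := by
  filter_upwards [h.outside, ae_restrict_mem measurableSet_ball.compl] with x hx hxB
  rw [mem_compl_iff, mem_ball_iff_norm, not_lt] at hxB
  have := le_mul_rpow_four_div hα hρ hO (r := ‖x - x₀‖) (by linarith)
  have := h.error_nonneg x
  exact max_le (by linarith) (by linarith)

lemma IsOscillationBound.div_four (h : IsOscillationBound s p f₀ α τ u E x₀ ρ m O) (hp : 1 < p)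
    (hα : 0 ≤ α) (hαp : α * (p - 1) ≤ s * p) (hτ : 0 ≤ τ) (hρ : 0 < ρ) (hO : 0 ≤ O)
    (hle : ∀ᵐ x ∂volume.restrict (Metric.ball x₀ (ρ / 4)), u x ≤ m + 4 ^ (-α) * O) :
    IsOscillationBound s p f₀ α τ u E x₀ (ρ / 4) m (4 ^ (-α) * O) where
  toHasTailBound := by
    rw [mul_left_comm]
    exact h.toHasTailBound.div_four hp hαp hρ (by positivity) h.error_eq_zero
  error_nonneg := h.error_nonneg
  error_eq_zero x hx := h.error_eq_zero x (Metric.ball_subset_ball (by linarith) hx)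
  inside := by
    filter_upwards [hle, ae_restrict_of_ae_restrict_of_subset
      (Metric.ball_subset_ball (by linarith)) h.inside] with x hxle hx
    exact ⟨hx.1, hxle⟩
  outside := by
    have hθ : 4 ^ (-α) * O ≤ O := mul_le_of_le_one_left hO
      (Real.rpow_le_one_of_one_le_of_nonpos (by norm_num) (by linarith))
    have hin := h.inside
    have hout := h.outside
    rw [ae_restrict_iff' measurableSet_ball] at hin
    rw [ae_restrict_iff' measurableSet_ball.compl] at hout ⊢
    filter_upwards [hin, hout] with x hxin hxout hx
    rw [mem_compl_iff, mem_ball_iff_norm, not_lt] at hx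
    rw [rpow_neg_mul_rpow_four_div (norm_nonneg _) hρ]
    have := le_mul_rpow_four_div hα hρ hO hx
    have := h.error_nonneg x
    by_cases hxB : x ∈ Metric.ball x₀ ρ
    · have := hxin hxB
      constructor <;> linarith
    · have := hxout hxB
      constructor <;> linarith

lemma IsDeGiorgi.exists_isOscillationBound_div_four_of_half (hn : 1 ≤ n) (hsp : 0 < s * p)
    (hp : 1 < p) (hC : 0 < C) :
    ∃ α τ : ℝ, 0 < α ∧ α < 1 ∧ 0 < τ ∧
      ∀ {Ω : Set (Eucl n)} {u E : Eucl n → ℝ} {x₀ : Eucl n} {f₀ ρ m O : ℝ},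
      IsDeGiorgi s p C f₀ Ω u → 0 < ρ → 0 < O → Metric.ball x₀ ρ ⊆ Ω →
      IsOscillationBound s p f₀ α τ u E x₀ ρ m O →
      volume (Metric.ball x₀ (ρ / 2)) / 2 ≤
        volume (Metric.ball x₀ (ρ / 2) ∩ {x | u x ≤ m + O / 2}) →
      IsOscillationBound s p f₀ α τ u E x₀ (ρ / 4) m (4 ^ (-α) * O) := by
  obtain ⟨α, τ, hα, hα1, hαp, hτ, hstep⟩ := IsDeGiorgi.exists_oscillation_step hn hsp hp hC (n := n)
  refine ⟨α, τ, hα, hα1, hτ, fun {Ω u E x₀ f₀ ρ m O} hu hρ hO hball h hhalf => ?_⟩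
  refine h.div_four hp hα.le hαp hτ.le hρ hO.le ?_
  rw [show m + O / 2 = m + O - O / 2 by ring] at hhalf
  filter_upwards [hstep hu hρ hO hball h.error_nonneg (h.inside.mono fun _ hx => hx.2)
    (h.excess_le hα.le hρ hO.le) h.toHasTailBound hhalf] with x hx
  linarith

lemma measure_half_le_inter_or {α : Type*} [MeasurableSpace α] {μ : Measure α} {A S T : Set α}
    (hA : A ⊆ S ∪ T) : μ A / 2 ≤ μ (A ∩ S) ∨ μ A / 2 ≤ μ (A ∩ T) := by
  by_contra! hlt
  refine absurd (ENNReal.add_lt_add hlt.1 hlt.2) (not_lt.2 ?_)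
  rw [ENNReal.add_halves]
  refine (measure_mono ?_).trans (measure_union_le _ _)
  rw [← inter_union_distrib_left]
  exact subset_inter Subset.rfl hA

lemma IsDeGiorgi.exists_isOscillationBound_div_four (hn : 1 ≤ n) (hsp : 0 < s * p) (hp : 1 < p)
    (hC : 0 < C) :
    ∃ α τ : ℝ, 0 < α ∧ α < 1 ∧ 0 < τ ∧
      ∀ {Ω : Set (Eucl n)} {u E : Eucl n → ℝ} {x₀ : Eucl n} {f₀ ρ m O : ℝ},
      IsDeGiorgi s p C f₀ Ω u → IsDeGiorgi s p C f₀ Ω (-u) → 0 < ρ → 0 < O →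
      Metric.ball x₀ ρ ⊆ Ω → IsOscillationBound s p f₀ α τ u E x₀ ρ m O →
      ∃ m', m ≤ m' ∧ m' + 4 ^ (-α) * O ≤ m + O ∧
        IsOscillationBound s p f₀ α τ u E x₀ (ρ / 4) m' (4 ^ (-α) * O) := by
  obtain ⟨α, τ, hα, hα1, hτ, hstep⟩ :=
    IsDeGiorgi.exists_isOscillationBound_div_four_of_half hn hsp hp hC (n := n)
  refine ⟨α, τ, hα, hα1, hτ, fun {Ω u E x₀ f₀ ρ m O} hu hu' hρ hO hball h => ?_⟩
  have hθ : 4 ^ (-α) * O ≤ O := mul_le_of_le_one_left hO.le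
    (Real.rpow_le_one_of_one_le_of_nonpos (by norm_num) (by linarith))
  have hcover : Metric.ball x₀ (ρ / 2) ⊆
      {x | u x ≤ m + O / 2} ∪ {x | (-u) x ≤ -(m + O) + O / 2} := fun x _ => by
    refine (le_total (u x) (m + O / 2)).imp id fun hx => ?_
    rw [mem_ofPred_eq, Pi.neg_apply]
    linarith
  rcases measure_half_le_inter_or hcover with hhalf | hhalf
  · exact ⟨m, le_rfl, by linarith, hstep hu hρ hO hball h hhalf⟩
  · have hneg := (hstep hu' hρ hO hball h.neg hhalf).neg
    rw [neg_neg] at hneg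
    exact ⟨_, by linarith, by linarith, hneg⟩

lemma HasTailBound.isOscillationBound (h : HasTailBound s p f₀ (τ * O) (fun x => |u x|) x₀ R)
    (hp : 1 < p) (hα : 0 ≤ α) (hR : 0 < R) (hO : 0 ≤ O)
    (hbd : ∀ᵐ x ∂volume.restrict (Metric.ball x₀ R), |u x| ≤ O / 2) :
    IsOscillationBound s p f₀ α τ u ((Metric.ball x₀ R)ᶜ.indicator fun x => |u x|) x₀ R
      (-(O / 2)) O where
  tail_le := (setLIntegral_indicator_rpow_mul_le (by linarith) measurableSet_ball.compl _ _).trans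
    h.tail_le
  source_le := h.source_le
  error_nonneg := indicator_nonneg fun _ _ => abs_nonneg _
  error_eq_zero _ hx := indicator_of_notMem (notMem_compl_iff.2 hx) _
  inside := by
    filter_upwards [hbd] with x hx
    rw [abs_le] at hx
    constructor <;> linarith
  outside := by
    filter_upwards [ae_restrict_mem measurableSet_ball.compl] with x hx
    rw [indicator_of_mem hx]
    rw [mem_compl_iff, mem_ball_iff_norm, not_lt] at hx
    have := le_mul_rpow_four_div hα hR hO (r := ‖x - x₀‖) (by linarith)
    have := neg_abs_le (u x)
    have := le_abs_self (u x)
    constructor <;> linarith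

theorem IsDeGiorgi.exists_oscillation_decay (hn : 1 ≤ n) (hsp : 0 < s * p) (hp : 1 < p)
    (hC : 0 < C) :
    ∃ α τ : ℝ, 0 < α ∧ α < 1 ∧ 0 < τ ∧
      ∀ {Ω : Set (Eucl n)} {u : Eucl n → ℝ} {x₀ : Eucl n} {f₀ R H : ℝ},
      IsDeGiorgi s p C f₀ Ω u → IsDeGiorgi s p C f₀ Ω (-u) → 0 < R → 0 < H →
      Metric.ball x₀ R ⊆ Ω →
      (∀ᵐ x ∂volume.restrict (Metric.ball x₀ R), |u x| ≤ H / 2) →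
      HasTailBound s p f₀ (τ * H) (fun x => |u x|) x₀ R →
      ∃ c : ℝ, |c| ≤ H / 2 ∧ HasHolderDecay volume α H R u x₀ c := by
  obtain ⟨α, τ, hα, hα1, hτ, hstep⟩ :=
    IsDeGiorgi.exists_isOscillationBound_div_four hn hsp hp hC (n := n)
  refine ⟨α, τ, hα, hα1, hτ, ?_⟩
  intro Ω u x₀ f₀ R H hu hu' hR hH hball hbd htail
  set E := (Metric.ball x₀ R)ᶜ.indicator fun x => |u x|
  set O : ℕ → ℝ := fun j => H * (4 ^ (-α)) ^ j
  have hO (j : ℕ) : 0 < O j := by positivity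
  have hOsucc (j : ℕ) : O (j + 1) = 4 ^ (-α) * O j := by simp only [O]; ring
  have hnext (j : ℕ) (m : ℝ) (h : IsOscillationBound s p f₀ α τ u E x₀ (R / 4 ^ j) m (O j)) :
      ∃ m', m ≤ m' ∧ m' + O (j + 1) ≤ m + O j ∧
        IsOscillationBound s p f₀ α τ u E x₀ (R / 4 ^ (j + 1)) m' (O (j + 1)) := by
    rw [hOsucc, pow_succ, ← div_div]
    have hsub : R / 4 ^ j ≤ R := div_le_self hR.le (one_le_pow₀ (by norm_num))
    exact hstep hu hu' (by positivity) (hO j) ((Metric.ball_subset_ball hsub).trans hball) h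
  choose! next hmono hanti hbound using hnext
  let m : ℕ → ℝ := fun j => Nat.rec (-(H / 2)) next j
  have hm (j : ℕ) : IsOscillationBound s p f₀ α τ u E x₀ (R / 4 ^ j) (m j) (O j) := by
    induction j with
    | zero => simpa [O, m] using htail.isOscillationBound hp hα.le hR hH.le hbd
    | succ j ih => exact hbound j (m j) ih
  have hmono' : Monotone m := monotone_nat_of_le_succ fun j => hmono j (m j) (hm j)
  have hanti' : Antitone fun j => m j + O j := antitone_nat_of_succ_le fun j => hanti j (m j) (hm j)
  have hc := hmono'.ciSup_mem_iInter_Icc_of_antitone hanti' fun j =>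
    le_add_of_nonneg_right (hO j).le
  rw [mem_iInter] at hc
  refine ⟨⨆ j, m j, ?_, fun j => ?_⟩
  · have h0 : -(H / 2) ≤ _ ∧ _ ≤ -(H / 2) + H * (4 ^ (-α)) ^ 0 := hc 0
    rw [pow_zero, mul_one] at h0
    rw [abs_le]
    constructor <;> linarith
  · filter_upwards [(hm j).inside] with x hx
    have hj := hc j
    rw [mem_Icc] at hj
    rw [abs_le]
    constructor <;> linarith

end OscillationDecay

section PointValues

variable {n : ℕ} {s p q C N R f₀ : ℝ} {Ω : Set (Eucl n)} {u : Eucl n → ℝ} {x x₀ z : Eucl n}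

/-- The number `N` bounds, in units natural for the radius `R`, the `L ^ p` norm of `u` on the ball
of radius `2 * R`, its tail outside the ball of radius `R`, and the source term `f₀`. -/
structure HasSizeBound (s p f₀ N : ℝ) (u : Eucl n → ℝ) (x₀ : Eucl n) (R : ℝ) : Prop
    extends HasTailBound s p f₀ N (fun x => |u x|) x₀ R where
  energy_le : ∫⁻ x in Metric.ball x₀ (2 * R), ENNReal.ofReal (|u x| ^ p) ≤
    ENNReal.ofReal (N ^ p * R ^ (n : ℝ))

lemma HasSizeBound.neg (h : HasSizeBound s p f₀ N u x₀ R) : HasSizeBound s p f₀ N (-u) x₀ R where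
  tail_le := by simpa only [Pi.neg_apply, abs_neg] using h.tail_le
  source_le := h.source_le
  energy_le := by simpa only [Pi.neg_apply, abs_neg] using h.energy_le

lemma rpow_sub_one_le_add_div {a : ℝ} (ha : 0 ≤ a) (hN : 0 < N) (hp : 1 < p) :
    a ^ (p - 1) ≤ N ^ (p - 1) + a ^ p / N := by
  rcases le_total a N with h | h
  · have : a ^ (p - 1) ≤ N ^ (p - 1) := Real.rpow_le_rpow ha h (by linarith)
    have : 0 ≤ a ^ p / N := by positivity
    linarith
  · have : a ^ (p - 1) ≤ a ^ p / N := by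
      rw [le_div_iff₀ hN]
      calc a ^ (p - 1) * N ≤ a ^ (p - 1) * a := by gcongr
        _ = a ^ p := rpow_sub_one_mul_self ha (by linarith)
    have : 0 ≤ N ^ (p - 1) := by positivity
    linarith

lemma HasSizeBound.lintegral_rpow_sub_one_le (h : HasSizeBound s p f₀ N u x₀ R) (hp : 1 < p)
    (hR : 0 < R) (hN : 0 < N) :
    ∫⁻ x in Metric.ball x₀ R, ENNReal.ofReal (|u x| ^ (p - 1)) ≤
      ENNReal.ofReal ((unitVol n + 1) * N ^ (p - 1) * R ^ (n : ℝ)) := by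
  have := unitVol_pos n
  calc ∫⁻ x in Metric.ball x₀ R, ENNReal.ofReal (|u x| ^ (p - 1))
      ≤ ∫⁻ x in Metric.ball x₀ R, (ENNReal.ofReal (N ^ (p - 1)) +
          ENNReal.ofReal (|u x| ^ p) * ENNReal.ofReal N⁻¹) := by
        refine lintegral_mono fun x => ?_
        rw [← ENNReal.ofReal_mul (by positivity),
          ← ENNReal.ofReal_add (by positivity) (by positivity)]
        exact ENNReal.ofReal_le_ofReal (rpow_sub_one_le_add_div (abs_nonneg _) hN hp)
    _ = ENNReal.ofReal (N ^ (p - 1)) * ENNReal.ofReal (unitVol n * R ^ (n : ℝ)) +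
          (∫⁻ x in Metric.ball x₀ R, ENNReal.ofReal (|u x| ^ p)) * ENNReal.ofReal N⁻¹ := by
        rw [lintegral_add_left measurable_const, setLIntegral_const, volume_ball_eq x₀ hR,
          lintegral_mul_const' _ _ ENNReal.ofReal_ne_top]
    _ ≤ ENNReal.ofReal (N ^ (p - 1)) * ENNReal.ofReal (unitVol n * R ^ (n : ℝ)) +
          ENNReal.ofReal (N ^ p * R ^ (n : ℝ)) * ENNReal.ofReal N⁻¹ := by
        gcongr
        exact (lintegral_mono_set (Metric.ball_subset_ball (by linarith))).trans h.energy_le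
    _ = ENNReal.ofReal ((unitVol n + 1) * N ^ (p - 1) * R ^ (n : ℝ)) := by
        rw [← ENNReal.ofReal_mul (by positivity), ← ENNReal.ofReal_mul (by positivity),
          ← ENNReal.ofReal_add (by positivity) (by positivity)]
        have hNp : N ^ p = N ^ (p - 1) * N := (rpow_sub_one_mul_self hN.le (by linarith)).symm
        rw [hNp]
        congr 1
        field_simp

lemma norm_sub_rpow_neg_le (hR : 0 < R) (hq : 0 ≤ q) (hz : z ∈ Metric.ball x₀ R)
    (hx : x ∉ Metric.ball x₀ R) (hxz : x ∉ Metric.ball z (R / 2)) :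
    ‖x - z‖ ^ (-q) ≤ 3 ^ q * ‖x - x₀‖ ^ (-q) := by
  rw [mem_ball_iff_norm] at hz
  rw [mem_ball_iff_norm, not_lt] at hx hxz
  have hdist : ‖x - x₀‖ / 3 ≤ ‖x - z‖ := by
    have := norm_sub_le_norm_sub_add_norm_sub x z x₀
    linarith
  calc ‖x - z‖ ^ (-q) ≤ (‖x - x₀‖ / 3) ^ (-q) :=
        Real.rpow_le_rpow_of_nonpos (by linarith) hdist (by linarith)
    _ = 3 ^ q * ‖x - x₀‖ ^ (-q) := by
        rw [Real.div_rpow (norm_nonneg _) zero_le_three, Real.rpow_neg zero_le_three,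
          div_inv_eq_mul, mul_comm]

lemma HasSizeBound.lintegral_tail_near_le (h : HasSizeBound s p f₀ N u x₀ R) (hsp : 0 < s * p)
    (hp : 1 < p) (hR : 0 < R) (hN : 0 < N) (z : Eucl n) :
    ∫⁻ x in Metric.ball x₀ R \ Metric.ball z (R / 2), ENNReal.ofReal
      (|u x| ^ (p - 1) * ‖x - z‖ ^ (-((n : ℝ) + s * p))) ≤
      ENNReal.ofReal
        (2 ^ ((n : ℝ) + s * p) * (unitVol n + 1) * (N ^ (p - 1) * R ^ (-(s * p)))) := by
  have := unitVol_pos n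
  set q := (n : ℝ) + s * p with hq
  have : 0 < q := by positivity
  calc ∫⁻ x in Metric.ball x₀ R \ Metric.ball z (R / 2), ENNReal.ofReal
        (|u x| ^ (p - 1) * ‖x - z‖ ^ (-q))
      ≤ ∫⁻ x in Metric.ball x₀ R \ Metric.ball z (R / 2),
          ENNReal.ofReal ((R / 2) ^ (-q)) * ENNReal.ofReal (|u x| ^ (p - 1)) := by
        refine setLIntegral_mono' (measurableSet_ball.diff measurableSet_ball) fun x hx => ?_
        rw [← ENNReal.ofReal_mul (by positivity), mul_comm]
        have hxz := hx.2
        rw [mem_ball_iff_norm, not_lt] at hxz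
        gcongr ENNReal.ofReal (?_ * _)
        exact Real.rpow_le_rpow_of_nonpos (by positivity) hxz (by linarith)
    _ ≤ ENNReal.ofReal ((R / 2) ^ (-q)) *
          ENNReal.ofReal ((unitVol n + 1) * N ^ (p - 1) * R ^ (n : ℝ)) := by
        rw [lintegral_const_mul' _ _ ENNReal.ofReal_ne_top]
        gcongr
        exact (lintegral_mono_set sdiff_subset).trans (h.lintegral_rpow_sub_one_le hp hR hN)
    _ = ENNReal.ofReal (2 ^ q * (unitVol n + 1) * (N ^ (p - 1) * R ^ (-(s * p)))) := by
        rw [← ENNReal.ofReal_mul (by positivity), Real.div_rpow hR.le zero_le_two,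
          Real.rpow_neg zero_le_two, div_inv_eq_mul,
          show -(s * p) = -q + n by rw [hq]; ring, Real.rpow_add hR]
        congr 1
        ring

lemma HasSizeBound.lintegral_tail_far_le (h : HasSizeBound s p f₀ N u x₀ R) (hsp : 0 < s * p)
    (hR : 0 < R) (hz : z ∈ Metric.ball x₀ R) :
    ∫⁻ x in (Metric.ball x₀ R)ᶜ \ Metric.ball z (R / 2), ENNReal.ofReal
      (|u x| ^ (p - 1) * ‖x - z‖ ^ (-((n : ℝ) + s * p))) ≤
      ENNReal.ofReal (3 ^ ((n : ℝ) + s * p) * (N ^ (p - 1) * R ^ (-(s * p)))) := by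
  set q := (n : ℝ) + s * p
  have hq0 : 0 < q := by positivity
  calc ∫⁻ x in (Metric.ball x₀ R)ᶜ \ Metric.ball z (R / 2), ENNReal.ofReal
        (|u x| ^ (p - 1) * ‖x - z‖ ^ (-q))
      ≤ ∫⁻ x in (Metric.ball x₀ R)ᶜ \ Metric.ball z (R / 2),
          ENNReal.ofReal (3 ^ q) * ENNReal.ofReal (|u x| ^ (p - 1) * ‖x - x₀‖ ^ (-q)) := by
        refine setLIntegral_mono' (measurableSet_ball.compl.diff measurableSet_ball) fun x hx => ?_
        rw [← ENNReal.ofReal_mul (by positivity), mul_left_comm]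
        gcongr
        exact norm_sub_rpow_neg_le hR hq0.le hz hx.1 hx.2
    _ ≤ ENNReal.ofReal (3 ^ q * (N ^ (p - 1) * R ^ (-(s * p)))) := by
        rw [lintegral_const_mul' _ _ ENNReal.ofReal_ne_top, ENNReal.ofReal_mul (by positivity)]
        gcongr
        exact (lintegral_mono_set sdiff_subset).trans h.tail_le

lemma HasSizeBound.exists_hasTailBound (hsp : 0 < s * p) (hp : 1 < p) :
    ∃ A : ℝ, 1 ≤ A ∧ ∀ {f₀ N R : ℝ} {u : Eucl n → ℝ} {x₀ z : Eucl n}, 0 < R → 0 < N →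
      HasSizeBound s p f₀ N u x₀ R → z ∈ Metric.ball x₀ R →
      HasTailBound s p f₀ (A * N) (fun x => |u x|) z (R / 2) := by
  have hp1 : 0 < p - 1 := by linarith
  have := unitVol_pos n
  set q := (n : ℝ) + s * p
  set A := 2 ^ q * (unitVol n + 1) + 3 ^ q
  have hA1 : 1 ≤ A := by
    have : (1 : ℝ) ≤ 3 ^ q := Real.one_le_rpow (by norm_num) (by positivity)
    have : 0 < 2 ^ q * (unitVol n + 1) := by positivity
    linarith
  refine ⟨A ^ (p - 1)⁻¹, Real.one_le_rpow hA1 (by positivity), ?_⟩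
  intro f₀ N R u x₀ z hR hN h hz
  have hscale : A * (N ^ (p - 1) * R ^ (-(s * p))) ≤
      (A ^ (p - 1)⁻¹ * N) ^ (p - 1) * (R / 2) ^ (-(s * p)) := by
    rw [Real.mul_rpow (by positivity) hN.le, Real.rpow_inv_rpow (by positivity) hp1.ne', mul_assoc]
    gcongr A * (_ * ?_)
    exact Real.rpow_le_rpow_of_nonpos (by positivity) (by linarith) (by linarith)
  have hsplit : (Metric.ball z (R / 2))ᶜ ⊆ (Metric.ball x₀ R \ Metric.ball z (R / 2)) ∪
      ((Metric.ball x₀ R)ᶜ \ Metric.ball z (R / 2)) := by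
    rw [← union_sdiff_distrib, union_compl_self, compl_eq_univ_sdiff]
  refine ⟨?_, h.source_le.trans ((le_mul_of_one_le_left (by positivity) hA1).trans hscale)⟩
  refine (lintegral_mono_set hsplit).trans ((lintegral_union_le _ _ _).trans
    ((add_le_add (h.lintegral_tail_near_le hsp hp hR hN z)
      (h.lintegral_tail_far_le hsp hR hz)).trans ?_))
  rw [← ENNReal.ofReal_add (by positivity) (by positivity), ← add_mul]
  exact ENNReal.ofReal_le_ofReal hscale

lemma excess_zero_le_abs (u : Eucl n → ℝ) (x : Eucl n) : excess u 0 x ≤ |u x| := by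
  rw [excess, sub_zero]
  exact max_le (le_abs_self _) (abs_nonneg _)

lemma IsDeGiorgi.exists_ae_le_of_hasSizeBound (hn : 1 ≤ n) (hsp : 0 < s * p) (hp : 1 < p)
    (hC : 0 < C) :
    ∃ D : ℝ, 0 < D ∧ ∀ {Ω : Set (Eucl n)} {u : Eucl n → ℝ} {x₀ z : Eucl n} {f₀ R N : ℝ},
      IsDeGiorgi s p C f₀ Ω u → 0 < R → 0 < N → Metric.ball x₀ (2 * R) ⊆ Ω →
      HasSizeBound s p f₀ N u x₀ R → z ∈ Metric.ball x₀ R →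
      ∀ᵐ x ∂volume.restrict (Metric.ball z (R / 2)), u x ≤ D * N := by
  have hp0 : 0 < p := by linarith
  obtain ⟨ε, hε, hcrit⟩ := exists_ae_le_of_lintegral_excess_le hn hsp hp hC le_rfl (n := n)
  obtain ⟨A, hA, htail⟩ := HasSizeBound.exists_hasTailBound hsp hp (n := n)
  set D := max A ((2 ^ (n : ℝ) / ε) ^ p⁻¹)
  have hAD : A ≤ D := le_max_left _ _
  have hD : 0 < D := by linarith
  have hDp : 2 ^ (n : ℝ) / ε ≤ D ^ p := by
    rw [← Real.rpow_inv_le_iff_of_pos (by positivity) hD.le hp0]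
    exact le_max_right _ _
  refine ⟨D, hD, ?_⟩
  intro Ω u x₀ z f₀ R N hu hR hN hball h hz
  have hzR : Metric.ball z (2 * (R / 2)) ⊆ Metric.ball x₀ (2 * R) := by
    apply Metric.ball_subset_ball'
    rw [Metric.mem_ball] at hz
    linarith
  have hzt := (htail hR hN h hz).mono hp.le (by positivity) (by positivity)
    (mul_le_mul_of_nonneg_right hAD hN.le)
  have hsmall : N ^ p * R ^ (n : ℝ) ≤ ε * (R / 2) ^ (n : ℝ) * (D * N) ^ p := by
    rw [Real.div_rpow hR.le zero_le_two, Real.mul_rpow hD.le hN.le]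
    calc N ^ p * R ^ (n : ℝ) = ε * (R ^ (n : ℝ) / 2 ^ (n : ℝ)) * (2 ^ (n : ℝ) / ε * N ^ p) := by
          field_simp
      _ ≤ ε * (R ^ (n : ℝ) / 2 ^ (n : ℝ)) * (D ^ p * N ^ p) := by gcongr
  have hle := hcrit Ω u f₀ hu z (R / 2) 0 (D * N) (by positivity) (by positivity)
    (hzR.trans hball) ?_ ?_ (by simpa using hzt.source_le)
  · simpa using hle
  · refine (lintegral_mono fun x => ENNReal.ofReal_le_ofReal (Real.rpow_le_rpow
      (excess_nonneg _ _ _) (excess_zero_le_abs u x) hp0.le)).trans ((lintegral_mono_set hzR).trans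
      (h.energy_le.trans (ENNReal.ofReal_le_ofReal hsmall)))
  · rw [one_mul]
    refine (lintegral_mono fun x => ENNReal.ofReal_le_ofReal ?_).trans hzt.tail_le
    have := excess_nonneg u 0 x
    have := excess_zero_le_abs u x
    gcongr

theorem IsDeGiorgi.exists_value_decay (hn : 1 ≤ n) (hsp : 0 < s * p) (hp : 1 < p) (hC : 0 < C) :
    ∃ α C₁ : ℝ, 0 < α ∧ α < 1 ∧ 1 ≤ C₁ ∧
      ∀ {Ω : Set (Eucl n)} {u : Eucl n → ℝ} {x₀ z : Eucl n} {f₀ R N : ℝ},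
      IsDeGiorgi s p C f₀ Ω u → IsDeGiorgi s p C f₀ Ω (-u) → 0 < R → 0 < N →
      Metric.ball x₀ (2 * R) ⊆ Ω → HasSizeBound s p f₀ N u x₀ R → z ∈ Metric.ball x₀ R →
      ∃ c : ℝ, |c| ≤ C₁ * N ∧ HasHolderDecay volume α (C₁ * N) (R / 2) u z c := by
  obtain ⟨A, hA, htail⟩ := HasSizeBound.exists_hasTailBound hsp hp (n := n)
  obtain ⟨D, _, hsup⟩ := IsDeGiorgi.exists_ae_le_of_hasSizeBound hn hsp hp hC (n := n)
  obtain ⟨α, τ, hα, hα1, hτ, hosc⟩ := IsDeGiorgi.exists_oscillation_decay hn hsp hp hC (n := n)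
  set C₁ := max 1 (max (2 * D) (A / τ))
  have hC₁ : 1 ≤ C₁ := le_max_left _ _
  have hDC₁ : 2 * D ≤ C₁ := (le_max_left _ _).trans (le_max_right _ _)
  have hAC₁ : A / τ ≤ C₁ := (le_max_right _ _).trans (le_max_right _ _)
  rw [div_le_iff₀' hτ] at hAC₁
  refine ⟨α, C₁, hα, hα1, hC₁, ?_⟩
  intro Ω u x₀ z f₀ R N hu hu' hR hN hball h hz
  have hsub : Metric.ball z (R / 2) ⊆ Metric.ball x₀ (2 * R) := by
    apply Metric.ball_subset_ball'
    rw [Metric.mem_ball] at hz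
    linarith
  have habs : ∀ᵐ x ∂volume.restrict (Metric.ball z (R / 2)), |u x| ≤ C₁ * N / 2 := by
    filter_upwards [hsup hu hR hN hball h hz, hsup hu' hR hN hball h.neg hz] with x hx hx'
    exact (abs_le'.2 ⟨hx, hx'⟩).trans (by nlinarith)
  have hzt := (htail hR hN h hz).mono hp.le (by positivity) (by positivity)
    (mul_le_mul_of_nonneg_right hAC₁ hN.le)
  rw [mul_assoc] at hzt
  obtain ⟨c, hc, hdecay⟩ := hosc hu hu' (by positivity) (by positivity) (hsub.trans hball) habs hzt
  exact ⟨c, hc.trans (half_le_self (by positivity)), hdecay⟩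

end PointValues

section PreciseRepresentative

open scoped Topology

lemma nhds_inf_ae_neBot {X : Type*} [TopologicalSpace X] [MeasurableSpace X] {μ : Measure X}
    [μ.IsOpenPosMeasure] (z : X) : (𝓝 z ⊓ ae μ).NeBot :=
  Filter.inf_neBot_iff.2 fun _ hs _ ht =>
    mem_closure_iff_nhds.1 (Measure.dense_of_ae ht z) _ hs

variable {X : Type*} [PseudoMetricSpace X] [MeasurableSpace X] [OpensMeasurableSpace X]
  {μ : Measure X} {U : Set X} {z z' : X} {u v : X → ℝ} {α b B c c' r : ℝ}

lemma nhds_inf_ae_le_ae_restrict (hU : IsOpen U) (hz : z ∈ U) : 𝓝 z ⊓ ae μ ≤ ae (μ.restrict U) := by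
  rw [ae_restrict_eq hU.measurableSet, inf_comm]
  exact inf_le_inf_left _ (Filter.le_principal_iff.2 (hU.mem_nhds hz))

lemma ae_restrict_of_forall_exists_isOpen [SecondCountableTopology X] {P : X → Prop}
    (hU : MeasurableSet U)
    (h : ∀ z ∈ U, ∃ V, IsOpen V ∧ z ∈ V ∧ ∀ᵐ x ∂μ.restrict V, x ∈ U → P x) :
    ∀ᵐ x ∂μ.restrict U, P x := by
  rw [ae_restrict_iff' hU, ae_iff]
  refine measure_null_of_locally_null _ fun z hz => ?_
  obtain ⟨V, hV, hzV, hae⟩ := h z (Classical.not_imp.1 hz).1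
  rw [ae_restrict_iff' hV.measurableSet, ae_iff] at hae
  refine ⟨_, inter_mem_nhdsWithin _ (hV.mem_nhds hzV), measure_mono_null ?_ hae⟩
  exact fun x hx hcon => hx.1 (hcon hx.2)

/-- The precise representative of `u`: its value at `z` is the limit of `u` at `z` along the
complements of null sets, and unspecified where this limit does not exist. -/
noncomputable def preciseRep (μ : Measure X) (u : X → ℝ) (z : X) : ℝ :=
  (𝓝 z ⊓ ae μ).limUnder u

lemma tendsto_mul_four_rpow_neg_pow (hα : 0 < α) (B : ℝ) :
    Filter.Tendsto (fun j : ℕ => B * (4 ^ (-α)) ^ j) Filter.atTop (𝓝 0) := by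
  have hlt : (4 : ℝ) ^ (-α) < 1 :=
    Real.rpow_lt_one_of_one_lt_of_neg (by norm_num) (neg_lt_zero.2 hα)
  have := (tendsto_pow_atTop_nhds_zero_of_lt_one (by positivity) hlt).const_mul B
  rwa [mul_zero] at this

lemma HasHolderDecay.tendsto (h : HasHolderDecay μ α B r u z c) (hα : 0 < α) (hr : 0 < r) :
    Filter.Tendsto u (𝓝 z ⊓ ae μ) (𝓝 c) := by
  refine Metric.tendsto_nhds.2 fun ε hε => ?_
  obtain ⟨j, hj⟩ := ((tendsto_mul_four_rpow_neg_pow hα B).eventually_lt_const hε).exists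
  have hz : z ∈ Metric.ball z (r / 4 ^ j) := Metric.mem_ball_self (by positivity)
  filter_upwards [(h j).filter_mono (nhds_inf_ae_le_ae_restrict Metric.isOpen_ball hz)] with x hx
  exact hx.trans_lt hj

variable [μ.IsOpenPosMeasure]

lemma HasHolderDecay.preciseRep_eq (h : HasHolderDecay μ α B r u z c) (hα : 0 < α) (hr : 0 < r) :
    preciseRep μ u z = c :=
  have := nhds_inf_ae_neBot (μ := μ) z
  (h.tendsto hα hr).limUnder_eq

lemma abs_sub_le_of_ae_ball (hd : dist z z' < r)
    (h : ∀ᵐ x ∂μ.restrict (Metric.ball z r), |u x - c| ≤ b)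
    (h' : ∀ᵐ x ∂μ.restrict (Metric.ball z' r), |u x - c'| ≤ b) : |c - c'| ≤ 2 * b := by
  have hz : z ∈ Metric.ball z' r := hd
  have hz' : z ∈ Metric.ball z r := Metric.mem_ball_self (dist_nonneg.trans_lt hd)
  have := nhds_inf_ae_neBot (μ := μ) z
  obtain ⟨x, hx, hx'⟩ :=
    ((h.filter_mono (nhds_inf_ae_le_ae_restrict Metric.isOpen_ball hz')).and
      (h'.filter_mono (nhds_inf_ae_le_ae_restrict Metric.isOpen_ball hz))).exists
  have := abs_sub_le c (u x) c'
  rw [abs_sub_comm c (u x)] at this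
  linarith

lemma rpow_neg_pow_eq_inv_pow_rpow {y : ℝ} (hy : 0 ≤ y) (α : ℝ) (j : ℕ) :
    (y ^ (-α)) ^ j = (y⁻¹ ^ j) ^ α := by
  rw [Real.rpow_neg hy, ← Real.inv_rpow hy, Real.rpow_pow_comm (inv_nonneg.2 hy)]

lemma HasHolderDecay.abs_sub_le (hα : 0 < α) (hα1 : α ≤ 1) (hr : 0 < r)
    (h : HasHolderDecay μ α B r u z c) (h' : HasHolderDecay μ α B r u z' c')
    (hc : |c| ≤ B) (hc' : |c'| ≤ B) : |c - c'| ≤ 16 * B * (dist z z' / r) ^ α := by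
  have hB : 0 ≤ B := (abs_nonneg c).trans hc
  suffices hle : |c - c'| ≤ 2 * B * (8 * (dist z z' / r)) ^ α by
    have h8 : (8 : ℝ) ^ α ≤ 8 := Real.rpow_le_self_of_one_le (by norm_num) hα1
    calc |c - c'| ≤ 2 * B * (8 ^ α * (dist z z' / r) ^ α) := by
          rwa [← Real.mul_rpow (by norm_num) (by positivity)]
      _ ≤ 2 * B * (8 * (dist z z' / r) ^ α) := by gcongr
      _ = 16 * B * (dist z z' / r) ^ α := by ring
  have hnear (j : ℕ) (hj : dist z z' < r / 4 ^ j) : |c - c'| ≤ 2 * (B * (4 ^ (-α)) ^ j) :=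
    abs_sub_le_of_ae_ball hj (h j) (h' j)
  rcases eq_or_lt_of_le' (dist_nonneg (x := z) (y := z')) with hd | hd
  · have hlim := (tendsto_mul_four_rpow_neg_pow hα B).const_mul 2
    rw [mul_zero] at hlim
    refine (ge_of_tendsto' hlim fun j => hnear j ?_).trans (by positivity)
    rw [hd]
    positivity
  rcases le_or_gt (2 * dist z z') r with hle | hgt
  · obtain ⟨j, hj, hj'⟩ := exists_nat_pow_near_of_lt_one (x := 2 * dist z z' / r)
      (y := (4 : ℝ)⁻¹) (by positivity) ((div_le_one hr).2 hle) (by norm_num) (by norm_num)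
    have hdj : dist z z' < r / 4 ^ j := by
      rw [div_le_iff₀ hr, inv_pow, inv_mul_eq_div] at hj'
      linarith
    refine (hnear j hdj).trans ?_
    rw [rpow_neg_pow_eq_inv_pow_rpow zero_le_four, ← mul_assoc]
    gcongr
    rw [pow_succ, mul_div_assoc] at hj
    linarith
  · have hone : 1 ≤ 8 * (dist z z' / r) := by
      rw [← mul_div_assoc, one_le_div hr]
      linarith
    calc |c - c'| ≤ |c| + |c'| := abs_sub _ _
      _ ≤ 2 * B := by linarith
      _ ≤ 2 * B * (8 * (dist z z' / r)) ^ α :=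
          le_mul_of_one_le_right (by positivity) (Real.one_le_rpow hone hα.le)

lemma ae_eq_of_hasHolderDecay [SecondCountableTopology X] (hU : IsOpen U) (hα : 0 < α) (hr : 0 < r)
    (h : ∀ z ∈ U, HasHolderDecay μ α B r u z (v z)) : v =ᵐ[μ.restrict U] u := by
  have hclose (j : ℕ) : ∀ᵐ x ∂μ.restrict U, |u x - v x| ≤ 3 * (B * (4 ^ (-α)) ^ j) := by
    refine ae_restrict_of_forall_exists_isOpen hU.measurableSet fun z hz => ?_
    refine ⟨Metric.ball z (r / 4 ^ j), Metric.isOpen_ball, Metric.mem_ball_self (by positivity), ?_⟩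
    filter_upwards [h z hz j, ae_restrict_mem measurableSet_ball] with x hx hxz hxU
    have hvx := abs_sub_le_of_ae_ball (Metric.mem_ball'.1 hxz) (h z hz j) (h x hxU j)
    have := abs_sub_le (u x) (v z) (v x)
    linarith
  filter_upwards [ae_all_iff.2 hclose] with x hx
  have hlim := (tendsto_mul_four_rpow_neg_pow hα B).const_mul 3
  rw [mul_zero] at hlim
  have := ge_of_tendsto' hlim hx
  exact (sub_eq_zero.1 (abs_nonpos_iff.1 this)).symm

end PreciseRepresentative

section HolderOnWith

open scoped Topology

variable {X : Type*}

lemma exists_holderOnWith_of_isCompact [PseudoMetricSpace X] {Y : Type*} [PseudoMetricSpace Y]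
    {α : ℝ≥0} (hα : 0 < α) (hα1 : α ≤ 1) {Q : Set X} (hQ : IsCompact Q) {v : X → Y}
    (h : ∀ x ∈ Q, ∃ c, ∃ V ∈ 𝓝 x, HolderOnWith c α v V) : ∃ c, HolderOnWith c α v Q := by
  -- `α`-Hölder maps on `X` are Lipschitz maps on its snowflaking, for the same topology.
  let ψ : Metric.Snowflaking X α (NNReal.coe_pos.2 hα) (NNReal.coe_le_one.2 hα1) ≃ₜ X :=
    Metric.Snowflaking.homeomorph
  have hloc : LocallyLipschitzOn (ψ ⁻¹' Q) (v ∘ ψ) := fun x hx => by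
    obtain ⟨c, V, hV, hc⟩ := h (ψ x) hx
    exact ⟨c, ψ ⁻¹' V, mem_nhdsWithin_of_mem_nhds (ψ.continuous.continuousAt hV),
      fun a ha b hb => hc _ ha _ hb⟩
  obtain ⟨c, hc⟩ := hloc.exists_lipschitzOnWith_of_compact (ψ.isCompact_preimage.2 hQ)
  refine ⟨c, fun x hx y hy => ?_⟩
  exact hc (x := ψ.symm x) (by simpa using hx) (y := ψ.symm y) (by simpa using hy)

lemma holderOnWith_of_abs_sub_le [PseudoMetricSpace X] {α : ℝ≥0} {U : Set X} {v : X → ℝ} {L : ℝ}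
    (hL : 0 ≤ L) (h : ∀ x ∈ U, ∀ y ∈ U, |v x - v y| ≤ L * dist x y ^ (α : ℝ)) :
    HolderOnWith L.toNNReal α v U := by
  intro x hx y hy
  rw [edist_dist, edist_dist, Real.dist_eq, ENNReal.ofReal_rpow_of_nonneg dist_nonneg α.coe_nonneg,
    ← ENNReal.ofReal, ← ENNReal.ofReal_mul hL]
  exact ENNReal.ofReal_le_ofReal (h x hx y hy)

lemma holderSeminorm_le {n : ℕ} {α c : ℝ≥0} {U : Set (Eucl n)} {v : Eucl n → ℝ}
    (h : HolderOnWith c α v U) : holderSeminorm α U v ≤ c :=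
  (HolderWith.restrict_iff.2 h).eHolderNorm_le

end HolderOnWith

lemma le_mul_of_forall_gt {a b N₀ : ℝ} (h : ∀ N, N₀ < N → a ≤ b * N) : a ≤ b * N₀ :=
  have hlim : Filter.Tendsto (fun N : ℝ => b * N) (nhdsWithin N₀ (Ioi N₀)) (nhds (b * N₀)) :=
    ((continuous_const.mul continuous_id).tendsto N₀).mono_left nhdsWithin_le_nhds
  ge_of_tendsto hlim (Filter.eventually_of_mem self_mem_nhdsWithin h)

section WeakSolutions

variable {n : ℕ} {s p q f₀ R N : ℝ} {K : Eucl n → Eucl n → ℝ} {Ω : Set (Eucl n)}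
  {f u v : Eucl n → ℝ} {x₀ : Eucl n}

lemma ball_subset_of_le_infDist_frontier {E : Type*} [SeminormedAddCommGroup E] [NormedSpace ℝ E]
    {Ω : Set E} (hΩ : IsOpen Ω) {x : E} (hx : x ∈ Ω) {r : ℝ}
    (hr : r ≤ Metric.infDist x (frontier Ω)) : Metric.ball x r ⊆ Ω := by
  have hdisj : Disjoint (Metric.ball x r) (frontier Ω) :=
    (Metric.disjoint_ball_infDist (x := x)).mono_left (Metric.ball_subset_ball hr)
  rcases le_or_gt r 0 with hr0 | hr0
  · rw [Metric.ball_eq_empty.2 hr0]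
    exact empty_subset Ω
  refine (convex_ball x r).isPreconnected.subset_left_of_subset_union hΩ
    isClosed_closure.isOpen_compl (disjoint_compl_right.mono_left subset_closure) ?_
    ⟨x, Metric.mem_ball_self hr0, hx⟩
  intro y hy
  by_contra hcon
  rw [mem_union, not_or, mem_compl_iff, not_not] at hcon
  exact hdisj.notMem_of_mem_left hy (hΩ.frontier_eq ▸ ⟨hcon.2, hcon.1⟩)

lemma gagliardo_neg (s p : ℝ) (D : Set (Eucl n × Eucl n)) (u : Eucl n → ℝ) :
    gagliardo s p D (-u) = gagliardo s p D u :=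
  lintegral_congr fun z => by rw [Pi.neg_apply, Pi.neg_apply, neg_sub_neg, abs_sub_comm]

lemma IsWeakSolution.neg (h : IsWeakSolution s p K Ω f u) :
    IsWeakSolution s p K Ω (-f) (-u) := by
  refine ⟨⟨h.1.1.neg, h.1.2.1.neg, (gagliardo_neg s p _ u).trans_lt h.1.2.2⟩, fun φ hφ hsupp => ?_⟩
  have hform (z : Eucl n × Eucl n) : |(-u) z.1 - (-u) z.2| ^ (p - 2) * ((-u) z.1 - (-u) z.2) *
      (φ z.1 - φ z.2) * K z.1 z.2 = -(|u z.1 - u z.2| ^ (p - 2) * (u z.1 - u z.2) *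
      (φ z.1 - φ z.2) * K z.1 z.2) := by
    rw [Pi.neg_apply, Pi.neg_apply, neg_sub_neg, abs_sub_comm]
    ring
  simp_rw [hform, Pi.neg_apply, neg_mul]
  rw [integral_neg, integral_neg, mul_neg, h.2 φ hφ hsupp]

lemma ae_prod_eq_of_ae_eq (h : u =ᵐ[volume] v) :
    ∀ᵐ z : Eucl n × Eucl n, u z.1 = v z.1 ∧ u z.2 = v z.2 := by
  rw [Measure.volume_eq_prod]
  exact (Measure.quasiMeasurePreserving_fst.ae h).and (Measure.quasiMeasurePreserving_snd.ae h)

lemma IsWeakSolution.congr_ae (h : IsWeakSolution s p K Ω f u) (huv : u =ᵐ[volume] v) :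
    IsWeakSolution s p K Ω f v := by
  have hprod := ae_prod_eq_of_ae_eq huv
  refine ⟨⟨h.1.1.congr huv, h.1.2.1.ae_eq (ae_restrict_of_ae huv), ?_⟩, fun φ hφ hsupp => ?_⟩
  · refine (lintegral_congr_ae ?_).trans_lt h.1.2.2
    filter_upwards [ae_restrict_of_ae hprod] with z hz
    rw [hz.1, hz.2]
  · rw [← h.2 φ hφ hsupp]
    congr 1
    refine integral_congr_ae ?_
    filter_upwards [hprod] with z hz
    rw [hz.1, hz.2]

lemma HasSizeBound.congr_ae (h : HasSizeBound s p f₀ N u x₀ R) (huv : u =ᵐ[volume] v) :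
    HasSizeBound s p f₀ N v x₀ R where
  tail_le := by
    refine (lintegral_congr_ae ?_).trans_le h.tail_le
    filter_upwards [ae_restrict_of_ae huv] with x hx
    rw [hx]
  source_le := h.source_le
  energy_le := by
    refine (lintegral_congr_ae ?_).trans_le h.energy_le
    filter_upwards [ae_restrict_of_ae huv] with x hx
    rw [hx]

/-- The size of `u` and of the source bound `f₀` near the ball of radius `R` centred at `x₀`: the
right-hand side of the local Hölder estimate, without its constant. -/
noncomputable def localSize (s p f₀ : ℝ) (u : Eucl n → ℝ) (x₀ : Eucl n) (R : ℝ) : ℝ :=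
  (eLpNorm u (ENNReal.ofReal p) (volume.restrict (Metric.ball x₀ (2 * R)))).toReal /
    R ^ ((n : ℝ) / p) + tail s p u x₀ R + R ^ (s * p / (p - 1)) * f₀ ^ (1 / (p - 1))

lemma tail_nonneg (s p : ℝ) (u : Eucl n → ℝ) (x₀ : Eucl n) (hR : 0 ≤ R) : 0 ≤ tail s p u x₀ R :=
  Real.rpow_nonneg (mul_nonneg (Real.rpow_nonneg hR _)
    (integral_nonneg fun x => by positivity)) _

lemma localSize_nonneg (hf₀ : 0 ≤ f₀) (u : Eucl n → ℝ) (x₀ : Eucl n) (hR : 0 ≤ R) :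
    0 ≤ localSize s p f₀ u x₀ R := by
  have := tail_nonneg s p u x₀ hR
  unfold localSize
  positivity

lemma tail_rpow (hp : 1 < p) (hR : 0 ≤ R) (u : Eucl n → ℝ) (x₀ : Eucl n) :
    tail s p u x₀ R ^ (p - 1) = R ^ (s * p) * ∫ x in (Metric.ball x₀ R)ᶜ,
      |u x| ^ (p - 1) / ‖x - x₀‖ ^ ((n : ℝ) + s * p) := by
  have : 0 ≤ ∫ x in (Metric.ball x₀ R)ᶜ, |u x| ^ (p - 1) / ‖x - x₀‖ ^ ((n : ℝ) + s * p) :=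
    integral_nonneg fun x => by positivity
  rw [tail, one_div, Real.rpow_inv_rpow (by positivity) (by linarith)]

lemma one_add_norm_le_mul_norm_sub {E : Type*} [SeminormedAddCommGroup E] {x x₀ : E} (hR : 0 < R)
    (hx : R ≤ ‖x - x₀‖) : 1 + ‖x‖ ≤ ((1 + ‖x₀‖) / R + 1) * ‖x - x₀‖ := by
  have hx₀ : 1 + ‖x₀‖ ≤ (1 + ‖x₀‖) / R * ‖x - x₀‖ := by
    rw [div_mul_eq_mul_div, le_div_iff₀ hR]
    gcongr
  have := norm_le_norm_sub_add x x₀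
  linarith

lemma MemTailSpace.integrableOn_compl_ball (h : MemTailSpace s p u) (hsp : 0 ≤ s * p)
    (x₀ : Eucl n) (hR : 0 < R) :
    IntegrableOn (fun x => |u x| ^ (p - 1) / ‖x - x₀‖ ^ ((n : ℝ) + s * p))
      (Metric.ball x₀ R)ᶜ := by
  set q := (n : ℝ) + s * p
  set A := (1 + ‖x₀‖) / R + 1
  refine ((h.2.const_mul (A ^ q)).integrableOn (s := (Metric.ball x₀ R)ᶜ)).mono' ?_ ?_
  · have : AEMeasurable u (volume.restrict (Metric.ball x₀ R)ᶜ) := h.1.restrict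
    have hmeas : AEMeasurable (fun x => |u x| ^ (p - 1) / ‖x - x₀‖ ^ q)
        (volume.restrict (Metric.ball x₀ R)ᶜ) := by fun_prop
    exact hmeas.aestronglyMeasurable
  · filter_upwards [ae_restrict_mem measurableSet_ball.compl] with x hx
    rw [mem_compl_iff, mem_ball_iff_norm, not_lt] at hx
    have hx0 : 0 < ‖x - x₀‖ := hR.trans_le hx
    have hpow : (1 + ‖x‖) ^ q ≤ A ^ q * ‖x - x₀‖ ^ q := by
      rw [← Real.mul_rpow (by positivity) hx0.le]
      gcongr
      exact one_add_norm_le_mul_norm_sub hR hx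
    rw [Real.norm_of_nonneg (by positivity), mul_div_assoc',
      div_le_div_iff₀ (by positivity) (by positivity), mul_right_comm, mul_comm (_ ^ (p - 1))]
    gcongr

lemma MemTailSpace.lintegral_tail_eq (h : MemTailSpace s p u) (hsp : 0 ≤ s * p)
    (x₀ : Eucl n) (hR : 0 < R) :
    ∫⁻ x in (Metric.ball x₀ R)ᶜ, ENNReal.ofReal
      (|u x| ^ (p - 1) * ‖x - x₀‖ ^ (-((n : ℝ) + s * p))) =
    ENNReal.ofReal (∫ x in (Metric.ball x₀ R)ᶜ,
      |u x| ^ (p - 1) / ‖x - x₀‖ ^ ((n : ℝ) + s * p)) := by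
  rw [ofReal_integral_eq_lintegral_ofReal (h.integrableOn_compl_ball hsp x₀ hR)
    (.of_forall fun x => by positivity)]
  simp_rw [Real.rpow_neg (norm_nonneg _), ← div_eq_mul_inv]

lemma lintegral_abs_rpow_eq_ofReal {X : Type*} [MeasurableSpace X] {μ : Measure X} {u : X → ℝ}
    (hp : 0 < p) (hu : MemLp u (ENNReal.ofReal p) μ) :
    ∫⁻ x, ENNReal.ofReal (|u x| ^ p) ∂μ =
      ENNReal.ofReal ((eLpNorm u (ENNReal.ofReal p) μ).toReal ^ p) := by
  rw [← ENNReal.ofReal_rpow_of_nonneg ENNReal.toReal_nonneg hp.le, ENNReal.ofReal_toReal hu.2.ne,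
    eLpNorm_eq_eLpNorm' (ENNReal.ofReal_pos.2 hp).ne' ENNReal.ofReal_ne_top,
    ENNReal.toReal_ofReal hp.le, ← lintegral_rpow_enorm_eq_rpow_eLpNorm' hp]
  simp_rw [Real.enorm_eq_ofReal_abs, ENNReal.ofReal_rpow_of_nonneg (abs_nonneg _) hp.le]

lemma le_rpow_mul_rpow_neg {a b y : ℝ} (hq : 0 ≤ q) (hR : 0 < R) (ha : 0 ≤ a) (haN : a ≤ N)
    (hay : a ^ q = R ^ b * y) : y ≤ N ^ q * R ^ (-b) := by
  calc y = a ^ q * R ^ (-b) := by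
        rw [hay, mul_right_comm, ← Real.rpow_add hR, add_neg_cancel, Real.rpow_zero, one_mul]
    _ ≤ N ^ q * R ^ (-b) := by gcongr

lemma MemTailSpace.hasSizeBound (hut : MemTailSpace s p u) (hsp : 0 ≤ s * p) (hp : 1 < p)
    (hf₀ : 0 ≤ f₀) (hR : 0 < R)
    (huL : MemLp u (ENNReal.ofReal p) (volume.restrict (Metric.ball x₀ (2 * R))))
    (hN : localSize s p f₀ u x₀ R ≤ N) : HasSizeBound s p f₀ N u x₀ R := by
  have hp1 : 0 < p - 1 := by linarith
  have htail := tail_nonneg s p u x₀ hR.le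
  set a := (eLpNorm u (ENNReal.ofReal p) (volume.restrict (Metric.ball x₀ (2 * R)))).toReal with ha
  have hsource : 0 ≤ R ^ (s * p / (p - 1)) * f₀ ^ (1 / (p - 1)) := by positivity
  have henergy : 0 ≤ a / R ^ ((n : ℝ) / p) := by positivity
  rw [localSize, ← ha] at hN
  refine ⟨⟨?_, ?_⟩, ?_⟩
  · rw [hut.lintegral_tail_eq hsp x₀ hR]
    exact ENNReal.ofReal_le_ofReal
      (le_rpow_mul_rpow_neg hp1.le hR htail (by linarith) (tail_rpow hp hR.le u x₀))
  · refine le_rpow_mul_rpow_neg hp1.le hR hsource (by linarith) ?_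
    rw [Real.mul_rpow (by positivity) (by positivity), ← Real.rpow_mul hR.le, one_div,
      Real.rpow_inv_rpow hf₀ hp1.ne', div_mul_cancel₀ _ hp1.ne']
  · rw [lintegral_abs_rpow_eq_ofReal (by linarith) huL, ← ha]
    refine ENNReal.ofReal_le_ofReal ?_
    have haN : a ≤ N * R ^ ((n : ℝ) / p) := by
      rw [← div_le_iff₀ (by positivity)]
      linarith
    calc a ^ p ≤ (N * R ^ ((n : ℝ) / p)) ^ p := by gcongr
      _ = N ^ p * R ^ (n : ℝ) := by
        rw [Real.mul_rpow (by linarith) (by positivity), ← Real.rpow_mul hR.le,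
          div_mul_cancel₀ _ (by linarith)]

end WeakSolutions

section LocalEstimate

variable {n : ℕ} {s p Λ : ℝ}

lemma HasHolderDecay.congr_ae {X : Type*} [PseudoMetricSpace X] [MeasurableSpace X]
    {μ : Measure X} {α B r c : ℝ} {u v : X → ℝ} {z : X} (h : HasHolderDecay μ α B r u z c)
    (huv : u =ᵐ[μ] v) : HasHolderDecay μ α B r v z c := fun j => by
  filter_upwards [h j, ae_restrict_of_ae huv] with x hx hxv
  rwa [← hxv]

theorem exists_hasHolderDecay_preciseRep (hn : 1 ≤ n) (hs0 : 0 < s) (hs1 : s < 1) (hp : 1 < p)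
    (hΛ : 0 < Λ) :
    ∃ α C : ℝ, 0 < α ∧ α < 1 ∧ 1 ≤ C ∧
      ∀ {K : Eucl n → Eucl n → ℝ}, HasKernelBounds s p Λ K →
      ∀ {Ω : Set (Eucl n)}, MeasurableSet Ω →
      ∀ {f : Eucl n → ℝ} {f₀ : ℝ}, 0 ≤ f₀ → (∀ᵐ x ∂volume.restrict Ω, |f x| ≤ f₀) →
      ∀ {u : Eucl n → ℝ}, MemTailSpace s p u → IsWeakSolution s p K Ω f u →
      ∀ {x₀ z : Eucl n} {R N : ℝ}, 0 < R → Metric.ball x₀ (2 * R) ⊆ Ω →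
        localSize s p f₀ u x₀ R < N → z ∈ Metric.ball x₀ R →
        |preciseRep volume u z| ≤ C * N ∧
          HasHolderDecay volume α (C * N) (R / 2) u z (preciseRep volume u z) := by
  have hsp : 0 < s * p := by positivity
  obtain ⟨C₀, hC₀, hclass⟩ := exists_isDeGiorgi hn hs0 hs1 hp hΛ
  obtain ⟨α, C, hα, hα1, hC, hdecay⟩ :=
    IsDeGiorgi.exists_value_decay hn hsp hp (zero_lt_one.trans_le hC₀)
  refine ⟨α, C, hα, hα1, hC, ?_⟩
  intro K hK Ω hΩ f f₀ hf₀ hf u hut hu x₀ z R N hR hball hN hz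
  have hmk := hut.1.ae_eq_mk
  have hw := hu.congr_ae hmk
  have hwmeas := hut.1.measurable_mk
  have hf' : ∀ᵐ x ∂volume.restrict Ω, |(-f) x| ≤ f₀ := by
    simpa only [Pi.neg_apply, abs_neg] using hf
  have hsize := (hut.hasSizeBound hsp.le hp hf₀ hR
    (hu.1.2.1.mono_measure (Measure.restrict_mono hball le_rfl)) hN.le).congr_ae hmk
  obtain ⟨c, hc, hwc⟩ := hdecay (hclass K hK Ω hΩ f f₀ hf₀ hf _ hwmeas hw)
    (hclass K hK Ω hΩ (-f) f₀ hf₀ hf' _ hwmeas.neg hw.neg) hR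
    ((localSize_nonneg hf₀ u x₀ hR.le).trans_lt hN) hball hsize hz
  have huc := hwc.congr_ae hmk.symm
  rw [huc.preciseRep_eq hα (half_pos hR)]
  exact ⟨hc, huc⟩

theorem exists_preciseRep_bounds (hn : 1 ≤ n) (hs0 : 0 < s) (hs1 : s < 1) (hp : 1 < p)
    (hΛ : 0 < Λ) :
    ∃ α : ℝ≥0, 0 < α ∧ α < 1 ∧ ∃ C : ℝ, 1 ≤ C ∧
      ∀ {K : Eucl n → Eucl n → ℝ}, HasKernelBounds s p Λ K →
      ∀ {Ω : Set (Eucl n)}, IsOpen Ω →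
      ∀ {f : Eucl n → ℝ} {f₀ : ℝ}, 0 ≤ f₀ → (∀ᵐ x ∂volume.restrict Ω, |f x| ≤ f₀) →
      ∀ {u : Eucl n → ℝ}, MemTailSpace s p u → IsWeakSolution s p K Ω f u →
        preciseRep volume u =ᵐ[volume.restrict Ω] u ∧
        ∀ (x₀ : Eucl n) (R : ℝ), 0 < R → Metric.ball x₀ (2 * R) ⊆ Ω →
          (∀ x ∈ Metric.ball x₀ R, |preciseRep volume u x| ≤ C * localSize s p f₀ u x₀ R) ∧
          HolderOnWith (32 * C * localSize s p f₀ u x₀ R / R ^ (α : ℝ)).toNNReal α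
            (preciseRep volume u) (Metric.ball x₀ R) := by
  obtain ⟨α, C, hα, hα1, hC, hdecay⟩ := exists_hasHolderDecay_preciseRep hn hs0 hs1 hp hΛ
  refine ⟨⟨α, hα.le⟩, hα, hα1, C, hC, ?_⟩
  intro K hK Ω hΩ f f₀ hf₀ hf u hut hu
  have hvalue {x₀ z : Eucl n} {R N : ℝ} := hdecay hK hΩ.measurableSet hf₀ hf hut hu
    (x₀ := x₀) (z := z) (R := R) (N := N)
  refine ⟨ae_restrict_of_forall_exists_isOpen hΩ.measurableSet fun z hz => ?_, ?_⟩
  · obtain ⟨r, hr, hball⟩ := Metric.isOpen_iff.1 hΩ z hz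
    have hball' : Metric.ball z (2 * (r / 2)) ⊆ Ω := by rwa [mul_div_cancel₀ _ two_ne_zero]
    refine ⟨Metric.ball z (r / 2), Metric.isOpen_ball, Metric.mem_ball_self (half_pos hr), ?_⟩
    filter_upwards [ae_eq_of_hasHolderDecay Metric.isOpen_ball hα (half_pos (half_pos hr))
      fun y hy => (hvalue (half_pos hr) hball' (lt_add_one _) hy).2] with x hx _ using hx
  intro x₀ R hR hball
  refine ⟨fun x hx => le_mul_of_forall_gt fun N hN => (hvalue hR hball hN hx).1, ?_⟩
  have := localSize_nonneg (s := s) (p := p) hf₀ u x₀ hR.le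
  refine holderOnWith_of_abs_sub_le (by positivity) fun x hx y hy => ?_
  have h2 : (2 : ℝ) ^ α ≤ 2 := Real.rpow_le_self_of_one_le one_le_two hα1.le
  calc |preciseRep volume u x - preciseRep volume u y|
      ≤ 16 * C * (dist x y / (R / 2)) ^ α * localSize s p f₀ u x₀ R :=
        le_mul_of_forall_gt fun N hN => by
          obtain ⟨hx, hxd⟩ := hvalue hR hball hN hx
          obtain ⟨hy, hyd⟩ := hvalue hR hball hN hy
          exact (hxd.abs_sub_le hα hα1.le (half_pos hR) hyd hx hy).trans_eq (by ring)
    _ = 2 ^ α * (16 * C * (dist x y ^ α / R ^ α) * localSize s p f₀ u x₀ R) := by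
        rw [div_div_eq_mul_div, mul_div_right_comm, Real.mul_rpow (by positivity) zero_le_two,
          Real.div_rpow dist_nonneg hR.le]
        ring
    _ ≤ 2 * (16 * C * (dist x y ^ α / R ^ α) * localSize s p f₀ u x₀ R) := by gcongr
    _ = 32 * C * localSize s p f₀ u x₀ R / R ^ α * dist x y ^ α := by ring

lemma eLpNorm_top_add_holderSeminorm_le {α : ℝ≥0} {U : Set (Eucl n)} {u v : Eucl n → ℝ}
    {A H L : ℝ} (hU : MeasurableSet U) (hA : 0 ≤ A) (hH : 0 ≤ H) (hL : 0 < L)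
    (hvu : v =ᵐ[volume.restrict U] u) (hv : ∀ x ∈ U, |v x| ≤ A)
    (hvα : HolderOnWith (H / L).toNNReal α v U) :
    eLpNorm u ⊤ (volume.restrict U) + ENNReal.ofReal L * holderSeminorm α U v ≤
      ENNReal.ofReal (A + H) := by
  have hsup : eLpNorm u ⊤ (volume.restrict U) ≤ ENNReal.ofReal A := by
    rw [eLpNorm_exponent_top]
    refine eLpNormEssSup_le_of_ae_bound ?_
    filter_upwards [hvu, ae_restrict_mem hU] with x hx hxU
    rw [← hx]
    exact hv x hxU
  calc eLpNorm u ⊤ (volume.restrict U) + ENNReal.ofReal L * holderSeminorm α U v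
      ≤ ENNReal.ofReal A + ENNReal.ofReal L * ENNReal.ofReal (H / L) := by
        gcongr
        exact holderSeminorm_le hvα
    _ = ENNReal.ofReal (A + H) := by
        rw [← ENNReal.ofReal_mul hL.le, mul_div_cancel₀ _ hL.ne', ENNReal.ofReal_add hA hH]

lemma locallyHolder_of_forall_ball {α : ℝ≥0} (hα : 0 < α) (hα1 : α ≤ 1) {Ω : Set (Eucl n)}
    (hΩ : IsOpen Ω) {v : Eucl n → ℝ} (h : ∀ x₀ R, 0 < R → Metric.ball x₀ (2 * R) ⊆ Ω →
      ∃ c, HolderOnWith c α v (Metric.ball x₀ R)) : LocallyHolder α Ω v := by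
  refine fun Q hQ hQΩ => exists_holderOnWith_of_isCompact hα hα1 hQ fun x hx => ?_
  obtain ⟨r, hr, hball⟩ := Metric.isOpen_iff.1 hΩ x (hQΩ hx)
  obtain ⟨c, hc⟩ := h x (r / 2) (half_pos hr) (by rwa [mul_div_cancel₀ _ two_ne_zero])
  exact ⟨c, _, Metric.ball_mem_nhds x (half_pos hr), hc⟩

lemma ae_abs_le_of_toReal_eLpNorm_top_le {X : Type*} [MeasurableSpace X] {μ : Measure X}
    {f : X → ℝ} {f₀ : ℝ} (hf : MemLp f ⊤ μ) (hle : (eLpNorm f ⊤ μ).toReal ≤ f₀) :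
    ∀ᵐ x ∂μ, |f x| ≤ f₀ := by
  filter_upwards [ae_le_eLpNormEssSup (f := f) (μ := μ)] with x hx
  rw [← eLpNorm_exponent_top] at hx
  have := ENNReal.toReal_mono hf.2.ne hx
  rw [toReal_enorm, Real.norm_eq_abs] at this
  exact this.trans hle

end LocalEstimate

end NonlocalEq

theorem corollary4p3_general (n : ℕ) (hn : 1 ≤ n) (s p Λ : ℝ) (hs0 : 0 < s) (hs1 : s < 1)
    (hp : 1 < p) (hΛ : 0 < Λ) :
    ∃ α : ℝ≥0, 0 < α ∧ α < 1 ∧ ∃ C : ℝ, 1 ≤ C ∧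
      ∀ (Ω : Set (NonlocalEq.Eucl n)), IsOpen Ω →
      ∀ (K : NonlocalEq.Eucl n → NonlocalEq.Eucl n → ℝ), NonlocalEq.HasKernelBounds s p Λ K →
      ∀ (f : NonlocalEq.Eucl n → ℝ) (f₀ : ℝ), MemLp f ⊤ (volume.restrict Ω) →
        (eLpNorm f ⊤ (volume.restrict Ω)).toReal ≤ f₀ →
      ∀ (u : NonlocalEq.Eucl n → ℝ), NonlocalEq.MemTailSpace s p u →
        NonlocalEq.IsWeakSolution s p K Ω f u →
        ∃ v : NonlocalEq.Eucl n → ℝ, v =ᵐ[volume.restrict Ω] u ∧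
          NonlocalEq.LocallyHolder α Ω v ∧
          ∀ (x₀ : NonlocalEq.Eucl n) (R : ℝ), 0 < R → Metric.ball x₀ (2 * R) ⊆ Ω →
            eLpNorm u ⊤ (volume.restrict (Metric.ball x₀ R)) +
                ENNReal.ofReal (R ^ (α : ℝ)) *
                  NonlocalEq.holderSeminorm α (Metric.ball x₀ R) v ≤
              ENNReal.ofReal (C * NonlocalEq.localSize s p f₀ u x₀ R) := by
  obtain ⟨α, hα, hα1, C, hC, hbounds⟩ :=
    NonlocalEq.exists_preciseRep_bounds hn hs0 hs1 hp hΛ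
  refine ⟨α, hα, hα1, 33 * C, by linarith, ?_⟩
  intro Ω hΩ K hK f f₀ hf hff u hut hu
  have hf₀ : 0 ≤ f₀ := ENNReal.toReal_nonneg.trans hff
  obtain ⟨hae, hb⟩ := hbounds hK hΩ hf₀
    (NonlocalEq.ae_abs_le_of_toReal_eLpNorm_top_le hf hff) hut hu
  refine ⟨NonlocalEq.preciseRep volume u, hae, NonlocalEq.locallyHolder_of_forall_ball hα hα1.le hΩ
    fun x₀ R hR hball => ⟨_, (hb x₀ R hR hball).2⟩, fun x₀ R hR hball => ?_⟩
  obtain ⟨hsup, hholder⟩ := hb x₀ R hR hball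
  have := NonlocalEq.localSize_nonneg (s := s) (p := p) hf₀ u x₀ hR.le
  have hsub : Metric.ball x₀ R ⊆ Ω := (Metric.ball_subset_ball (by linarith)).trans hball
  refine (NonlocalEq.eLpNorm_top_add_holderSeminorm_le measurableSet_ball (by positivity)
    (by positivity) (by positivity) (ae_restrict_of_ae_restrict_of_subset hsub hae)
    hsup hholder).trans_eq ?_
  congr 1
  ring

theorem corollary4p3 (n : ℕ) (hn : 1 ≤ n) (s p Λ : ℝ) (hs0 : 0 < s) (hs1 : s < 1)
    (hp : 1 < p) (hΛ : 1 ≤ Λ) :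
    ∃ α : ℝ≥0, 0 < α ∧ α < 1 ∧ ∃ C : ℝ, 1 ≤ C ∧
      ∀ (Ω : Set (NonlocalEq.Eucl n)), IsOpen Ω → Bornology.IsBounded Ω →
      ∀ (K : NonlocalEq.Eucl n → NonlocalEq.Eucl n → ℝ), NonlocalEq.IsKernel s p Λ K →
      ∀ (f : NonlocalEq.Eucl n → ℝ) (f₀ : ℝ), MemLp f ⊤ (volume.restrict Ω) →
        (eLpNorm f ⊤ (volume.restrict Ω)).toReal ≤ f₀ →
      ∀ (u : NonlocalEq.Eucl n → ℝ), NonlocalEq.MemTailSpace s p u →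
        NonlocalEq.IsWeakSolution s p K Ω f u →
        ∃ v : NonlocalEq.Eucl n → ℝ, v =ᵐ[volume.restrict Ω] u ∧
          NonlocalEq.LocallyHolder α Ω v ∧
          ∀ x₀ ∈ Ω, ∀ R : ℝ, 0 < R → R < Metric.infDist x₀ (frontier Ω) / 2 →
            eLpNorm u ⊤ (volume.restrict (Metric.ball x₀ R)) +
                ENNReal.ofReal (R ^ (α : ℝ)) *
                  NonlocalEq.holderSeminorm α (Metric.ball x₀ R) v ≤
              ENNReal.ofReal (C *
                ((eLpNorm u (ENNReal.ofReal p)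
                    (volume.restrict (Metric.ball x₀ (2 * R)))).toReal / R ^ ((n : ℝ) / p) +
                  NonlocalEq.tail s p u x₀ R +
                  R ^ (s * p / (p - 1)) * f₀ ^ (1 / (p - 1)))) := by
  obtain ⟨α, hα, hα1, C, hC, h⟩ :=
    corollary4p3_general n hn s p Λ hs0 hs1 hp (zero_lt_one.trans_le hΛ)
  refine ⟨α, hα, hα1, C, hC, fun Ω hΩ _ K hK f f₀ hf hff u hut hu => ?_⟩
  obtain ⟨v, hvu, hv, hest⟩ := h Ω hΩ K hK.hasKernelBounds f f₀ hf hff u hut hu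
  exact ⟨v, hvu, hv, fun x₀ hx₀ R hR hRd => hest x₀ R hR
    (NonlocalEq.ball_subset_of_le_infDist_frontier hΩ hx₀ (by linarith))⟩
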